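/- Let $\alpha_0,\beta_0,\alpha_+,\alpha_-,\beta\in\mathbb{C}$ satisfy $|\alpha_0|^2+|\beta_0|^2=|\alpha_\pm|^2+|\beta|^2=1$, $\alpha_0\neq 0$, and $0<\rho:=|\alpha_+|=|\alpha_-|<1$. Put $$C_0=\begin{bmatrix}\alpha_0&\beta_0\\-\overline{\beta_0}&\overline{\alpha_0}\end{bmatrix},\qquad C_\pm=\begin{bmatrix}\alpha_\pm&\beta\\-\overline{\beta}&\overline{\alpha_\pm}\end{bmatrix},\qquad s=\mathrm{Re}(\beta_0\overline{\beta}),\quad t=\mathrm{Im}(\beta_0\overline{\beta}),$$ and assume $|s|<|\beta|^2$. Let $\mathcal{C}(x)=C_+$ for $x\ge 1$, $\mathcal{C}(0)=C_0$, $\mathcal{C}(x)=C_-$ for $x\le -1$, and let $U$ be the quantum walk on $\ell^2(\mathbb{Z},\mathbb{C}^2)$, $$(U\Psi)(x)=\pi_L\,\mathcal{C}(x+1)\Psi(x+1)+\pi_R\,\mathcal{C}(x-1)\Psi(x-1),$$ where $\pi_L,\pi_R$ are the projections of $\mathbb{C}^2$ onto the first and second coordinate axis. Write $\mathcal{C}(x)=\begin{bmatrix}a_x&b_x\\c_x&d_x\end{bmatrix}$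 and, for $\lambda\in\mathbb{C}\setminus\{0\}$, $$T_\lambda(x)=\begin{bmatrix}\frac{1}{a_{x+1}}(\lambda-\lambda^{-1}c_xb_{x+1})&-\lambda^{-1}\frac{b_{x+1}d_x}{a_{x+1}}\\ \lambda^{-1}c_x&\lambda^{-1}d_x\end{bmatrix},$$ $F_\lambda(0)=I$, $F_\lambda(x)=T_\lambda(x-1)\cdots T_\lambda(0)$ for $x\ge1$, $F_\lambda(x)=T_\lambda(x)^{-1}\cdots T_\lambda(-1)^{-1}$ for $x\le-1$. For finitely supported $f:\mathbb{Z}\to\mathbb{C}^2$ let $\widehat f(\lambda)=\sum_x F_{1/\overline{\lambda}}(x)^*f(x)$. Then there is exactly one positive-matrix-valued (positive semidefinite $2\times2$ matrix valued, countably additive) Borel measure $\Sigma$ on $S^1$ such that, with inner products linear in the first variable, $$\langle (U-\lambda)^{-1}f,g\rangle=\int_{S^1}\frac{1}{\zeta-\lambda}\,\langle d\Sigma(\zeta)\widehat f(\zeta),\widehat g(\zeta)\rangle_{\mathbb{C}^2}$$ for all finitely supported $f,g$ and all $\lambda\in\mathbb{C}$ with $|\lambda|\neq1$, and it is given as follows.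 Put $$x_*=\frac{1-s}{\sqrt{2-2s-\rho^2}},\qquad y_*=\sqrt{1-x_*^2}=\sqrt{\frac{1-\rho^2-s^2}{2-2s-\rho^2}},\qquad \zeta_*=x_*+iy_*,$$ $S=\{\zeta\in S^1:|\mathrm{Re}\,\zeta|\le\rho\}$, and let $\chi_S$ be the indicator function of $S$ and $d\bar{}\,\zeta$ the Lebesgue measure on $S^1$ with total mass one. Then $\rho<x_*<1$, the four points $\pm\zeta_*,\pm\overline{\zeta_*}\in S^1$ are eigenvalues of $U$, and, with $\zeta=x+iy$, $$\begin{aligned}d\Sigma(\zeta)={}&\frac{\sqrt{\rho^2-x^2}}{(1-s)^2-(2-2s-\rho^2)x^2}\begin{bmatrix}(1-s)|y|+\mathrm{sgn}(y)tx&-i\,\mathrm{sgn}(y)\overline{\alpha_0}\beta x\\ i\,\mathrm{sgn}(y)\alpha_0\overline{\beta}x&(1-s)|y|-\mathrm{sgn}(y)tx\end{bmatrix}\chi_S(\zeta)\,d\bar{}\,\zeta\\ &+\frac{x_*\sqrt{x_*^2-\rho^2}}{2y_*(1-s)^2}\begin{bmatrix}(1-s)y_*+tx_*&-i\overline{\alpha_0}\beta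 x_*\\ i\alpha_0\overline{\beta}x_*&(1-s)y_*-tx_*\end{bmatrix}(\delta_{\zeta_*}+\delta_{-\zeta_*})\\ &+\frac{x_*\sqrt{x_*^2-\rho^2}}{2y_*(1-s)^2}\begin{bmatrix}(1-s)y_*-tx_*&i\overline{\alpha_0}\beta x_*\\ -i\alpha_0\overline{\beta}x_*&(1-s)y_*+tx_*\end{bmatrix}(\delta_{\overline{\zeta_*}}+\delta_{-\overline{\zeta_*}}).\end{aligned}$$ -/

import Mathlib

open MeasureTheory
open scoped ComplexConjugate ComplexOrder

noncomputable section

/-- The Borel σ-algebra on the unit circle. -/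
instance Circle.instMeasurableSpaceBorel : MeasurableSpace Circle := borel Circle

instance Circle.instBorelSpaceBorel : BorelSpace Circle := ⟨rfl⟩

namespace QW

/-- `ℂ²` with its standard Hermitian inner product; coordinate `0` is `L`, coordinate `1` is `R`. -/
abbrev Spin : Type := EuclideanSpace ℂ (Fin 2)

/-- Complex `2 × 2` matrices. -/
abbrev Mat : Type := Matrix (Fin 2) (Fin 2) ℂ

/-- A coin matrix: a map from `ℤ` to `U(2)`. -/
abbrev Coin : Type := ℤ → Matrix.unitaryGroup (Fin 2) ℂ

/-- The Hilbert space `ℓ²(ℤ, ℂ²)`. -/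
abbrev L2 : Type := lp (fun _ : ℤ => Spin) 2

/-! ### The walk -/

/-- `(U(C)ψ)(x) = π_L C(x+1) ψ(x+1) + π_R C(x-1) ψ(x-1)` on arbitrary maps `ℤ → ℂ²`. -/
def walkMap (C : Coin) (ψ : ℤ → Spin) (x : ℤ) : Spin :=
  !₂[((C (x + 1) : Mat).mulVec (ψ (x + 1)).ofLp) 0, ((C (x - 1) : Mat).mulVec (ψ (x - 1)).ofLp) 1]

theorem norm_sq_mulVec (A : Matrix.unitaryGroup (Fin 2) ℂ) (v : Spin) :
    ‖((A : Mat).mulVec v.ofLp) 0‖ ^ 2 + ‖((A : Mat).mulVec v.ofLp) 1‖ ^ 2 = ‖v‖ ^ 2 := by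
  have h := (Matrix.mem_unitaryGroup_iff'.mp A.2)
  have h1 : (star ((A : Mat).mulVec v.ofLp)) ⬝ᵥ ((A : Mat).mulVec v.ofLp)
      = star v.ofLp ⬝ᵥ v.ofLp := by
    rw [Matrix.star_mulVec, ← Matrix.dotProduct_mulVec, Matrix.mulVec_mulVec,
      ← Matrix.star_eq_conjTranspose, h, Matrix.one_mulVec]
  simp only [dotProduct, Fin.sum_univ_two, Pi.star_apply, RCLike.star_def,
    Complex.conj_mul'] at h1
  rw [EuclideanSpace.norm_sq_eq, Fin.sum_univ_two]
  exact_mod_cast h1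

theorem norm_sq_walkMap_le (C : Coin) (ψ : ℤ → Spin) (x : ℤ) :
    ‖walkMap C ψ x‖ ^ 2 ≤ ‖ψ (x + 1)‖ ^ 2 + ‖ψ (x - 1)‖ ^ 2 := by
  rw [EuclideanSpace.norm_sq_eq, Fin.sum_univ_two]
  have h1 := norm_sq_mulVec (C (x + 1)) (ψ (x + 1))
  have h2 := norm_sq_mulVec (C (x - 1)) (ψ (x - 1))
  simp only [walkMap, PiLp.toLp_apply, Matrix.cons_val_zero, Matrix.cons_val_one]
  have h3 := sq_nonneg ‖((C (x + 1) : Mat).mulVec (ψ (x + 1)).ofLp) 1‖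
  have h4 := sq_nonneg ‖((C (x - 1) : Mat).mulVec (ψ (x - 1)).ofLp) 0‖
  linarith

theorem walkMap_add (C : Coin) (ψ φ : ℤ → Spin) (x : ℤ) :
    walkMap C (ψ + φ) x = walkMap C ψ x + walkMap C φ x := by
  ext i
  fin_cases i <;> simp [walkMap, Matrix.mulVec_add]

theorem walkMap_smul (C : Coin) (c : ℂ) (ψ : ℤ → Spin) (x : ℤ) :
    walkMap C (c • ψ) x = c • walkMap C ψ x := by
  ext i
  fin_cases i <;> simp [walkMap, Matrix.mulVec_smul]

theorem summable_norm_sq (ψ : L2) : Summable fun x : ℤ => ‖ψ x‖ ^ 2 := by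
  have h := (memℓp_gen_iff (p := 2) (by norm_num)).mp (lp.memℓp ψ)
  simpa using h

theorem norm_sq_eq_tsum (ψ : L2) : ‖ψ‖ ^ 2 = ∑' x : ℤ, ‖ψ x‖ ^ 2 := by
  have h := lp.norm_rpow_eq_tsum (p := 2) (by norm_num) ψ
  simpa using h

theorem summable_shift_add (ψ : L2) : Summable fun x : ℤ => ‖ψ (x + 1)‖ ^ 2 :=
  (Equiv.addRight (1 : ℤ)).summable_iff.mpr (summable_norm_sq ψ)

theorem summable_shift_sub (ψ : L2) : Summable fun x : ℤ => ‖ψ (x - 1)‖ ^ 2 :=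
  (Equiv.subRight (1 : ℤ)).summable_iff.mpr (summable_norm_sq ψ)

theorem summable_shift (ψ : L2) :
    Summable fun x : ℤ => ‖ψ (x + 1)‖ ^ 2 + ‖ψ (x - 1)‖ ^ 2 :=
  (summable_shift_add ψ).add (summable_shift_sub ψ)

theorem tsum_shift (ψ : L2) :
    ∑' x : ℤ, (‖ψ (x + 1)‖ ^ 2 + ‖ψ (x - 1)‖ ^ 2) = ‖ψ‖ ^ 2 + ‖ψ‖ ^ 2 := by
  have h := (summable_shift_add ψ).tsum_add (summable_shift_sub ψ)
  have h1 := (Equiv.addRight (1 : ℤ)).tsum_eq (fun x => ‖ψ x‖ ^ 2)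
  have h2 := (Equiv.subRight (1 : ℤ)).tsum_eq (fun x => ‖ψ x‖ ^ 2)
  rw [norm_sq_eq_tsum]
  exact h.trans (congrArg₂ (· + ·) h1 h2)

theorem summable_walkMap (C : Coin) (ψ : L2) :
    Summable fun x : ℤ => ‖walkMap C ψ x‖ ^ 2 :=
  (summable_shift ψ).of_nonneg_of_le (fun _ => sq_nonneg _) (norm_sq_walkMap_le C ψ)

theorem memℓp_walkMap (C : Coin) (ψ : L2) : Memℓp (walkMap C ψ) 2 :=
  memℓp_gen (by simpa using summable_walkMap C ψ)

/-- The walk `U` as a bounded operator on `ℓ²(ℤ, ℂ²)`: the restriction of `walkMap C`. -/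
def walk (C : Coin) : L2 →L[ℂ] L2 :=
  LinearMap.mkContinuous
    { toFun := fun ψ => ⟨walkMap C ψ, memℓp_walkMap C ψ⟩
      map_add' := by
        intro ψ φ
        exact Subtype.ext (funext fun x => walkMap_add C ψ φ x)
      map_smul' := by
        intro c ψ
        exact Subtype.ext (funext fun x => walkMap_smul C c ψ x) }
    2 (by
      intro ψ
      refine le_of_sq_le_sq ?_ (by positivity)
      have h : ‖(⟨walkMap C ψ, memℓp_walkMap C ψ⟩ : L2)‖ ^ 2 ≤ ‖ψ‖ ^ 2 + ‖ψ‖ ^ 2 := by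
        rw [norm_sq_eq_tsum, ← tsum_shift]
        exact (summable_walkMap C ψ).tsum_le_tsum (norm_sq_walkMap_le C ψ) (summable_shift ψ)
      refine h.trans ?_
      nlinarith [sq_nonneg ‖ψ‖])

theorem walk_apply (C : Coin) (ψ : L2) (x : ℤ) : walk C ψ x = walkMap C ψ x := rfl

/-- The resolvent `R(λ) = (U - λ)⁻¹` (only used where `U - λ` is invertible). -/
def walkResolvent (C : Coin) (z : ℂ) : L2 →L[ℂ] L2 :=
  Ring.inverse (walk C - z • ContinuousLinearMap.id ℂ L2)

/-! ### Transfer matrices and the QW-Fourier transform -/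

/-- The transfer matrix `T_λ(x)`, where `C(x) = [[a_x, b_x], [c_x, d_x]]`. -/
def transfer (C : Coin) (z : ℂ) (x : ℤ) : Mat :=
  let a (y : ℤ) : ℂ := (C y : Mat) 0 0
  let b (y : ℤ) : ℂ := (C y : Mat) 0 1
  let c (y : ℤ) : ℂ := (C y : Mat) 1 0
  let d (y : ℤ) : ℂ := (C y : Mat) 1 1
  !![(a (x + 1))⁻¹ * (z - z⁻¹ * c x * b (x + 1)), -z⁻¹ * (b (x + 1) * d x / a (x + 1));
     z⁻¹ * c x, z⁻¹ * d x]

/-- `T_λ(n-1) ⋯ T_λ(1) T_λ(0)`. -/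
def fundamentalPos (C : Coin) (z : ℂ) : ℕ → Mat
  | 0 => 1
  | n + 1 => transfer C z n * fundamentalPos C z n

/-- `T_λ(-n)⁻¹ ⋯ T_λ(-2)⁻¹ T_λ(-1)⁻¹`. -/
def fundamentalNeg (C : Coin) (z : ℂ) : ℕ → Mat
  | 0 => 1
  | n + 1 => (transfer C z (-((n : ℤ) + 1)))⁻¹ * fundamentalNeg C z n

/-- The matrices `F_λ(x)`, `x ∈ ℤ`. -/
def fundamental (C : Coin) (z : ℂ) (x : ℤ) : Mat :=
  if 0 ≤ x then fundamentalPos C z x.toNat else fundamentalNeg C z (-x).toNat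

/-- The QW-Fourier transform `f̂(λ) = ∑ₓ F_{λ*}(x)* f(x)`, `λ* = 1 / conj λ`, of a finitely
supported `f`. -/
def fourier (C : Coin) (f : ℤ →₀ Spin) (z : ℂ) : Spin :=
  ∑ x ∈ f.support,
    WithLp.toLp 2 ((fundamental C (conj z)⁻¹ x).conjTranspose.mulVec (f x).ofLp)

/-- A finitely supported function as an element of `ℓ²(ℤ, ℂ²)`. -/
def toL2 (f : ℤ →₀ Spin) : L2 := ∑ x ∈ f.support, lp.single 2 x (f x)

theorem toL2_apply (f : ℤ →₀ Spin) (x : ℤ) : toL2 f x = f x := by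
  classical
  simp only [toL2, lp.coeFn_sum, Finset.sum_apply, lp.single_apply, Finset.sum_pi_single]
  by_cases hx : x ∈ f.support
  · simp [hx]
  · simp only [hx, if_false]
    exact (Finsupp.notMem_support_iff.mp hx).symm

/-! ### Matrix-valued measures on the circle -/

/-- A countably additive matrix-valued set function on the Borel sets of the circle. -/
abbrev MatMeasure : Type := VectorMeasure Circle Mat

/-- The complex measure `M_{ij}`. -/
def MatMeasure.entry (M : MatMeasure) (i j : Fin 2) : ComplexMeasure Circle :=
  M.mapRange (Matrix.entryAddMonoidHom ℂ i j) (continuous_id.matrix_elem i j)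

/-- All values are positive semidefinite Hermitian matrices. -/
def MatMeasure.IsPositive (M : MatMeasure) : Prop :=
  ∀ A : Set Circle, MeasurableSet A → (M A).PosSemidef

/-- `∫ k(ζ) ⟨dM(ζ) u(ζ), v(ζ)⟩ = ∑_{i,j} ∫ k(ζ) u_j(ζ) conj (v_i(ζ)) dM_{ij}(ζ)`
(the inner product is linear in the first variable). -/
def MatMeasure.sesqIntegral (M : MatMeasure) (k : Circle → ℂ) (u v : Circle → Spin) : ℂ :=
  ∑ i : Fin 2, ∑ j : Fin 2,
    (M.entry i j).integral (fun ζ => k ζ * u ζ j * conj (v ζ i)) (ContinuousLinearMap.mul ℝ ℂ)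

/-- `M` is a positive-matrix-valued measure representing the resolvent of the walk:
`⟨R(λ) f, g⟩ = ∫ (ζ - λ)⁻¹ ⟨dM(ζ) f̂(ζ), ĝ(ζ)⟩` for finitely supported `f`, `g` and `|λ| ≠ 1`.
Mathlib's `inner` is linear in the second variable, whence the order `inner ℂ g (R f)`. -/
def IsSpectralMatrixMeasure (C : Coin) (M : MatMeasure) : Prop :=
  M.IsPositive ∧
    ∀ z : ℂ, ‖z‖ ≠ 1 → ∀ f g : ℤ →₀ Spin,
      inner ℂ (toL2 g) (walkResolvent C z (toL2 f)) =
        M.sesqIntegral (fun ζ => ((ζ : ℂ) - z)⁻¹)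
          (fun ζ => fourier C f (ζ : ℂ)) (fun ζ => fourier C g (ζ : ℂ))

/-- Lebesgue measure on the circle with total mass one. -/
def circleLebesgue : Measure Circle :=
  (ENNReal.ofReal (2 * Real.pi))⁻¹ •
    (volume.restrict (Set.Ioc (-Real.pi) Real.pi)).map Circle.exp

/-- The Dirac mass at `ζ₀`, as a complex number attached to the set `A`. -/
def diracMass (ζ₀ : Circle) (A : Set Circle) : ℂ := A.indicator (fun _ => 1) ζ₀

/-! ### The simplest two-phase model -/

/-- The special unitary matrix `[[α, β], [-conj β, conj α]]`, `|α|² + |β|² = 1`. -/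
def suCoin (α β : ℂ) (h : ‖α‖ ^ 2 + ‖β‖ ^ 2 = 1) : Matrix.unitaryGroup (Fin 2) ℂ :=
  ⟨!![α, β; -conj β, conj α], by
    have h' : α * conj α + β * conj β = 1 := by
      rw [Complex.mul_conj', Complex.mul_conj']
      exact_mod_cast h
    rw [Matrix.mem_unitaryGroup_iff]
    ext i j
    fin_cases i <;> fin_cases j <;>
      simp [Matrix.mul_apply, Fin.sum_univ_two, Matrix.star_eq_conjTranspose] <;>
      first | linear_combination h' | ring1⟩

/-- The two-phase coin with one defect: `Cp` for `x ≥ 1`, `C0` at `x = 0`, `Cm` for `x ≤ -1`. -/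
def twoPhaseCoin (Cp C0 Cm : Matrix.unitaryGroup (Fin 2) ℂ) : Coin :=
  fun x => if 1 ≤ x then Cp else if x = 0 then C0 else Cm

end QW

end

/-!
The walk `U` is unitary, so its resolvent `R(z)` exists for `|z| ≠ 1`. Two facts reduce the theorem to
the `2 × 2` block `G(z) = (δ₀ e_i, R(z) δ₀ e_j)` of the resolvent at the origin.

* The columns of `F_ζ` are generalized eigenfunctions of `U`, so that `f ↦ f̂` intertwines `U` with
  multiplication by `ζ` (`circleFourier_stepSingle`). Since all diagonal entries of the coins are
  nonzero, every finitely supported `f` is a combination of the vectors `Uⁿ δ₀ e_j`, and `f̂` is the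
  same combination of the functions `ζⁿ e_j` (`fourierPair_mem`). Hence a positive matrix measure
  represents the resolvent as soon as its Cauchy transform is `G`
  (`isSpectralMatrixMeasure_of_origin`).
* A complex measure on the circle is determined by its Cauchy transform off the circle
  (`complexMeasure_ext_of_cauchy`), because Laurent polynomials are dense in the continuous
  functions and lie in every closed subspace that contains the Cauchy kernels
  (`mem_of_resolvent_mem`). This gives uniqueness.

For the two-phase coin, the solution of `(U - z) ψ = δ₀ v` has geometric tails whose rate `κ` is the
root in the unit disc of `z + 1/z = ρ (κ + 1/κ)`. Solving the remaining equations at the origin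
gives `G(z)` explicitly (`walkResolvent_origin`), and the same tails with `v = 0` give the
eigenvectors (`hasEigenvalue_walk`).

It remains to compute the Cauchy transform of the measure in the theorem. Folding the circle onto
`x = Re ζ` turns it into an integral over `[-ρ, ρ]` of `√(ρ² - x²)` times a rational function with
poles `±x_*` and `(z + 1/z) / 2`. Partial fractions reduce it to the Stieltjes transform of the
semicircle law (`integral_semicircle`), which is a mean value property on the circle. The residues
at `±x_*` are completed by the four point masses, and the sum is `G`
(`cauchy_transform_density`, `integralCLM_spectralMeasure`). Positivity holds because the
determinant of the matrix weight is `(1 - s)² - (2 - 2s - ρ²) x²`, which is positive for `|x| ≤ ρ`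
and zero at `±x_*`.
-/

noncomputable section
namespace QW

/-! ### Unitarity of the walk and its resolvent -/

theorem norm_sq_walkMap (C : Coin) (ψ : ℤ → Spin) (x : ℤ) :
    ‖walkMap C ψ x‖ ^ 2 = ‖((C (x + 1) : Mat).mulVec (ψ (x + 1)).ofLp) 0‖ ^ 2
      + ‖((C (x - 1) : Mat).mulVec (ψ (x - 1)).ofLp) 1‖ ^ 2 := by
  rw [EuclideanSpace.norm_sq_eq, Fin.sum_univ_two]
  simp [walkMap]

theorem norm_walk (C : Coin) (ψ : L2) : ‖walk C ψ‖ = ‖ψ‖ := by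
  have key : ‖walk C ψ‖ ^ 2 = ‖ψ‖ ^ 2 := by
    have hle (i : Fin 2) (x : ℤ) : ‖((C x : Mat).mulVec (ψ x).ofLp) i‖ ^ 2 ≤ ‖ψ x‖ ^ 2 := by
      have h := norm_sq_mulVec (C x) (ψ x)
      have h0 := sq_nonneg ‖((C x : Mat).mulVec (ψ x).ofLp) 0‖
      have h1 := sq_nonneg ‖((C x : Mat).mulVec (ψ x).ofLp) 1‖
      fin_cases i <;> simp only [Fin.zero_eta, Fin.mk_one] <;> linarith
    have hs (i : Fin 2) : Summable fun x : ℤ => ‖((C x : Mat).mulVec (ψ x).ofLp) i‖ ^ 2 :=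
      (summable_norm_sq ψ).of_nonneg_of_le (fun _ => sq_nonneg _) (hle i)
    have e0 := (Equiv.addRight (1 : ℤ)).tsum_eq
      (fun x => ‖((C x : Mat).mulVec (ψ x).ofLp) 0‖ ^ 2)
    have e1 := (Equiv.subRight (1 : ℤ)).tsum_eq
      (fun x => ‖((C x : Mat).mulVec (ψ x).ofLp) 1‖ ^ 2)
    have s0 := (Equiv.addRight (1 : ℤ)).summable_iff.mpr (hs 0)
    have s1 := (Equiv.subRight (1 : ℤ)).summable_iff.mpr (hs 1)
    rw [norm_sq_eq_tsum, norm_sq_eq_tsum]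
    calc ∑' x, ‖walk C ψ x‖ ^ 2
        = ∑' x, (‖((C (x + 1) : Mat).mulVec (ψ (x + 1)).ofLp) 0‖ ^ 2
            + ‖((C (x - 1) : Mat).mulVec (ψ (x - 1)).ofLp) 1‖ ^ 2) :=
          tsum_congr fun x => norm_sq_walkMap C ψ x
      _ = _ := s0.tsum_add s1
      _ = ∑' x, ‖((C x : Mat).mulVec (ψ x).ofLp) 0‖ ^ 2
            + ∑' x, ‖((C x : Mat).mulVec (ψ x).ofLp) 1‖ ^ 2 := congrArg₂ (· + ·) e0 e1
      _ = ∑' x, ‖ψ x‖ ^ 2 := by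
          rw [← (hs 0).tsum_add (hs 1)]
          exact tsum_congr fun x => norm_sq_mulVec (C x) (ψ x)
  exact (sq_eq_sq₀ (norm_nonneg _) (norm_nonneg _)).mp key

/-- The inverse of the walk on arbitrary maps `ℤ → ℂ²`:
`(U⁻¹ φ)(x) = C(x)* (φ_L(x - 1), φ_R(x + 1))`. -/
def walkInvMap (C : Coin) (φ : ℤ → Spin) (x : ℤ) : Spin :=
  WithLp.toLp 2 (((star (C x) : Matrix.unitaryGroup (Fin 2) ℂ) : Mat).mulVec
    ![φ (x - 1) 0, φ (x + 1) 1])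

theorem walkMap_walkInvMap (C : Coin) (φ : ℤ → Spin) : walkMap C (walkInvMap C φ) = φ := by
  have h (y : ℤ) (v : Fin 2 → ℂ) : (C y : Mat).mulVec (((star (C y) :
      Matrix.unitaryGroup (Fin 2) ℂ) : Mat).mulVec v) = v := by
    rw [Matrix.mulVec_mulVec]
    exact (congrArg (fun A : Mat => A.mulVec v) (Matrix.mem_unitaryGroup_iff.mp (C y).2)).trans
      (Matrix.one_mulVec v)
  funext x
  ext i
  fin_cases i <;> simp only [walkMap, walkInvMap, h] <;> simp

theorem norm_sq_walkInvMap_le (C : Coin) (φ : ℤ → Spin) (x : ℤ) :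
    ‖walkInvMap C φ x‖ ^ 2 ≤ ‖φ (x + 1)‖ ^ 2 + ‖φ (x - 1)‖ ^ 2 := by
  have h := norm_sq_mulVec (star (C x)) !₂[φ (x - 1) 0, φ (x + 1) 1]
  have h1 : ‖φ (x - 1) 0‖ ^ 2 ≤ ‖φ (x - 1)‖ ^ 2 := by
    gcongr
    exact PiLp.norm_apply_le _ _
  have h2 : ‖φ (x + 1) 1‖ ^ 2 ≤ ‖φ (x + 1)‖ ^ 2 := by
    gcongr
    exact PiLp.norm_apply_le _ _
  rw [EuclideanSpace.norm_sq_eq, Fin.sum_univ_two] at h ⊢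
  simp only [walkInvMap, PiLp.toLp_apply] at h ⊢
  rw [h]
  simp only [Matrix.cons_val_zero, Matrix.cons_val_one]
  linarith

theorem walk_surjective (C : Coin) : Function.Surjective (walk C) := by
  intro φ
  have hmem : Memℓp (walkInvMap C φ) 2 := memℓp_gen (by
    simpa using (summable_shift φ).of_nonneg_of_le (fun _ => sq_nonneg _)
      (norm_sq_walkInvMap_le C φ))
  exact ⟨⟨walkInvMap C φ, hmem⟩, Subtype.ext (walkMap_walkInvMap C φ)⟩

theorem walk_mem_unitary (C : Coin) : walk C ∈ unitary (L2 →L[ℂ] L2) := by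
  have h1 : star (walk C) * walk C = 1 := by
    have := (ContinuousLinearMap.norm_map_iff_adjoint_comp_self (walk C)).mp (norm_walk C)
    rw [ContinuousLinearMap.star_eq_adjoint]
    exact this
  refine Unitary.mem_iff.mpr ⟨h1, ?_⟩
  ext1 φ
  obtain ⟨ψ, rfl⟩ := walk_surjective C φ
  have h2 := congrArg (fun T : L2 →L[ℂ] L2 => walk C (T ψ)) h1
  simpa using h2

theorem isUnit_walk_sub (C : Coin) {z : ℂ} (hz : ‖z‖ ≠ 1) :
    IsUnit (walk C - z • (1 : L2 →L[ℂ] L2)) := by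
  have h : z ∉ spectrum ℂ (walk C) := fun hmem => hz (by
    simpa using spectrum.subset_circle_of_unitary (walk_mem_unitary C) hmem)
  rw [spectrum.notMem_iff, Algebra.algebraMap_eq_smul_one] at h
  simpa using h.neg

theorem walkResolvent_apply_eq (C : Coin) {z : ℂ} (hz : ‖z‖ ≠ 1) {ψ φ : L2}
    (h : walk C ψ - z • ψ = φ) : walkResolvent C z φ = ψ := by
  have h1 := Ring.inverse_mul_cancel _ (isUnit_walk_sub C hz)
  have h2 := congrArg (fun T : L2 →L[ℂ] L2 => T ψ) h1
  rw [← h]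
  simp only [mul_apply_eq_comp, sub_apply, smul_apply, one_apply_eq_self] at h2
  exact h2

/-! ### Solutions of `(U - z) ψ = δ₀ v` with geometric tails -/

/-- The map `ℤ → ℂ²` with value `o` at `0`, `rⁿ p` at `n + 1` and `lⁿ q` at `-(n + 1)`. -/
def geomProfile (o p q : Spin) (r l : ℂ) : ℤ → Spin
  | Int.ofNat 0 => o
  | Int.ofNat (n + 1) => r ^ n • p
  | Int.negSucc n => l ^ n • q

theorem geomProfile_pos (o p q : Spin) (r l : ℂ) (n : ℕ) :
    geomProfile o p q r l ((n : ℤ) + 1) = r ^ n • p := rfl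

theorem geomProfile_neg (o p q : Spin) (r l : ℂ) (n : ℕ) :
    geomProfile o p q r l (-((n : ℤ) + 1)) = l ^ n • q := by
  rw [← Int.negSucc_eq]
  rfl

theorem memℓp_geomProfile (o p q : Spin) {r l : ℂ} (hr : ‖r‖ < 1) (hl : ‖l‖ < 1) :
    Memℓp (geomProfile o p q r l) 2 := by
  refine memℓp_gen ?_
  have hg {c : ℂ} (hc : ‖c‖ < 1) (w : Spin) : Summable fun n : ℕ => ‖c ^ n • w‖ ^ 2 := by
    have hc2 : ‖c‖ ^ 2 < 1 := by
      rw [sq_lt_one_iff₀ (norm_nonneg _)]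
      exact hc
    refine ((summable_geometric_of_lt_one (sq_nonneg _) hc2).mul_right (‖w‖ ^ 2)).congr ?_
    intro n
    rw [norm_smul, norm_pow, mul_pow, ← pow_mul, ← pow_mul, mul_comm 2 n]
  simp only [ENNReal.toReal_ofNat, Real.rpow_ofNat]
  refine Summable.of_nat_of_neg_add_one ?_ ?_
  · exact (summable_nat_add_iff 1).mp (hg hr p)
  · simpa only [geomProfile_neg] using hg hl q

theorem walkMap_apply_zero (C : Coin) (ψ : ℤ → Spin) (x : ℤ) :
    walkMap C ψ x 0 = (C (x + 1) : Mat) 0 0 * ψ (x + 1) 0 + (C (x + 1) : Mat) 0 1 * ψ (x + 1) 1 := by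
  simp [walkMap, Matrix.mulVec, dotProduct, Fin.sum_univ_two]

theorem walkMap_apply_one (C : Coin) (ψ : ℤ → Spin) (x : ℤ) :
    walkMap C ψ x 1 = (C (x - 1) : Mat) 1 0 * ψ (x - 1) 0 + (C (x - 1) : Mat) 1 1 * ψ (x - 1) 1 := by
  simp [walkMap, Matrix.mulVec, dotProduct, Fin.sum_univ_two]

theorem twoPhaseCoin_pos (Cp C0 Cm : Matrix.unitaryGroup (Fin 2) ℂ) (n : ℕ) :
    twoPhaseCoin Cp C0 Cm ((n : ℤ) + 1) = Cp := by
  rw [twoPhaseCoin, if_pos (by omega)]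

theorem twoPhaseCoin_zero (Cp C0 Cm : Matrix.unitaryGroup (Fin 2) ℂ) :
    twoPhaseCoin Cp C0 Cm 0 = C0 := by
  rw [twoPhaseCoin, if_neg (by omega), if_pos rfl]

theorem twoPhaseCoin_neg (Cp C0 Cm : Matrix.unitaryGroup (Fin 2) ℂ) (n : ℕ) :
    twoPhaseCoin Cp C0 Cm (-((n : ℤ) + 1)) = Cm := by
  rw [twoPhaseCoin, if_neg (by omega), if_neg (by omega)]

/-- The six cases of an integer that matter for the two-phase walk. -/
theorem int_cases_near_zero {p : ℤ → Prop} (h0 : p 0) (h1 : p 1) (h2 : ∀ n : ℕ, p ((n : ℤ) + 2))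
    (h3 : p (-1)) (h4 : ∀ n : ℕ, p (-((n : ℤ) + 2))) (x : ℤ) : p x := by
  obtain ⟨n, rfl | rfl⟩ := x.eq_nat_or_neg
  · match n with
    | 0 => simpa using h0
    | 1 => simpa using h1
    | n + 2 => simpa using h2 n
  · match n with
    | 0 => simpa using h0
    | 1 => simpa using h3
    | n + 2 => simpa using h4 n

/-- The equation `(U - z) ψ = δ₀ v` for a map `ψ` with geometric tails amounts to eight scalar
equations. -/
theorem exists_geometric_solution {α₀ β₀ αp αm β : ℂ}
    (h₀ : ‖α₀‖ ^ 2 + ‖β₀‖ ^ 2 = 1) (hp : ‖αp‖ ^ 2 + ‖β‖ ^ 2 = 1) (hm : ‖αm‖ ^ 2 + ‖β‖ ^ 2 = 1)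
    {z r l p₀ p₁ q₀ q₁ : ℂ} {o v : Spin} (hr : ‖r‖ < 1) (hl : ‖l‖ < 1)
    (e1 : r * (αp * p₀ + β * p₁) = z * p₀) (e2 : -conj β * p₀ + conj αp * p₁ = z * (r * p₁))
    (e3 : αp * p₀ + β * p₁ = z * o 0 + v 0) (e4 : -conj β₀ * o 0 + conj α₀ * o 1 = z * p₁)
    (e5 : α₀ * o 0 + β₀ * o 1 = z * q₀) (e6 : -conj β * q₀ + conj αm * q₁ = z * o 1 + v 1)
    (e7 : αm * q₀ + β * q₁ = z * (l * q₀)) (e8 : l * (-conj β * q₀ + conj αm * q₁) = z * q₁) :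
    ∃ ψ : L2, walk (twoPhaseCoin (suCoin αp β hp) (suCoin α₀ β₀ h₀) (suCoin αm β hm)) ψ - z • ψ
      = toL2 (Finsupp.single 0 v) ∧ ψ 0 = o := by
  set Cp := suCoin αp β hp
  have hCp : (Cp : Mat) = !![αp, β; -conj β, conj αp] := rfl
  set C0 := suCoin α₀ β₀ h₀
  have hC0 : (C0 : Mat) = !![α₀, β₀; -conj β₀, conj α₀] := rfl
  set Cm := suCoin αm β hm
  have hCm : (Cm : Mat) = !![αm, β; -conj β, conj αm] := rfl
  set f := geomProfile o !₂[p₀, p₁] !₂[q₀, q₁] r l with hf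
  have f0 : f 0 = o := rfl
  have fp (n : ℕ) : f ((n : ℤ) + 1) = r ^ n • !₂[p₀, p₁] := geomProfile_pos ..
  have fn (n : ℕ) : f (-((n : ℤ) + 1)) = l ^ n • !₂[q₀, q₁] := geomProfile_neg ..
  have f1 : f 1 = !₂[p₀, p₁] := by simpa using fp 0
  have f2 : f (-1) = !₂[q₀, q₁] := by simpa using fn 0
  have kp := twoPhaseCoin_pos Cp C0 Cm
  have kn := twoPhaseCoin_neg Cp C0 Cm
  have k0 := twoPhaseCoin_zero Cp C0 Cm
  have k1 : twoPhaseCoin Cp C0 Cm 1 = Cp := by simpa using kp 0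
  have k2 : twoPhaseCoin Cp C0 Cm (-1) = Cm := by simpa using kn 0
  refine ⟨⟨f, memℓp_geomProfile _ _ _ hr hl⟩, Subtype.ext (funext fun x => ?_), f0⟩
  rw [toL2_apply]
  change walkMap _ f x - z • f x = _
  refine int_cases_near_zero (p := fun x => walkMap (twoPhaseCoin Cp C0 Cm) f x - z • f x
    = Finsupp.single 0 v x) ?_ ?_ ?_ ?_ ?_ x
  · ext i
    fin_cases i
    · simp [walkMap_apply_zero, k1, f1, f0, hCp]
      linear_combination e3
    · simp [walkMap_apply_one, k2, f2, f0, hCm]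
      linear_combination e6
  · have fp1 := fp 1
    have kp1 := kp 1
    norm_num at fp1 kp1
    ext i
    fin_cases i
    · simp [walkMap_apply_zero, kp1, f1, fp1, hCp]
      linear_combination e1
    · simp [walkMap_apply_one, k0, f1, f0, hC0]
      linear_combination e4
  · intro n
    have fpa : f ((n : ℤ) + 2) = r ^ (n + 1) • !₂[p₀, p₁] := by
      rw [← fp (n + 1)]
      push_cast
      ring_nf
    have a1 : (n : ℤ) + 2 + 1 = ((n + 2 : ℕ) : ℤ) + 1 := by push_cast; ring
    have a2 : (n : ℤ) + 2 - 1 = (n : ℤ) + 1 := by ring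
    have a3 : (n : ℤ) + 2 ≠ 0 := by omega
    ext i
    fin_cases i
    · simp [walkMap_apply_zero, a1, kp (n + 2), fpa, fp (n + 2), hCp, a3]
      linear_combination r ^ (n + 1) * e1
    · simp [walkMap_apply_one, a2, kp, fpa, fp, hCp, a3]
      linear_combination r ^ n * e2
  · have fn1 := fn 1
    have kn1 := kn 1
    norm_num at fn1 kn1
    ext i
    fin_cases i
    · simp [walkMap_apply_zero, k0, f2, f0, hC0]
      linear_combination e5
    · simp [walkMap_apply_one, kn1, f2, fn1, hCm]
      linear_combination e8
  · intro n
    have fna : f (-((n : ℤ) + 2)) = l ^ (n + 1) • !₂[q₀, q₁] := by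
      rw [← fn (n + 1)]
      push_cast
      ring_nf
    have a1 : -((n : ℤ) + 2) - 1 = -(((n + 2 : ℕ) : ℤ) + 1) := by push_cast; ring
    have a2 : -((n : ℤ) + 2) + 1 = -((n : ℤ) + 1) := by ring
    have a3 : -((n : ℤ) + 2) ≠ 0 := by omega
    ext i
    fin_cases i
    · rw [PiLp.sub_apply, PiLp.smul_apply]
      simp only [Fin.zero_eta]
      rw [walkMap_apply_zero, a2, kn, fna, fn,
        Finsupp.single_eq_of_ne a3]
      simp [hCm]
      linear_combination l ^ n * e7
    · rw [PiLp.sub_apply, PiLp.smul_apply]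
      simp only [Fin.mk_one]
      rw [walkMap_apply_one, a1, kn, fna, fn, Finsupp.single_eq_of_ne a3]
      simp [hCm]
      linear_combination l ^ (n + 1) * e8

/-! ### The decay rate and the Green matrix at the origin -/

/-- A solution of `z + 1/z = 2a` with `-1 < a < 1` lies on the unit circle. -/
theorem norm_eq_one_of_joukowsky {z : ℂ} {a : ℝ} (ha : |a| < 1) (h : 1 + z ^ 2 = 2 * a * z) :
    ‖z‖ = 1 := by
  have h1 := congrArg Complex.re h
  have h2 := congrArg Complex.im h
  simp [sq] at h1 h2
  have ha2 : a ^ 2 < 1 := by rw [sq_lt_one_iff_abs_lt_one]; exact ha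
  have h3 : z.im * (z.re - a) = 0 := by linarith
  rcases mul_eq_zero.mp h3 with h3 | h3
  · rw [h3] at h1
    nlinarith [sq_nonneg (z.re - a)]
  · have h4 : z.re = a := by linarith
    have h5 : ‖z‖ ^ 2 = 1 := by
      rw [Complex.sq_norm, Complex.normSq_apply]
      rw [h4] at h1 ⊢
      linarith
    exact (pow_eq_one_iff_of_nonneg (norm_nonneg z) two_ne_zero).mp h5

/-- Off the unit circle, the equation `z + 1/z = ρ (κ + 1/κ)` for the spatial decay rate has a
solution in the open disc. It is written as `κ = η z`, so that `z = 0` needs no special treatment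
afterwards. -/
theorem exists_decay_rate {ρ : ℝ} (hρ0 : 0 < ρ) (hρ1 : ρ < 1) {z : ℂ} (hz : ‖z‖ ≠ 1) :
    ∃ η : ℂ, ‖η * z‖ < 1 ∧ (1 + z ^ 2) * η = ρ * (1 + η ^ 2 * z ^ 2) := by
  have hρ : (ρ : ℂ) ≠ 0 := by exact_mod_cast hρ0.ne'
  by_cases hz0 : z = 0
  · exact ⟨ρ, by simp [hz0], by simp [hz0]⟩
  obtain ⟨w, hw⟩ := IsAlgClosed.exists_pow_nat_eq
    (((1 + z ^ 2) / (2 * ρ * z)) ^ 2 - 1 : ℂ) (n := 2) two_pos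
  set J : ℂ := (1 + z ^ 2) / (2 * ρ * z) with hJ
  have hJz : 1 + z ^ 2 = 2 * ρ * z * J := by
    rw [hJ]
    field_simp
  -- the two roots `J ± w` are inverse to each other
  have hprod : (J + w) * (J - w) = 1 := by linear_combination -hw
  have main (κ : ℂ) (hκ : ‖κ‖ < 1) (h : κ ^ 2 - 2 * J * κ + 1 = 0) :
      ∃ η : ℂ, ‖η * z‖ < 1 ∧ (1 + z ^ 2) * η = ρ * (1 + η ^ 2 * z ^ 2) := by
    refine ⟨κ / z, by rwa [div_mul_cancel₀ _ hz0], ?_⟩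
    rw [hJz]
    field_simp
    linear_combination -h
  have hn : ‖J + w‖ * ‖J - w‖ = 1 := by rw [← norm_mul, hprod, norm_one]
  rcases lt_trichotomy ‖J + w‖ 1 with h | h | h
  · exact main _ h (by linear_combination hw)
  · exfalso
    refine hz (norm_eq_one_of_joukowsky (a := ρ * (J + w).re) ?_ ?_)
    · rw [abs_mul, abs_of_pos hρ0]
      have := Complex.abs_re_le_norm (J + w)
      nlinarith
    · have h1 : (J + w) * conj (J + w) = 1 := by
        rw [Complex.mul_conj', h]
        norm_num
      have h2 : J - w = conj (J + w) := by
        have h0 : J + w ≠ 0 := by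
          intro h0
          simp [h0] at h
        exact mul_left_cancel₀ h0 (hprod.trans h1.symm)
      have h3 : 2 * J = 2 * ((J + w).re : ℂ) := by
        have := Complex.add_conj (J + w)
        rw [← h2] at this
        push_cast at this
        linear_combination this
      rw [hJz]
      push_cast
      linear_combination ρ * z * h3
  · refine main _ ?_ (by linear_combination hw : (J - w) ^ 2 - 2 * J * (J - w) + 1 = 0)
    nlinarith [norm_nonneg (J - w)]

/-- If the decay rate `κ` belongs to `z`, the exterior equations of the walk are solved by
explicit geometric tails, and `(U - z) ψ = δ₀ v` reduces to four equations at the origin. -/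
theorem exists_solution_of_decay_rate {α₀ β₀ αp αm β : ℂ} {ρ : ℝ}
    (h₀ : ‖α₀‖ ^ 2 + ‖β₀‖ ^ 2 = 1) (hp : ‖αp‖ ^ 2 + ‖β‖ ^ 2 = 1) (hm : ‖αm‖ ^ 2 + ‖β‖ ^ 2 = 1)
    (hρp : ‖αp‖ = ρ) (hρm : ‖αm‖ = ρ) (hρ0 : 0 < ρ)
    {z κ P Q : ℂ} {o v : Spin} (hκ : ‖κ‖ < 1) (h : κ * (1 + z ^ 2) = ρ * z * (1 + κ ^ 2))
    (e1 : P * (1 - ρ * z * κ) = z * o 0 + v 0)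
    (e2 : z * conj β * P = -conj β₀ * o 0 + conj α₀ * o 1)
    (e3 : -Q * (1 - ρ * z * κ) = z * o 1 + v 1)
    (e4 : z * β * Q = α₀ * o 0 + β₀ * o 1) :
    ∃ ψ : L2, walk (twoPhaseCoin (suCoin αp β hp) (suCoin α₀ β₀ h₀) (suCoin αm β hm)) ψ - z • ψ
      = toL2 (Finsupp.single 0 v) ∧ ψ 0 = o := by
  have hρ : (ρ : ℂ) ≠ 0 := by exact_mod_cast hρ0.ne'
  have hαp : αp ≠ 0 := by
    rintro rfl
    simp at hρp
    exact hρ0.ne hρp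
  have kp : αp * conj αp = ρ ^ 2 := by rw [Complex.mul_conj', hρp]
  have km : αm * conj αm = ρ ^ 2 := by rw [Complex.mul_conj', hρm]
  have kβ : β * conj β = 1 - ρ ^ 2 := by
    rw [Complex.mul_conj', ← hρp]
    have : (‖αp‖ : ℂ) ^ 2 + ‖β‖ ^ 2 = 1 := by exact_mod_cast hp
    linear_combination this
  have nr : ‖(ρ : ℂ) / αp * κ‖ < 1 := by
    rw [norm_mul, norm_div, hρp, Complex.norm_real, Real.norm_of_nonneg hρ0.le, div_self hρ0.ne',
      one_mul]
    exact hκ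
  have nl : ‖αm / (ρ : ℂ) * κ‖ < 1 := by
    rw [norm_mul, norm_div, hρm, Complex.norm_real, Real.norm_of_nonneg hρ0.le, div_self hρ0.ne',
      one_mul]
    exact hκ
  have kp' : conj αp = ρ ^ 2 / αp := by
    rw [eq_div_iff hαp]
    linear_combination kp
  refine exists_geometric_solution h₀ hp hm (r := ρ / αp * κ) (l := αm / ρ * κ)
    (p₀ := P / αp * (ρ * (ρ - z * κ))) (p₁ := P * conj β) (q₀ := Q * β)
    (q₁ := -Q * (αm / ρ * (ρ - z * κ))) nr nl ?_ ?_ ?_ ?_ ?_ ?_ ?_ ?_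
  · field_simp
    linear_combination P * κ * kβ + P * h
  · rw [kp']
    field_simp
    ring
  · rw [← e1]
    field_simp
    linear_combination P * kβ
  · linear_combination -e2
  · linear_combination -e4
  · rw [← e3]
    field_simp
    linear_combination -Q * (ρ - z * κ) * km - Q * ρ * kβ
  · field_simp
    ring
  · field_simp
    linear_combination -Q * αm * κ * (ρ - z * κ) * km - Q * ρ * αm * κ * kβ - Q * ρ * αm * h

theorem one_sub_decay_ne_zero {ρ : ℝ} (hρ0 : 0 < ρ) (hρ1 : ρ < 1) {z κ : ℂ}
    (h : κ * (1 + z ^ 2) = ρ * z * (1 + κ ^ 2)) : 1 - ρ * z * κ ≠ 0 := by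
  intro h0
  have hρ : (1 - ρ ^ 2 : ℂ) ≠ 0 := by
    have : (1 - ρ ^ 2 : ℝ) ≠ 0 := by nlinarith
    exact_mod_cast this
  have hz : z * (1 - ρ ^ 2 : ℂ) = 0 := by
    linear_combination ρ * h - (ρ * κ - z) * h0
  rcases mul_eq_zero.mp hz with rfl | h1
  · simp at h0
  · exact hρ h1

/-- The denominator of the Green matrix vanishes only on the unit circle. -/
theorem green_denominator_ne_zero {ρ s : ℝ} (hρ0 : 0 < ρ) (hm : 0 < 2 - 2 * s - ρ ^ 2)
    (hlt : (1 - s) ^ 2 < 2 - 2 * s - ρ ^ 2) {z κ : ℂ} (hz : ‖z‖ ≠ 1)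
    (h : κ * (1 + z ^ 2) = ρ * z * (1 + κ ^ 2)) :
    ρ * (1 + z ^ 2) - 2 * (1 - s) * z * κ ≠ 0 := by
  intro h0
  have hρ : (ρ : ℂ) ≠ 0 := by exact_mod_cast hρ0.ne'
  have hz0 : z ≠ 0 := by
    rintro rfl
    simp [hρ] at h0
  set k := √(2 - 2 * s - ρ ^ 2) with hk
  have hkpos : 0 < k := Real.sqrt_pos.mpr hm
  have hk2 : k ^ 2 = 2 - 2 * s - ρ ^ 2 := Real.sq_sqrt hm.le
  have hk2' : (k : ℂ) ^ 2 = 2 - 2 * s - ρ ^ 2 := by exact_mod_cast hk2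
  have hkc : (k : ℂ) ≠ 0 := by exact_mod_cast hkpos.ne'
  -- eliminating `z` leaves `κ² (2 - 2s - ρ²) = ρ²`
  have h1 : z * (κ * k - ρ) * (κ * k + ρ) = 0 := by
    linear_combination (κ ^ 2 * z) * hk2' - κ * h0 + ρ * h
  have hlt' : |(1 - s) / k| < 1 := by
    rw [abs_div, abs_of_pos hkpos, div_lt_one hkpos]
    exact abs_lt_of_sq_lt_sq (by rw [hk2]; exact hlt) hkpos.le
  rcases mul_eq_zero.mp h1 with h1 | h1
  · have h2 : κ * k = ρ := by
      linear_combination (mul_eq_zero.mp h1).resolve_left hz0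
    refine hz (norm_eq_one_of_joukowsky hlt' ?_)
    push_cast
    field_simp
    refine mul_left_cancel₀ hρ ?_
    linear_combination k * h0 + 2 * (1 - s) * z * h2
  · have h2 : κ * k = -ρ := by linear_combination h1
    refine hz (norm_eq_one_of_joukowsky (a := -((1 - s) / k)) (by rwa [abs_neg]) ?_)
    push_cast
    field_simp
    refine mul_left_cancel₀ hρ ?_
    linear_combination k * h0 + 2 * (1 - s) * z * h2

/-- The Green matrix `G(z)` of the walk at the origin, where `κ` is the decay rate at `z`. -/
def greenMatrix (α₀ β₀ β : ℂ) (ρ s : ℝ) (z κ : ℂ) : Mat :=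
  (ρ * (1 + z ^ 2) - 2 * (1 - s) * z * κ)⁻¹ •
    !![(1 - β₀ * conj β) * κ - ρ * z, -(conj α₀ * β * κ);
      α₀ * conj β * κ, (1 - conj β₀ * β) * κ - ρ * z]

/-- `greenMatrix` is the diagonal block at the origin of the resolvent. -/
theorem walkResolvent_origin {α₀ β₀ αp αm β : ℂ} {ρ s : ℝ}
    (h₀ : ‖α₀‖ ^ 2 + ‖β₀‖ ^ 2 = 1) (hp : ‖αp‖ ^ 2 + ‖β‖ ^ 2 = 1) (hm : ‖αm‖ ^ 2 + ‖β‖ ^ 2 = 1)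
    (hρp : ‖αp‖ = ρ) (hρm : ‖αm‖ = ρ) (hρ0 : 0 < ρ) (hρ1 : ρ < 1)
    (hs : s = (β₀ * conj β).re) (hpos : 0 < 2 - 2 * s - ρ ^ 2)
    (hlt : (1 - s) ^ 2 < 2 - 2 * s - ρ ^ 2)
    {z κ : ℂ} (hz : ‖z‖ ≠ 1) (hκ : ‖κ‖ < 1) (h : κ * (1 + z ^ 2) = ρ * z * (1 + κ ^ 2)) (v : Spin) :
    (walkResolvent (twoPhaseCoin (suCoin αp β hp) (suCoin α₀ β₀ h₀) (suCoin αm β hm)) z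
      (toL2 (Finsupp.single 0 v)) 0).ofLp = (greenMatrix α₀ β₀ β ρ s z κ).mulVec v.ofLp := by
  have he := one_sub_decay_ne_zero hρ0 hρ1 h
  have hd := green_denominator_ne_zero hρ0 hpos hlt hz h
  set e : ℂ := 1 - ρ * z * κ with he'
  set d : ℂ := ρ * (1 + z ^ 2) - 2 * (1 - s) * z * κ with hd'
  have k0 : α₀ * conj α₀ + β₀ * conj β₀ = 1 := by
    rw [Complex.mul_conj', Complex.mul_conj']
    exact_mod_cast h₀
  have kβ : β * conj β = 1 - ρ ^ 2 := by
    rw [Complex.mul_conj', ← hρp]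
    have : (‖αp‖ : ℂ) ^ 2 + ‖β‖ ^ 2 = 1 := by exact_mod_cast hp
    linear_combination this
  have ks : 2 * (s : ℂ) = β₀ * conj β + conj β₀ * β := by
    have := Complex.add_conj (β₀ * conj β)
    rw [← hs, map_mul, Complex.conj_conj] at this
    push_cast at this
    linear_combination -this
  set o : Spin := WithLp.toLp 2 ((greenMatrix α₀ β₀ β ρ s z κ).mulVec v.ofLp) with ho
  have o0 : d * o 0 = ((1 - β₀ * conj β) * κ - ρ * z) * v 0 - conj α₀ * β * κ * v 1 := by
    simp only [ho, greenMatrix, Matrix.smul_mulVec, ← hd', Pi.smul_apply, smul_eq_mul,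
      mul_inv_cancel_left₀ hd]
    simp [Matrix.mulVec, dotProduct, Fin.sum_univ_two]
    ring
  have o1 : d * o 1 = α₀ * conj β * κ * v 0 + ((1 - conj β₀ * β) * κ - ρ * z) * v 1 := by
    simp only [ho, greenMatrix, Matrix.smul_mulVec, ← hd', Pi.smul_apply, smul_eq_mul,
      mul_inv_cancel_left₀ hd]
    simp [Matrix.mulVec, dotProduct, Fin.sum_univ_two]
  have e2 : z * conj β * ((z * o 0 + v 0) / e) = -conj β₀ * o 0 + conj α₀ * o 1 := by
    rw [← mul_div_assoc, div_eq_iff he]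
    refine mul_left_cancel₀ hd ?_
    clear_value e d o
    subst he' hd'
    linear_combination z ^ 2 * conj β * o0 + (1 - ρ * z * κ) * conj β₀ * o0
      - (1 - ρ * z * κ) * conj α₀ * o1
      + v 0 * (-(1 - ρ * z * κ) * conj β * κ * k0 + z ^ 2 * conj β * κ * ks
        + z ^ 2 * κ * conj β₀ * kβ + (conj β₀ - conj β) * h)
      + v 1 * (-z ^ 2 * κ * conj α₀ * kβ - conj α₀ * h)
  have e4 : z * β * (-(z * o 1 + v 1) / e) = α₀ * o 0 + β₀ * o 1 := by
    rw [← mul_div_assoc, div_eq_iff he]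
    refine mul_left_cancel₀ hd ?_
    clear_value e d o
    subst he' hd'
    linear_combination -z ^ 2 * β * o1 - (1 - ρ * z * κ) * β₀ * o1 - (1 - ρ * z * κ) * α₀ * o0
      - v 1 * (-(1 - ρ * z * κ) * β * κ * k0 + z ^ 2 * β * κ * ks
        + z ^ 2 * κ * β₀ * kβ + (β₀ - β) * h)
      + v 0 * (-z ^ 2 * κ * α₀ * kβ - α₀ * h)
  obtain ⟨ψ, hψ, hψ0⟩ := exists_solution_of_decay_rate h₀ hp hm hρp hρm hρ0
    (P := (z * o 0 + v 0) / e) (Q := -(z * o 1 + v 1) / e) (o := o) (v := v) hκ h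
    (div_mul_cancel₀ _ he) e2 (by rw [neg_div, neg_neg]; exact div_mul_cancel₀ _ he) e4
  rw [walkResolvent_apply_eq _ hz hψ, hψ0]

/-- A point `z` with `z + 1/z = 2 (1 - s) σ`, where `σ² (2 - 2s - ρ²) = 1`, is an eigenvalue; its
decay rate is `ρ σ`. -/
theorem hasEigenvalue_walk {α₀ β₀ αp αm β : ℂ} {ρ s : ℝ}
    (h₀ : ‖α₀‖ ^ 2 + ‖β₀‖ ^ 2 = 1) (hp : ‖αp‖ ^ 2 + ‖β‖ ^ 2 = 1) (hm : ‖αm‖ ^ 2 + ‖β‖ ^ 2 = 1)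
    (hα₀ : α₀ ≠ 0) (hρp : ‖αp‖ = ρ) (hρm : ‖αm‖ = ρ) (hρ0 : 0 < ρ) (hρ1 : ρ < 1)
    (hs : s = (β₀ * conj β).re) {σ : ℝ} (hσ : σ ^ 2 * (2 - 2 * s - ρ ^ 2) = 1)
    (hσρ : |ρ * σ| < 1) {z : ℂ} (hz : 1 + z ^ 2 = 2 * (1 - s) * σ * z) :
    Module.End.HasEigenvalue (walk (twoPhaseCoin (suCoin αp β hp) (suCoin α₀ β₀ h₀)
      (suCoin αm β hm)) : L2 →ₗ[ℂ] L2) z := by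
  have hσ' : (σ : ℂ) ^ 2 * (2 - 2 * s - ρ ^ 2) = 1 := by exact_mod_cast hσ
  have h : (ρ * σ : ℂ) * (1 + z ^ 2) = ρ * z * (1 + (ρ * σ) ^ 2) := by
    linear_combination ρ * σ * hz + ρ * z * hσ'
  have he := one_sub_decay_ne_zero hρ0 hρ1 h
  set e : ℂ := 1 - ρ * z * (ρ * σ) with he'
  have k0 : α₀ * conj α₀ + β₀ * conj β₀ = 1 := by
    rw [Complex.mul_conj', Complex.mul_conj']
    exact_mod_cast h₀
  have kβ : β * conj β = 1 - ρ ^ 2 := by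
    rw [Complex.mul_conj', ← hρp]
    have : (‖αp‖ : ℂ) ^ 2 + ‖β‖ ^ 2 = 1 := by exact_mod_cast hp
    linear_combination this
  have ks : 2 * (s : ℂ) = β₀ * conj β + conj β₀ * β := by
    have := Complex.add_conj (β₀ * conj β)
    rw [← hs, map_mul, Complex.conj_conj] at this
    push_cast at this
    linear_combination -this
  -- the secular equation
  have hD : e ^ 2 + 2 * s * z ^ 2 * e + z ^ 4 * (1 - ρ ^ 2) = 0 := by
    have h1 : z ^ 2 * (1 - ρ ^ 2) = e ^ 2 - (1 - z ^ 2) * e := by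
      rw [he']
      linear_combination ρ * z * h
    have h2 : e * (1 + z ^ 2) - z ^ 2 * (1 - 2 * s - z ^ 2) = 0 := by
      rw [he']
      linear_combination (1 - ρ ^ 2 * z * σ + z ^ 2) * hz
        + 2 * (1 - s) * σ * z * hz + 2 * (1 - s) * z ^ 2 * hσ'
    linear_combination z ^ 2 * h1 + e * h2
  set o : Spin := !₂[e * conj α₀, z ^ 2 * conj β + e * conj β₀] with ho
  have o0 : o 0 = e * conj α₀ := rfl
  have o1 : o 1 = z ^ 2 * conj β + e * conj β₀ := rfl
  have e2 : z * conj β * (z * o 0 / e) = -conj β₀ * o 0 + conj α₀ * o 1 := by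
    rw [← mul_div_assoc, div_eq_iff he, o0, o1]
    ring
  have e4 : z * β * (-(z * o 1) / e) = α₀ * o 0 + β₀ * o 1 := by
    rw [← mul_div_assoc, div_eq_iff he, o0, o1]
    linear_combination -z ^ 4 * kβ - e ^ 2 * k0 - hD + e * z ^ 2 * ks
  obtain ⟨ψ, hψ, hψ0⟩ := exists_solution_of_decay_rate h₀ hp hm hρp hρm hρ0
    (P := z * o 0 / e) (Q := -(z * o 1) / e) (o := o) (v := 0) (κ := ρ * σ) (z := z)
    (by rw [← Complex.ofReal_mul, Complex.norm_real]; exact hσρ) h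
    (by simpa using div_mul_cancel₀ _ he) e2
    (by rw [neg_div, neg_neg]; simpa using div_mul_cancel₀ _ he) e4
  refine Module.End.hasEigenvalue_of_hasEigenvector (x := ψ)
      (Module.End.hasEigenvector_iff.mpr ⟨Module.End.mem_eigenspace_iff.mpr ?_, ?_⟩)
  · have hz0 : toL2 (Finsupp.single 0 (0 : Spin)) = 0 := by simp [toL2]
    rw [hz0] at hψ
    exact sub_eq_zero.mp hψ
  · intro hψz
    rw [hψz] at hψ0
    have : e * conj α₀ = 0 := by rw [← o0, ← hψ0]; rfl
    exact (mul_ne_zero he ((map_ne_zero _).mpr hα₀)) this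

/-! ### Closed subspaces containing all resolvents -/

open Filter Topology in
/-- A closed subspace of a Banach algebra that contains the resolvents `R(z)`, `|z| ≠ 1`, of an
element `u` contains all `uⁿ` and all `uⁿ R(z)`, `n ∈ ℤ`; here `p n` plays the role of `uⁿ`. -/
theorem mem_of_resolvent_mem {A : Type*} [NormedRing A] [NormedAlgebra ℂ A] [CompleteSpace A]
    {u : A} {p : ℤ → A} {R : ℂ → A} {S : Submodule ℂ A} (hS : IsClosed (S : Set A))
    (hp0 : p 0 = 1) (hp : ∀ n, p (n + 1) = p n * u)
    (hR : ∀ z : ℂ, ‖z‖ ≠ 1 → (u - z • 1) * R z = 1 ∧ R z * (u - z • 1) = 1)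
    (hRS : ∀ z : ℂ, ‖z‖ ≠ 1 → R z ∈ S) (n : ℤ) :
    p n ∈ S ∧ ∀ z : ℂ, ‖z‖ ≠ 1 → p n * R z ∈ S := by
  have hu {z : ℂ} (hz : ‖z‖ ≠ 1) : u * R z = 1 + z • R z := by
    have := (hR z hz).1
    rw [sub_mul, smul_mul_assoc, one_mul] at this
    rw [← this]
    abel
  have hres {z : ℂ} (hz : ‖z‖ ≠ 1) : R z = Ring.inverse (u - z • 1) :=
    (Ring.inverse_unit ⟨_, _, (hR z hz).1, (hR z hz).2⟩).symm
  -- `uⁿ` is the limit of `-z uⁿ R(z)` as `z → ∞`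
  have hpow {m : ℤ} (hm : ∀ z : ℂ, ‖z‖ ≠ 1 → p m * R z ∈ S) : p m ∈ S := by
    have hbig : ∀ᶠ z : ℂ in Bornology.cobounded ℂ, ‖z‖ ≠ 1 :=
      (tendsto_norm_cobounded_atTop.eventually_gt_atTop 1).mono fun z hz => hz.ne'
    have h1 : Tendsto R (Bornology.cobounded ℂ) (𝓝 0) := by
      have h2 := (spectrum.resolvent_tendsto_cobounded (𝕜 := ℂ) u).neg
      rw [neg_zero] at h2
      refine h2.congr' (hbig.mono fun z hz => ?_)
      rw [resolvent, Algebra.algebraMap_eq_smul_one, neg_eq_iff_eq_neg]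
      refine Ring.inverse_unit ⟨z • 1 - u, -R z, ?_, ?_⟩
      · rw [← neg_sub u, neg_mul_neg, (hR z hz).1]
      · rw [← neg_sub u, neg_mul_neg, (hR z hz).2]
    have h2 : Tendsto (fun z : ℂ => (-z) • (p m * R z)) (Bornology.cobounded ℂ) (𝓝 (p m)) := by
      have h3 := (h1.const_mul (p m * u)).const_sub (p m)
      rw [mul_zero, sub_zero] at h3
      refine h3.congr' (hbig.mono fun z hz => ?_)
      rw [mul_assoc, hu hz, mul_add, mul_one, mul_smul_comm]
      change _ = (-z) • (p m * R z)
      rw [neg_smul]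
      abel
    exact hS.mem_of_tendsto h2 (hbig.mono fun z hz => S.smul_mem _ (hm z hz))
  have key : ∀ z : ℂ, ‖z‖ ≠ 1 → p n * R z ∈ S := by
    induction n using Int.induction_on with
    | zero => simpa [hp0] using hRS
    | succ m ih =>
      intro z hz
      rw [hp, mul_assoc, hu hz, mul_add, mul_one, mul_smul_comm]
      exact S.add_mem (hpow ih) (S.smul_mem _ (ih z hz))
    | pred m ih =>
      have hstep : p (-(m : ℤ)) = p (-(m : ℤ) - 1) * u := by
        rw [← hp]
        ring_nf
      have h0 : p (-(m : ℤ) - 1) ∈ S := by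
        have h1 := ih 0 (by simp)
        rwa [hstep, mul_assoc, hu (by simp), zero_smul, add_zero, mul_one] at h1
      have hne {z : ℂ} (hz : ‖z‖ ≠ 1) (hz0 : z ≠ 0) : p (-(m : ℤ) - 1) * R z ∈ S := by
        have h1 := ih z hz
        rw [hstep, mul_assoc, hu hz, mul_add, mul_one, mul_smul_comm] at h1
        have h2 := S.smul_mem z⁻¹ ((S.add_mem_iff_right h0).mp h1)
        rwa [inv_smul_smul₀ hz0] at h2
      intro z hz
      rcases eq_or_ne z 0 with rfl | hz0
      · have hsmall : ∀ᶠ z : ℂ in 𝓝[≠] 0, ‖z‖ ≠ 1 := by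
          refine eventually_nhdsWithin_of_eventually_nhds ?_
          exact continuous_norm.continuousAt.eventually_ne (by simp)
        have hcont : ContinuousAt (fun z : ℂ => p (-(m : ℤ) - 1) * Ring.inverse (u - z • 1)) 0 := by
          refine continuousAt_const.mul ?_
          have hc : ContinuousAt (fun z : ℂ => u - z • (1 : A)) 0 := by fun_prop
          refine ContinuousAt.comp (g := Ring.inverse) ?_ hc
          exact NormedRing.inverse_continuousAt ⟨_, _, (hR 0 hz).1, (hR 0 hz).2⟩
        have h1 := hcont.tendsto.mono_left (nhdsWithin_le_nhds (s := {0}ᶜ))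
        rw [hres hz]
        refine hS.mem_of_tendsto h1 ?_
        filter_upwards [hsmall, self_mem_nhdsWithin] with w hw hw0
        rw [← hres hw]
        exact hne hw hw0
      · exact hne hz hz0
  exact ⟨hpow key, key⟩

/-! ### The QW-Fourier transform and cyclicity of the origin -/

theorem fourier_eq_sum (C : Coin) (f : ℤ →₀ Spin) (z : ℂ) :
    fourier C f z = f.sum fun x v =>
      WithLp.toLp 2 ((fundamental C (conj z)⁻¹ x).conjTranspose.mulVec v.ofLp) := rfl

theorem fourier_add (C : Coin) (f g : ℤ →₀ Spin) (z : ℂ) :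
    fourier C (f + g) z = fourier C f z + fourier C g z := by
  simp only [fourier_eq_sum]
  refine Finsupp.sum_add_index' (fun x => by simp) fun x v w => ?_
  rw [WithLp.ofLp_add, Matrix.mulVec_add, WithLp.toLp_add]

theorem fourier_single (C : Coin) (x : ℤ) (v : Spin) (z : ℂ) :
    fourier C (Finsupp.single x v) z
      = WithLp.toLp 2 ((fundamental C (conj z)⁻¹ x).conjTranspose.mulVec v.ofLp) := by
  rw [fourier_eq_sum, Finsupp.sum_single_index (by simp)]

theorem toL2_add (f g : ℤ →₀ Spin) : toL2 (f + g) = toL2 f + toL2 g := by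
  refine Subtype.ext (funext fun x => ?_)
  rw [toL2_apply]
  change (f + g) x = toL2 f x + toL2 g x
  rw [toL2_apply, toL2_apply]
  rfl

theorem toL2_smul (c : ℂ) (f : ℤ →₀ Spin) : toL2 (c • f) = c • toL2 f := by
  refine Subtype.ext (funext fun x => ?_)
  rw [toL2_apply]
  change (c • f) x = c • toL2 f x
  rw [toL2_apply]
  rfl

theorem det_transfer (C : Coin) {z : ℂ} (hz : z ≠ 0) (x : ℤ) (ha : (C (x + 1) : Mat) 0 0 ≠ 0) :
    (transfer C z x).det = (C x : Mat) 1 1 / (C (x + 1) : Mat) 0 0 := by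
  rw [transfer, Matrix.det_fin_two_of]
  field_simp
  ring

/-- The recursion `F(x + 1) = T(x) F(x)` on all of `ℤ`. -/
theorem fundamental_add_one (C : Coin) (hC : ∀ x, (C x : Mat) 0 0 ≠ 0 ∧ (C x : Mat) 1 1 ≠ 0)
    {z : ℂ} (hz : z ≠ 0) (x : ℤ) :
    fundamental C z (x + 1) = transfer C z x * fundamental C z x := by
  obtain ⟨n, rfl | rfl⟩ : ∃ n : ℕ, x = n ∨ x = -((n : ℤ) + 1) := by
    rcases le_or_gt 0 x with h | h
    · exact ⟨x.toNat, Or.inl (by omega)⟩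
    · exact ⟨(-x - 1).toNat, Or.inr (by omega)⟩
  · rw [fundamental, if_pos (by omega), fundamental, if_pos (by omega),
      show ((n : ℤ) + 1).toNat = n + 1 by omega, Int.toNat_natCast]
    rfl
  · have hunit : IsUnit (transfer C z (-((n : ℤ) + 1))).det := by
      rw [det_transfer C hz _ (hC _).1]
      exact (div_ne_zero (hC _).2 (hC _).1).isUnit
    have h1 : fundamental C z (-((n : ℤ) + 1)) = fundamentalNeg C z (n + 1) := by
      rw [fundamental, if_neg (by omega)]
      congr 1
    have h2 : fundamental C z (-((n : ℤ) + 1) + 1) = fundamentalNeg C z n := by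
      rcases Nat.eq_zero_or_pos n with rfl | hn
      · simp [fundamental, fundamentalPos, fundamentalNeg]
      · rw [fundamental, if_neg (by omega)]
        congr 1
        omega
    rw [h1, h2, fundamentalNeg, Matrix.mul_nonsing_inv_cancel_left _ _ hunit]

/-- The columns of `F` are generalized eigenfunctions: `C(x) F(x) = z (π_L F(x-1) + π_R F(x+1))`. -/
theorem coin_mul_fundamental (C : Coin) (hC : ∀ x, (C x : Mat) 0 0 ≠ 0 ∧ (C x : Mat) 1 1 ≠ 0)
    {z : ℂ} (hz : z ≠ 0) (x : ℤ) :
    (C x : Mat) * fundamental C z x = z • (!![1, 0; 0, 0] * fundamental C z (x - 1)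
      + !![0, 0; 0, 1] * fundamental C z (x + 1)) := by
  have h1 := fundamental_add_one C hC hz x
  have h2 := fundamental_add_one C hC hz (x - 1)
  rw [sub_add_cancel] at h2
  have ha := (hC x).1
  ext i j
  have e1 := congrFun (congrFun h1 1) j
  have e20 := congrFun (congrFun h2 0) j
  have e21 := congrFun (congrFun h2 1) j
  simp only [transfer, Matrix.mul_apply, Fin.sum_univ_two, Matrix.of_apply, Matrix.cons_val',
    Matrix.cons_val_zero, Matrix.cons_val_one, Matrix.cons_val_fin_one, sub_add_cancel] at e1 e20 e21
  rw [Matrix.mul_apply, Matrix.smul_apply, Matrix.add_apply, Matrix.mul_apply, Matrix.mul_apply]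
  simp only [Fin.sum_univ_two]
  fin_cases i
  · simp
    rw [e20, e21]
    field_simp
    ring
  · simp
    rw [e1]
    field_simp

/-- The adjoint of `coin_mul_fundamental` on the unit circle, where `conj ζ = ζ⁻¹`. -/
theorem conjTranspose_fundamental_mul (C : Coin)
    (hC : ∀ x, (C x : Mat) 0 0 ≠ 0 ∧ (C x : Mat) 1 1 ≠ 0) (ζ : Circle) (x : ℤ) :
    (ζ : ℂ) • (fundamental C ζ x).conjTranspose
      = (fundamental C ζ (x - 1)).conjTranspose * !![1, 0; 0, 0] * (C x : Mat)
        + (fundamental C ζ (x + 1)).conjTranspose * !![0, 0; 0, 1] * (C x : Mat) := by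
  have h := coin_mul_fundamental C hC ζ.coe_ne_zero x
  have hu : (C x : Mat).conjTranspose * (C x : Mat) = 1 := Matrix.mem_unitaryGroup_iff'.mp (C x).2
  have hζ : (ζ : ℂ) * conj (ζ : ℂ) = 1 := by
    rw [Complex.mul_conj', Circle.norm_coe]
    norm_num
  have h2 := congrArg (fun A : Mat => (ζ : ℂ) • (A.conjTranspose * (C x : Mat))) h
  simp only [Matrix.conjTranspose_mul, Matrix.mul_assoc, hu, Matrix.mul_one,
    Matrix.conjTranspose_smul, Matrix.conjTranspose_add, Matrix.smul_mul, smul_smul,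
    RCLike.star_def, hζ, one_smul, Matrix.add_mul] at h2
  have hL : (!![1, 0; 0, 0] : Mat).conjTranspose = !![1, 0; 0, 0] := by
    ext i j
    fin_cases i <;> fin_cases j <;> simp
  have hR : (!![0, 0; 0, 1] : Mat).conjTranspose = !![0, 0; 0, 1] := by
    ext i j
    fin_cases i <;> fin_cases j <;> simp
  rw [h2, hL, hR, Matrix.mul_assoc, Matrix.mul_assoc]

/-- The transform of `f` on the unit circle. -/
def circleFourier (C : Coin) (f : ℤ →₀ Spin) (ζ : Circle) : Spin := fourier C f (ζ : ℂ)

theorem circleFourier_single (C : Coin) (x : ℤ) (v : Spin) (ζ : Circle) :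
    circleFourier C (Finsupp.single x v) ζ
      = WithLp.toLp 2 ((fundamental C ζ x).conjTranspose.mulVec v.ofLp) := by
  have h : (conj (ζ : ℂ))⁻¹ = ζ := by
    rw [← Circle.coe_inv_eq_conj, ← Circle.coe_inv, inv_inv]
  rw [circleFourier, fourier_single, h]

/-- One step of the walk applied to a function supported at `x`, as a finitely supported map. -/
def stepSingle (C : Coin) (x : ℤ) (v : Spin) : ℤ →₀ Spin :=
  Finsupp.single (x - 1) !₂[((C x : Mat).mulVec v.ofLp) 0, 0]
    + Finsupp.single (x + 1) !₂[0, ((C x : Mat).mulVec v.ofLp) 1]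

theorem walk_toL2_single (C : Coin) (x : ℤ) (v : Spin) :
    walk C (toL2 (Finsupp.single x v)) = toL2 (stepSingle C x v) := by
  refine Subtype.ext (funext fun y => ?_)
  rw [toL2_apply]
  change walkMap C (toL2 (Finsupp.single x v)) y = _
  have h : ⇑(toL2 (Finsupp.single x v)) = Finsupp.single x v := funext (toL2_apply _)
  rw [h]
  ext i
  fin_cases i
  · simp only [Fin.zero_eta, walkMap_apply_zero, stepSingle, Finsupp.add_apply, PiLp.add_apply]
    rcases eq_or_ne (x - 1) y with rfl | hy
    · simp [Finsupp.single_apply, Matrix.mulVec, dotProduct, Fin.sum_univ_two]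
      split_ifs <;> simp
    · have h1 : y + 1 ≠ x := fun h => hy (by omega)
      rw [Finsupp.single_eq_of_ne h1, Finsupp.single_eq_of_ne hy.symm]
      simp [Finsupp.single_apply]
      split_ifs <;> simp
  · simp only [Fin.mk_one, walkMap_apply_one, stepSingle, Finsupp.add_apply, PiLp.add_apply]
    rcases eq_or_ne (x + 1) y with rfl | hy
    · simp [Finsupp.single_apply, Matrix.mulVec, dotProduct, Fin.sum_univ_two]
      split_ifs <;> simp
    · have h1 : y - 1 ≠ x := fun h => hy (by omega)
      rw [Finsupp.single_eq_of_ne h1, Finsupp.single_eq_of_ne hy.symm]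
      simp [Finsupp.single_apply]
      split_ifs <;> simp

/-- The transform intertwines the walk with multiplication by `ζ`. -/
theorem circleFourier_stepSingle (C : Coin)
    (hC : ∀ x, (C x : Mat) 0 0 ≠ 0 ∧ (C x : Mat) 1 1 ≠ 0) (x : ℤ) (v : Spin) (ζ : Circle) :
    circleFourier C (stepSingle C x v) ζ
      = (ζ : ℂ) • circleFourier C (Finsupp.single x v) ζ := by
  have h := conjTranspose_fundamental_mul C hC ζ x
  have e1 : (!₂[((C x : Mat).mulVec v.ofLp) 0, 0] : Spin).ofLp
      = (!![1, 0; 0, 0] : Mat).mulVec ((C x : Mat).mulVec v.ofLp) := by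
    ext i
    fin_cases i <;> simp [Matrix.mulVec, dotProduct, Fin.sum_univ_two]
  have e2 : (!₂[0, ((C x : Mat).mulVec v.ofLp) 1] : Spin).ofLp
      = (!![0, 0; 0, 1] : Mat).mulVec ((C x : Mat).mulVec v.ofLp) := by
    ext i
    fin_cases i <;> simp [Matrix.mulVec, dotProduct, Fin.sum_univ_two]
  have hadd : circleFourier C (stepSingle C x v) ζ = _ + _ := fourier_add C _ _ _
  rw [hadd]
  change circleFourier C _ ζ + circleFourier C _ ζ = _
  rw [circleFourier_single, circleFourier_single, circleFourier_single, e1, e2, ← WithLp.toLp_smul,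
    ← WithLp.toLp_add, ← Matrix.smul_mulVec, h, Matrix.add_mulVec]
  simp only [Matrix.mulVec_mulVec, Matrix.mul_assoc]

/-! ### Complex measures on the circle -/

/-- The variation is at most the sum of the total variations of the real and imaginary parts. -/
instance isFiniteMeasure_variation {α : Type*} [MeasurableSpace α] (c : ComplexMeasure α) :
    IsFiniteMeasure c.variation := by
  have h : c.variation ≤ (ComplexMeasure.re c).totalVariation
      + (ComplexMeasure.im c).totalVariation := by
    refine VectorMeasure.variation_le_of_forall_enorm_le fun E _ => ?_
    have h1 : ‖(c E).re‖ₑ ≤ (ComplexMeasure.re c).totalVariation E :=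
      (ComplexMeasure.re c).enorm_le_totalVariation E
    have h2 : ‖(c E).im‖ₑ ≤ (ComplexMeasure.im c).totalVariation E :=
      (ComplexMeasure.im c).enorm_le_totalVariation E
    calc ‖c E‖ₑ ≤ ‖(c E).re‖ₑ + ‖(c E).im‖ₑ := by
          rw [← ofReal_norm, ← ofReal_norm, ← ofReal_norm,
            ← ENNReal.ofReal_add (norm_nonneg _) (norm_nonneg _)]
          exact ENNReal.ofReal_le_ofReal (Complex.norm_le_abs_re_add_abs_im _)
      _ ≤ _ := add_le_add h1 h2
  exact isFiniteMeasure_of_le _ h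

theorem integrable_of_continuous (c : ComplexMeasure Circle) (φ : C(Circle, ℂ)) :
    c.Integrable φ :=
  φ.continuous.integrable_of_hasCompactSupport (HasCompactSupport.of_compactSpace _)

/-- Integration of continuous functions against a complex measure on the circle, as a continuous
linear functional. -/
def integralCLM (c : ComplexMeasure Circle) : C(Circle, ℂ) →L[ℂ] ℂ :=
  LinearMap.mkContinuous
    { toFun := fun φ => c.integral φ (ContinuousLinearMap.mul ℝ ℂ)
      map_add' := fun φ χ =>
        VectorMeasure.integral_add (integrable_of_continuous c φ) (integrable_of_continuous c χ)
      map_smul' := fun a φ => setToFun_smul _ (fun b s x => by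
        change (b * x) * c s = b * (x * c s)
        ring) a φ }
    (‖ContinuousLinearMap.mul ℝ ℂ‖ * (c.variation.real Set.univ)) (by
      intro φ
      refine (VectorMeasure.norm_integral_le_integral_norm).trans ?_
      rw [mul_assoc]
      refine mul_le_mul_of_nonneg_left ?_ (ContinuousLinearMap.opNorm_nonneg _)
      have h : ∫ ζ, ‖φ ζ‖ ∂c.variation ≤ ∫ _, ‖φ‖ ∂c.variation :=
        integral_mono (integrable_of_continuous c φ).norm (integrable_const _)
          fun ζ => φ.norm_coe_le_norm ζ
      refine h.trans (le_of_eq ?_)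
      simp)

theorem integralCLM_apply (c : ComplexMeasure Circle) (φ : C(Circle, ℂ)) :
    integralCLM c φ = c.integral φ (ContinuousLinearMap.mul ℝ ℂ) := rfl

open Filter Topology in
/-- A complex measure on the circle is determined by the integrals of continuous functions:
indicators of closed sets are bounded limits of continuous functions. -/
theorem complexMeasure_ext {c d : ComplexMeasure Circle} (h : integralCLM c = integralCLM d) :
    c = d := by
  have key (e : ComplexMeasure Circle) {F : Set Circle} (hF : IsClosed F) :
      Tendsto (fun n : ℕ => e.integral (fun ζ => ((thickenedIndicator
        (Nat.one_div_pos_of_nat (n := n) (α := ℝ)) F ζ : NNReal) : ℂ))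
        (ContinuousLinearMap.mul ℝ ℂ)) atTop (𝓝 (e F)) := by
    have hind : e.integral (F.indicator fun _ => (1 : ℂ)) (ContinuousLinearMap.mul ℝ ℂ) = e F := by
      rw [VectorMeasure.integral_eq_setToFun, setToFun_indicator_const _ hF.measurableSet
        (measure_ne_top _ _)]
      simp [VectorMeasure.transpose]
    rw [← hind]
    refine VectorMeasure.tendsto_integral_of_dominated_convergence (fun _ => (1 : ℝ)) ?_
      (integrable_const _) ?_ ?_
    · intro n
      refine Continuous.aestronglyMeasurable ?_
      exact Complex.continuous_ofReal.comp (NNReal.continuous_coe.comp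
        (thickenedIndicator (Nat.one_div_pos_of_nat (n := n) (α := ℝ)) F).continuous)
    · intro n
      refine Eventually.of_forall fun ζ => ?_
      rw [Complex.norm_real, Real.norm_of_nonneg (NNReal.coe_nonneg _)]
      exact_mod_cast thickenedIndicator_le_one _ F ζ
    · refine Eventually.of_forall fun ζ => ?_
      have h1 := thickenedIndicator_tendsto_indicator_closure
        (fun n : ℕ => Nat.one_div_pos_of_nat (n := n) (α := ℝ))
        tendsto_one_div_add_atTop_nhds_zero_nat F
      rw [hF.closure_eq] at h1
      have h2 := (tendsto_pi_nhds.mp h1) ζ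
      have h3 := (Complex.continuous_ofReal.comp NNReal.continuous_coe).tendsto _ |>.comp h2
      refine h3.congr' ?_ |>.trans (le_of_eq ?_)
      · exact Eventually.of_forall fun n => rfl
      · by_cases hζ : ζ ∈ F <;> simp [hζ]
  have hcl {F : Set Circle} (hF : IsClosed F) : c F = d F := by
    refine tendsto_nhds_unique (key c hF) ((key d hF).congr fun n => ?_)
    exact (congrArg (fun L => L (⟨fun ζ => ((thickenedIndicator
        (Nat.one_div_pos_of_nat (n := n) (α := ℝ)) F ζ : NNReal) : ℂ),
        Complex.continuous_ofReal.comp (NNReal.continuous_coe.comp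
        (thickenedIndicator (Nat.one_div_pos_of_nat (n := n) (α := ℝ)) F).continuous)⟩ :
        C(Circle, ℂ))) h).symm
  refine VectorMeasure.ext_of_generateFrom {F | IsClosed F} (fun F hF => hcl hF) ?_
    isPiSystem_isClosed (hcl isClosed_univ)
  rw [← borel_eq_generateFrom_isClosed]
  exact BorelSpace.measurable_eq

/-- The function `ζ ↦ ζⁿ` on the circle. -/
def circlePow (n : ℤ) : C(Circle, ℂ) := ⟨fun ζ => ((ζ ^ n : Circle) : ℂ),
  (by fun_prop : Continuous fun ζ : Circle => (ζ : ℂ)).comp (continuous_zpow n)⟩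

theorem circlePow_apply (n : ℤ) (ζ : Circle) : circlePow n ζ = (ζ : ℂ) ^ n := by
  simp [circlePow]

theorem circlePow_zero : circlePow 0 = 1 := by
  ext ζ
  simp [circlePow_apply]

theorem circlePow_add (m n : ℤ) : circlePow (m + n) = circlePow m * circlePow n := by
  ext ζ
  simp [circlePow_apply, zpow_add₀]

theorem star_circlePow (n : ℤ) : star (circlePow n) = circlePow (-n) := by
  ext ζ
  simp only [ContinuousMap.star_apply, circlePow, ContinuousMap.coe_mk, RCLike.star_def, zpow_neg]
  rw [← Circle.coe_inv_eq_conj]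

theorem coe_sub_ne_zero {z : ℂ} (hz : ‖z‖ ≠ 1) (ζ : Circle) : (ζ : ℂ) - z ≠ 0 := by
  intro h
  rw [← sub_eq_zero.mp h] at hz
  exact hz ζ.norm_coe

open Classical in
/-- The function `ζ ↦ (ζ - z)⁻¹` on the circle, for `|z| ≠ 1` (and `0` otherwise). -/
def cauchyKernel (z : ℂ) : C(Circle, ℂ) :=
  if hz : ‖z‖ ≠ 1 then ⟨fun ζ => ((ζ : ℂ) - z)⁻¹,
    Continuous.inv₀ (by fun_prop) (coe_sub_ne_zero hz)⟩ else 0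

theorem cauchyKernel_apply {z : ℂ} (hz : ‖z‖ ≠ 1) (ζ : Circle) :
    cauchyKernel z ζ = ((ζ : ℂ) - z)⁻¹ := by
  rw [cauchyKernel, dif_pos hz]
  rfl

theorem sub_mul_cauchyKernel {z : ℂ} (hz : ‖z‖ ≠ 1) :
    (circlePow 1 - z • 1) * cauchyKernel z = 1 := by
  ext ζ
  simp [circlePow_apply, cauchyKernel_apply hz, mul_inv_cancel₀ (coe_sub_ne_zero hz ζ)]

/-- Laurent polynomials are dense in the continuous functions on the circle. -/
theorem eq_top_of_circlePow_mem {S : Submodule ℂ C(Circle, ℂ)} (hS : IsClosed (S : Set C(Circle, ℂ)))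
    (h : ∀ n, circlePow n ∈ S) : S = ⊤ := by
  let T : StarSubalgebra ℂ C(Circle, ℂ) := StarAlgebra.adjoin ℂ {circlePow 1}
  have hT : T.topologicalClosure = ⊤ := by
    refine ContinuousMap.starSubalgebra_topologicalClosure_eq_top_of_separatesPoints T ?_
    intro ζ ξ hne
    refine ⟨circlePow 1, ⟨circlePow 1, StarAlgebra.self_mem_adjoin_singleton ℂ _, rfl⟩, ?_⟩
    simpa [circlePow_apply, Circle.coe_inj] using hne
  have hspan : ∀ φ ∈ T, φ ∈ Submodule.span ℂ (Set.range circlePow) := by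
    intro φ hφ
    refine StarAlgebra.adjoin_induction (p := fun φ _ => φ ∈ Submodule.span ℂ (Set.range circlePow))
      ?_ ?_ ?_ ?_ ?_ hφ
    · rintro _ rfl
      exact Submodule.subset_span ⟨1, rfl⟩
    · intro a
      rw [Algebra.algebraMap_eq_smul_one, ← circlePow_zero]
      exact Submodule.smul_mem _ _ (Submodule.subset_span ⟨0, rfl⟩)
    · exact fun _ _ _ _ => Submodule.add_mem _
    · intro φ χ _ _ hφ hχ
      have := Submodule.mul_mem_mul hφ hχ
      rw [Submodule.span_mul_span] at this
      refine Submodule.span_mono ?_ this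
      rintro _ ⟨_, ⟨m, rfl⟩, _, ⟨n, rfl⟩, rfl⟩
      exact ⟨m + n, circlePow_add m n⟩
    · intro φ hφT hφ
      clear hφT
      induction hφ using Submodule.span_induction with
      | mem φ hφ =>
        obtain ⟨n, rfl⟩ := hφ
        exact Submodule.subset_span ⟨-n, (star_circlePow n).symm⟩
      | zero => simp
      | add φ χ _ _ h1 h2 =>
        rw [star_add]
        exact Submodule.add_mem _ h1 h2
      | smul a φ _ h1 =>
        rw [star_smul]
        exact Submodule.smul_mem _ _ h1
  have hTS : (T : Set C(Circle, ℂ)) ⊆ S := fun φ hφ =>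
    (Submodule.span_le.mpr (Set.range_subset_iff.mpr h)) (hspan φ hφ)
  refine eq_top_iff.mpr fun φ _ => ?_
  have h1 : φ ∈ closure (T : Set C(Circle, ℂ)) := by
    have : φ ∈ T.topologicalClosure := by rw [hT]; trivial
    exact this
  exact closure_minimal hTS hS h1

/-- A complex measure on the circle is determined by its Cauchy transform off the circle. -/
theorem complexMeasure_ext_of_cauchy {c d : ComplexMeasure Circle}
    (h : ∀ z : ℂ, ‖z‖ ≠ 1 → integralCLM c (cauchyKernel z) = integralCLM d (cauchyKernel z)) :
    c = d := by
  let S : Submodule ℂ C(Circle, ℂ) := (integralCLM c - integralCLM d).ker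
  have hmem (φ : C(Circle, ℂ)) : φ ∈ S ↔ integralCLM c φ = integralCLM d φ := by
    simp [S, sub_eq_zero]
  have hS : IsClosed (S : Set C(Circle, ℂ)) := (integralCLM c - integralCLM d).isClosed_ker
  have hpow (n : ℤ) : circlePow n ∈ S :=
    (mem_of_resolvent_mem (u := circlePow 1) hS circlePow_zero (fun n => circlePow_add n 1)
      (fun z hz => ⟨sub_mul_cauchyKernel hz, by rw [mul_comm]; exact sub_mul_cauchyKernel hz⟩)
      (fun z hz => (hmem _).mpr (h z hz)) n).1
  have htop := eq_top_of_circlePow_mem hS hpow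
  refine complexMeasure_ext (ContinuousLinearMap.ext fun φ => (hmem φ).mp ?_)
  rw [htop]
  trivial

open Filter Topology in
/-- Integration against a measure with density, for bounded continuous integrands. -/
theorem integral_withDensityᵥ {μ : Measure Circle} {g : Circle → ℂ} (hg : Integrable g μ)
    (φ : C(Circle, ℂ)) :
    integralCLM (μ.withDensityᵥ g) φ = ∫ ζ, φ ζ * g ζ ∂μ := by
  have hsimple (f : SimpleFunc Circle ℂ) :
      (μ.withDensityᵥ g).integral f (ContinuousLinearMap.mul ℝ ℂ) = ∫ ζ, f ζ * g ζ ∂μ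
        ∧ Integrable (fun ζ => f ζ * g ζ) μ := by
    have hint (f : SimpleFunc Circle ℂ) : (μ.withDensityᵥ g).Integrable f :=
      SimpleFunc.integrable_of_isFiniteMeasure f
    induction f using SimpleFunc.induction with
    | const a hs =>
      rename_i s
      have e1 : ⇑(SimpleFunc.piecewise s hs (SimpleFunc.const Circle a) (SimpleFunc.const Circle 0))
          = s.indicator fun _ => a := by
        ext ζ
        simp [Set.indicator, Set.piecewise]
      rw [e1]
      have e2 : (fun ζ => s.indicator (fun _ => a) ζ * g ζ) = s.indicator fun ζ => a * g ζ := by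
        ext ζ
        by_cases hζ : ζ ∈ s <;> simp [hζ]
      rw [e2]
      refine ⟨?_, (hg.const_mul a).indicator hs⟩
      rw [integral_indicator hs, integral_const_mul, VectorMeasure.integral_eq_setToFun,
        setToFun_indicator_const _ hs (measure_ne_top _ _)]
      simp [VectorMeasure.transpose, withDensityᵥ_apply hg hs, mul_comm]
    | @add f f' _ h1 h2 =>
      have e : (fun ζ => (f + f') ζ * g ζ) = fun ζ => f ζ * g ζ + f' ζ * g ζ := by
        ext ζ
        simp [add_mul]
      rw [e]
      refine ⟨?_, h1.2.add h2.2⟩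
      rw [integral_add h1.2 h2.2, ← h1.1, ← h2.1]
      exact VectorMeasure.integral_add (hint f) (hint f')
  have hφ := φ.continuous.stronglyMeasurable
  have hb := hφ.norm_approxBounded_le (c := ‖φ‖) (norm_nonneg _)
  have hlim (ζ : Circle) : Tendsto (fun n => hφ.approxBounded ‖φ‖ n ζ) atTop (𝓝 (φ ζ)) :=
    hφ.tendsto_approxBounded_of_norm_le (φ.norm_coe_le_norm ζ)
  have l1 : Tendsto (fun n => (μ.withDensityᵥ g).integral (hφ.approxBounded ‖φ‖ n)
      (ContinuousLinearMap.mul ℝ ℂ)) atTop (𝓝 (integralCLM (μ.withDensityᵥ g) φ)) :=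
    VectorMeasure.tendsto_integral_of_dominated_convergence (fun _ => ‖φ‖)
      (fun n => (SimpleFunc.stronglyMeasurable _).aestronglyMeasurable) (integrable_const _)
      (fun n => Eventually.of_forall fun ζ => hb n ζ) (Eventually.of_forall hlim)
  have l2 : Tendsto (fun n => ∫ ζ, hφ.approxBounded ‖φ‖ n ζ * g ζ ∂μ) atTop
      (𝓝 (∫ ζ, φ ζ * g ζ ∂μ)) := by
    refine tendsto_integral_of_dominated_convergence (fun ζ => ‖φ‖ * ‖g ζ‖)
      (fun n => (hsimple _).2.aestronglyMeasurable) (hg.norm.const_mul _) (fun n => ?_) ?_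
    · refine Eventually.of_forall fun ζ => ?_
      rw [norm_mul]
      exact mul_le_mul_of_nonneg_right (hb n ζ) (norm_nonneg _)
    · exact Eventually.of_forall fun ζ => (hlim ζ).mul_const _
  exact tendsto_nhds_unique l1 (l2.congr fun n => (hsimple _).1.symm)

/-! ### Reduction of the representation formula to the origin -/

/-- The walk as an element of the unitary group. -/
def walkUnitary (C : Coin) : unitary (L2 →L[ℂ] L2) := ⟨walk C, walk_mem_unitary C⟩

/-- The power `Uⁿ`, `n ∈ ℤ`. -/
def walkPow (C : Coin) (n : ℤ) : L2 →L[ℂ] L2 := ((walkUnitary C ^ n : unitary (L2 →L[ℂ] L2)) : _)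

theorem walkPow_zero (C : Coin) : walkPow C 0 = 1 := by simp [walkPow]

theorem walkPow_add (C : Coin) (m n : ℤ) : walkPow C (m + n) = walkPow C m * walkPow C n := by
  simp [walkPow, zpow_add]

theorem walkPow_one (C : Coin) : walkPow C 1 = walk C := by simp [walkPow, walkUnitary]

theorem inner_walkPow (C : Coin) (m : ℤ) (φ ψ : L2) :
    inner ℂ (walkPow C m φ) ψ = inner ℂ φ (walkPow C (-m) ψ) := by
  have h : walkPow C (-m) = star (walkPow C m) := by
    rw [walkPow, zpow_neg, ← Unitary.star_eq_inv]
    rfl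
  rw [h, ContinuousLinearMap.star_eq_adjoint, ContinuousLinearMap.adjoint_inner_right]

theorem walkResolvent_mul (C : Coin) {z : ℂ} (hz : ‖z‖ ≠ 1) :
    (walk C - z • 1) * walkResolvent C z = 1 ∧ walkResolvent C z * (walk C - z • 1) = 1 :=
  ⟨Ring.mul_inverse_cancel _ (isUnit_walk_sub C hz), Ring.inverse_mul_cancel _ (isUnit_walk_sub C hz)⟩

theorem walkPow_mul_walkResolvent (C : Coin) {z : ℂ} (hz : ‖z‖ ≠ 1) (n : ℤ) :
    walkResolvent C z * walkPow C n = walkPow C n * walkResolvent C z := by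
  have h : Commute (walk C) (walkPow C n) := by
    rw [← walkPow_one]
    change _ * _ = _ * _
    rw [← walkPow_add, ← walkPow_add, add_comm]
  have h1 : Commute (walk C - z • 1) (walkPow C n) :=
    h.sub_left ((Commute.one_left _).smul_left z)
  obtain ⟨hl, hr⟩ := walkResolvent_mul C hz
  calc walkResolvent C z * walkPow C n
      = walkResolvent C z * (walkPow C n * (walk C - z • 1)) * walkResolvent C z := by
        rw [mul_assoc, mul_assoc, hl, mul_one]
    _ = walkPow C n * walkResolvent C z := by
        rw [← h1.eq, ← mul_assoc, hr, one_mul]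

/-- The basis vector `e_j` of `ℂ²`, as an initial state at the origin. -/
def originVec (j : Fin 2) : Spin := EuclideanSpace.single j 1

theorem inner_toL2_single (x : ℤ) (v : Spin) (ψ : L2) :
    inner ℂ (toL2 (Finsupp.single x v)) ψ = inner ℂ v (ψ x) := by
  have h : toL2 (Finsupp.single x v) = lp.single 2 x v := by
    refine Subtype.ext (funext fun y => ?_)
    rw [toL2_apply]
    simp [Finsupp.single_apply, Pi.single_apply, eq_comm]
  rw [h, lp.inner_single_left]

/-- The pairs `(Uⁿ δ₀ e_j, ζⁿ e_j)`. Vectors and transforms are carried along together, so that a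
span of such pairs keeps track of both with the same coefficients. -/
def powPair (C : Coin) (nj : ℤ × Fin 2) : L2 × (Circle → Spin) :=
  (walkPow C nj.1 (toL2 (Finsupp.single 0 (originVec nj.2))),
    fun ζ => circlePow nj.1 ζ • originVec nj.2)

/-- Multiplication of pairs by `(Uᵐ, ζᵐ)`. -/
def shiftPair (C : Coin) (m : ℤ) : L2 × (Circle → Spin) →ₗ[ℂ] L2 × (Circle → Spin) where
  toFun p := (walkPow C m p.1, fun ζ => circlePow m ζ • p.2 ζ)
  map_add' p q := by
    refine Prod.ext (map_add _ _ _) (funext fun ζ => smul_add _ _ _)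
  map_smul' a p := by
    refine Prod.ext (map_smul _ _ _) (funext fun ζ => smul_comm (circlePow m ζ) a (p.2 ζ))

theorem shiftPair_powPair (C : Coin) (m : ℤ) (nj : ℤ × Fin 2) :
    shiftPair C m (powPair C nj) = powPair C (m + nj.1, nj.2) := by
  refine Prod.ext ?_ (funext fun ζ => ?_)
  · simp [shiftPair, powPair, walkPow_add]
  · simp [shiftPair, powPair, circlePow_add, mul_smul]

theorem shiftPair_mem (C : Coin) (m : ℤ) {p : L2 × (Circle → Spin)}
    (hp : p ∈ Submodule.span ℂ (Set.range (powPair C))) :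
    shiftPair C m p ∈ Submodule.span ℂ (Set.range (powPair C)) := by
  have h : Submodule.span ℂ (Set.range (powPair C))
      ≤ (Submodule.span ℂ (Set.range (powPair C))).comap (shiftPair C m) := by
    refine Submodule.span_le.mpr ?_
    rintro _ ⟨nj, rfl⟩
    change shiftPair C m (powPair C nj) ∈ Submodule.span ℂ (Set.range (powPair C))
    rw [shiftPair_powPair]
    exact Submodule.subset_span ⟨_, rfl⟩
  exact h hp

theorem shiftPair_neg_shiftPair (C : Coin) (m : ℤ) (p : L2 × (Circle → Spin)) :
    shiftPair C (-m) (shiftPair C m p) = p := by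
  refine Prod.ext ?_ (funext fun ζ => ?_)
  · change walkPow C (-m) (walkPow C m p.1) = p.1
    rw [← mul_apply_eq_comp, ← walkPow_add, neg_add_cancel, walkPow_zero]
    rfl
  · change circlePow (-m) ζ • circlePow m ζ • p.2 ζ = p.2 ζ
    rw [smul_smul, ← ContinuousMap.mul_apply, ← circlePow_add, neg_add_cancel, circlePow_zero]
    simp

/-- A finitely supported map as an element of `ℓ²`, paired with its transform. -/
def fourierPair (C : Coin) (f : ℤ →₀ Spin) : L2 × (Circle → Spin) := (toL2 f, circleFourier C f)

theorem fourierPair_add (C : Coin) (f g : ℤ →₀ Spin) :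
    fourierPair C (f + g) = fourierPair C f + fourierPair C g :=
  Prod.ext (toL2_add f g) (funext fun _ => fourier_add C f g _)

theorem fourierPair_single_smul (C : Coin) (x : ℤ) (a : ℂ) (v : Spin) :
    fourierPair C (Finsupp.single x (a • v)) = a • fourierPair C (Finsupp.single x v) := by
  refine Prod.ext ?_ (funext fun ζ => ?_)
  · change toL2 _ = a • toL2 _
    rw [← toL2_smul, Finsupp.smul_single]
  · change circleFourier C _ ζ = a • circleFourier C _ ζ
    rw [circleFourier_single, circleFourier_single, WithLp.ofLp_smul, Matrix.mulVec_smul,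
      WithLp.toLp_smul]

theorem shiftPair_fourierPair (C : Coin)
    (hC : ∀ x, (C x : Mat) 0 0 ≠ 0 ∧ (C x : Mat) 1 1 ≠ 0) (x : ℤ) (v : Spin) :
    shiftPair C 1 (fourierPair C (Finsupp.single x v)) = fourierPair C (stepSingle C x v) := by
  refine Prod.ext ?_ (funext fun ζ => ?_)
  · change walkPow C 1 _ = _
    rw [walkPow_one]
    exact walk_toL2_single C x v
  · change circlePow 1 ζ • _ = circleFourier C _ ζ
    rw [circleFourier_stepSingle C hC, circlePow_apply, zpow_one]
    rfl

theorem spin_eq_smul_originVec (v : Spin) : v = v 0 • originVec 0 + v 1 • originVec 1 := by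
  ext i
  fin_cases i <;> simp [originVec]

/-- The subspace `δ₀ ⊗ ℂ²` is cyclic: every finitely supported map is a combination of the
`Uⁿ δ₀ e_j`, and its transform is the corresponding Laurent polynomial. -/
theorem fourierPair_mem (C : Coin)
    (hC : ∀ x, (C x : Mat) 0 0 ≠ 0 ∧ (C x : Mat) 1 1 ≠ 0) (f : ℤ →₀ Spin) :
    fourierPair C f ∈ Submodule.span ℂ (Set.range (powPair C)) := by
  set S := Submodule.span ℂ (Set.range (powPair C)) with hS
  have hback {x : ℤ} {v : Spin} (h : fourierPair C (stepSingle C x v) ∈ S) :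
      fourierPair C (Finsupp.single x v) ∈ S := by
    rw [← shiftPair_fourierPair C hC] at h
    have := shiftPair_mem C (-1) h
    rwa [shiftPair_neg_shiftPair] at this
  have hforw {x : ℤ} {v : Spin} (h : fourierPair C (Finsupp.single x v) ∈ S) :
      fourierPair C (stepSingle C x v) ∈ S := by
    rw [← shiftPair_fourierPair C hC]
    exact shiftPair_mem C 1 h
  have hlin {x : ℤ} (h0 : fourierPair C (Finsupp.single x (originVec 0)) ∈ S)
      (h1 : fourierPair C (Finsupp.single x (originVec 1)) ∈ S) (v : Spin) :
      fourierPair C (Finsupp.single x v) ∈ S := by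
    rw [spin_eq_smul_originVec v, Finsupp.single_add, fourierPair_add, fourierPair_single_smul,
      fourierPair_single_smul]
    exact S.add_mem (S.smul_mem _ h0) (S.smul_mem _ h1)
  -- the vectors sent by the coin to the coordinate axes
  have hadj (x : ℤ) (v : Spin) : (C x : Mat).mulVec
      (WithLp.toLp 2 ((star (C x : Mat)).mulVec v.ofLp) : Spin).ofLp = v.ofLp := by
    rw [Matrix.mulVec_mulVec, Matrix.mem_unitaryGroup_iff.mp (C x).2, Matrix.one_mulVec]
  have hL (x : ℤ) : stepSingle C x (WithLp.toLp 2 ((star (C x : Mat)).mulVec (originVec 0).ofLp))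
      = Finsupp.single (x - 1) (originVec 0) := by
    have e : (!₂[(originVec 0).ofLp 0, 0] : Spin) = originVec 0 := by
      ext i
      fin_cases i <;> simp [originVec]
    have e' : (!₂[0, (originVec 0).ofLp 1] : Spin) = 0 := by
      ext i
      fin_cases i <;> simp [originVec]
    rw [stepSingle, hadj, e, e', Finsupp.single_zero, add_zero]
  have hR (x : ℤ) : stepSingle C x (WithLp.toLp 2 ((star (C x : Mat)).mulVec (originVec 1).ofLp))
      = Finsupp.single (x + 1) (originVec 1) := by
    have e : (!₂[0, (originVec 1).ofLp 1] : Spin) = originVec 1 := by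
      ext i
      fin_cases i <;> simp [originVec]
    have e' : (!₂[(originVec 1).ofLp 0, 0] : Spin) = 0 := by
      ext i
      fin_cases i <;> simp [originVec]
    rw [stepSingle, hadj, e, e', Finsupp.single_zero, zero_add]
  have dL (x : ℤ) : (WithLp.toLp 2 ((star (C x : Mat)).mulVec (originVec 0).ofLp) : Spin)
      = conj ((C x : Mat) 0 0) • originVec 0 + conj ((C x : Mat) 0 1) • originVec 1 := by
    ext i
    fin_cases i <;> simp [originVec, Matrix.star_eq_conjTranspose]
  have dR (x : ℤ) : (WithLp.toLp 2 ((star (C x : Mat)).mulVec (originVec 1).ofLp) : Spin)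
      = conj ((C x : Mat) 1 0) • originVec 0 + conj ((C x : Mat) 1 1) • originVec 1 := by
    ext i
    fin_cases i <;> simp [originVec, Matrix.star_eq_conjTranspose]
  have hcomb {x : ℤ} {a b : ℂ} {v w : Spin} (ha : a ≠ 0)
      (h : fourierPair C (Finsupp.single x (a • v + b • w)) ∈ S)
      (hw : fourierPair C (Finsupp.single x w) ∈ S) : fourierPair C (Finsupp.single x v) ∈ S := by
    rw [Finsupp.single_add, fourierPair_add, fourierPair_single_smul, fourierPair_single_smul] at h
    have h1 := (S.add_mem_iff_left (S.smul_mem b hw)).mp h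
    have h2 := S.smul_mem a⁻¹ h1
    rwa [inv_smul_smul₀ ha] at h2
  have hzero (j : Fin 2) : fourierPair C (Finsupp.single 0 (originVec j)) ∈ S := by
    refine Submodule.subset_span ⟨(0, j), Prod.ext ?_ (funext fun ζ => ?_)⟩
    · simp [powPair, fourierPair, walkPow_zero]
    · change _ = circleFourier C _ ζ
      rw [circleFourier_single]
      simp [powPair, circlePow_zero, fundamental, fundamentalPos]
  have hup (x : ℤ) (h : ∀ v, fourierPair C (Finsupp.single x v) ∈ S) (v : Spin) :
      fourierPair C (Finsupp.single (x + 1) v) ∈ S := by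
    have h1 : fourierPair C (Finsupp.single (x + 1) (originVec 1)) ∈ S := by
      rw [← hR]
      exact hforw (h _)
    refine hlin ?_ h1 v
    refine hcomb (b := conj ((C (x + 1) : Mat) 0 1))
      ((map_ne_zero (starRingEnd ℂ)).mpr (hC (x + 1)).1) ?_ h1
    rw [← dL]
    refine hback ?_
    rw [hL, add_sub_cancel_right]
    exact h _
  have hdown (x : ℤ) (h : ∀ v, fourierPair C (Finsupp.single x v) ∈ S) (v : Spin) :
      fourierPair C (Finsupp.single (x - 1) v) ∈ S := by
    have h0 : fourierPair C (Finsupp.single (x - 1) (originVec 0)) ∈ S := by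
      rw [← hL]
      exact hforw (h _)
    refine hlin h0 ?_ v
    refine hcomb (b := conj ((C (x - 1) : Mat) 1 0))
      ((map_ne_zero (starRingEnd ℂ)).mpr (hC (x - 1)).2) ?_ h0
    rw [add_comm, ← dR]
    refine hback ?_
    rw [hR, sub_add_cancel]
    exact h _
  have hall (x : ℤ) : ∀ v, fourierPair C (Finsupp.single x v) ∈ S := by
    induction x using Int.induction_on with
    | zero => exact hlin (hzero 0) (hzero 1)
    | succ n ih => exact hup _ ih
    | pred n ih => exact hdown _ ih
  induction f using Finsupp.induction_linear with
  | zero =>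
    have := hall 0 0
    rwa [Finsupp.single_zero] at this
  | add f g hf hg =>
    rw [fourierPair_add]
    exact S.add_mem hf hg
  | single x v => exact hall x v

/-! ### The representation formula and uniqueness -/

/-- If the resolvent at the origin has entries `∫ (ζ - z)⁻¹ dM_{ij}(ζ)`, then so does
`Uⁿ R(z)`, with the additional factor `ζⁿ`. -/
theorem walkPow_walkResolvent_origin (C : Coin) {M : MatMeasure}
    (hM : ∀ z : ℂ, ‖z‖ ≠ 1 → ∀ i j, integralCLM (M.entry i j) (cauchyKernel z)
      = (walkResolvent C z (toL2 (Finsupp.single 0 (originVec j))) 0) i)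
    {z : ℂ} (hz : ‖z‖ ≠ 1) (n : ℤ) (i j : Fin 2) :
    ((walkPow C n * walkResolvent C z) (toL2 (Finsupp.single 0 (originVec j))) 0) i
      = integralCLM (M.entry i j) (circlePow n * cauchyKernel z) := by
  let δ (j : Fin 2) : L2 := toL2 (Finsupp.single 0 (originVec j))
  have hδ (ψ : L2) : inner ℂ (δ i) ψ = (ψ 0) i := by
    simp [δ, inner_toL2_single, originVec, EuclideanSpace.inner_single_left]
  let L : (L2 →L[ℂ] L2) × C(Circle, ℂ) →L[ℂ] ℂ :=
    (innerSL ℂ (δ i)).comp ((ContinuousLinearMap.apply ℂ L2 (δ j)).comp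
      (ContinuousLinearMap.fst ℂ _ _)) - (integralCLM (M.entry i j)).comp
      (ContinuousLinearMap.snd ℂ _ _)
  have hL (X : L2 →L[ℂ] L2) (φ : C(Circle, ℂ)) : (X, φ) ∈ L.ker
      ↔ (X (δ j) 0) i = integralCLM (M.entry i j) φ := by
    rw [LinearMap.mem_ker, ← hδ]
    simp only [L]
    exact sub_eq_zero
  have h := (mem_of_resolvent_mem (A := (L2 →L[ℂ] L2) × C(Circle, ℂ)) (u := (walk C, circlePow 1))
    (p := fun n => (walkPow C n, circlePow n)) (R := fun z => (walkResolvent C z, cauchyKernel z))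
    (S := L.ker) L.isClosed_ker ?_ ?_ ?_ ?_ n).2 z hz
  · exact (hL _ _).mp h
  · exact Prod.ext (walkPow_zero C) circlePow_zero
  · intro n
    refine Prod.ext ?_ (circlePow_add n 1)
    change walkPow C (n + 1) = walkPow C n * walk C
    rw [walkPow_add, walkPow_one]
  · intro z hz
    obtain ⟨h1, h2⟩ := walkResolvent_mul C hz
    refine ⟨Prod.ext h1 (sub_mul_cauchyKernel hz), Prod.ext h2 ?_⟩
    change cauchyKernel z * (circlePow 1 - z • 1) = 1
    rw [mul_comm]
    exact sub_mul_cauchyKernel hz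
  · intro z hz
    exact (hL _ _).mpr (hM z hz i j).symm

/-- The pairs of `powPair`, with the second member read as a vector of continuous functions. -/
def contPowPair (C : Coin) (nj : ℤ × Fin 2) : L2 × (Fin 2 → C(Circle, ℂ)) :=
  (walkPow C nj.1 (toL2 (Finsupp.single 0 (originVec nj.2))), Pi.single nj.2 (circlePow nj.1))

/-- The values of a pair of continuous functions, as a map to `ℂ²`. -/
def evalPair : L2 × (Fin 2 → C(Circle, ℂ)) →ₗ[ℂ] L2 × (Circle → Spin) where
  toFun p := (p.1, fun ζ => WithLp.toLp 2 fun i => p.2 i ζ)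
  map_add' _ _ := rfl
  map_smul' _ _ := rfl

theorem evalPair_contPowPair (C : Coin) (nj : ℤ × Fin 2) :
    evalPair (contPowPair C nj) = powPair C nj := by
  obtain ⟨n, j⟩ := nj
  refine Prod.ext rfl (funext fun ζ => ?_)
  ext i
  change (Pi.single j (circlePow n) : Fin 2 → C(Circle, ℂ)) i ζ = circlePow n ζ * originVec j i
  fin_cases i <;> fin_cases j <;> simp [originVec]

theorem exists_evalPair_eq_fourierPair (C : Coin)
    (hC : ∀ x, (C x : Mat) 0 0 ≠ 0 ∧ (C x : Mat) 1 1 ≠ 0) (f : ℤ →₀ Spin) :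
    ∃ p ∈ Submodule.span ℂ (Set.range (contPowPair C)), evalPair p = fourierPair C f := by
  have h := fourierPair_mem C hC f
  have e : Set.range (powPair C) = evalPair '' Set.range (contPowPair C) := by
    rw [← Set.range_comp]
    exact congrArg Set.range (funext fun nj => (evalPair_contPowPair C nj).symm)
  rw [e, Submodule.span_image] at h
  exact h

/-- The representation formula for pairs in the span of the `(Uⁿ δ₀ e_j, ζⁿ e_j)`. It is
sesquilinear, and on generators unitarity moves all powers of `U` to one side. -/
theorem inner_walkResolvent_eq_sum (C : Coin) {M : MatMeasure}
    (hM : ∀ z : ℂ, ‖z‖ ≠ 1 → ∀ i j, integralCLM (M.entry i j) (cauchyKernel z)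
      = (walkResolvent C z (toL2 (Finsupp.single 0 (originVec j))) 0) i)
    {z : ℂ} (hz : ‖z‖ ≠ 1) {p q : L2 × (Fin 2 → C(Circle, ℂ))}
    (hp : p ∈ Submodule.span ℂ (Set.range (contPowPair C)))
    (hq : q ∈ Submodule.span ℂ (Set.range (contPowPair C))) :
    inner ℂ q.1 (walkResolvent C z p.1)
      = ∑ i, ∑ j, integralCLM (M.entry i j) (cauchyKernel z * p.2 j * star (q.2 i)) := by
  induction hp using Submodule.span_induction with
  | zero => simp
  | add p p' _ _ h h' =>
    simp only [Prod.fst_add, Prod.snd_add, Pi.add_apply, map_add, inner_add_right, h, h',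
      mul_add, add_mul, Finset.sum_add_distrib]
  | smul a p _ h =>
    simp only [Prod.smul_fst, Prod.smul_snd, Pi.smul_apply, map_smul, inner_smul_right, h,
      mul_smul_comm, smul_mul_assoc, smul_eq_mul, Finset.mul_sum]
  | mem p hp =>
    obtain ⟨⟨n, j⟩, rfl⟩ := hp
    induction hq using Submodule.span_induction with
    | zero => simp
    | add q q' _ _ h h' =>
      simp only [Prod.fst_add, Prod.snd_add, Pi.add_apply, map_add, inner_add_left, h, h',
        star_add, mul_add, Finset.sum_add_distrib]
    | smul a q _ h =>
      simp only [Prod.smul_fst, Prod.smul_snd, Pi.smul_apply, map_smul, inner_smul_left, h,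
        star_smul, mul_smul_comm, smul_eq_mul, Finset.mul_sum, RCLike.star_def]
    | mem q hq =>
      obtain ⟨⟨m, i⟩, rfl⟩ := hq
      have hδ (ψ : L2) : inner ℂ (toL2 (Finsupp.single 0 (originVec i))) ψ = (ψ 0) i := by
        simp [inner_toL2_single, originVec, EuclideanSpace.inner_single_left]
      have h1 : inner ℂ (contPowPair C (m, i)).1 (walkResolvent C z (contPowPair C (n, j)).1)
          = ((walkPow C (-m + n) * walkResolvent C z)
              (toL2 (Finsupp.single 0 (originVec j))) 0) i := by
        rw [← hδ, walkPow_add, mul_assoc, ← walkPow_mul_walkResolvent C hz]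
        exact inner_walkPow C m _ _
      rw [h1, walkPow_walkResolvent_origin C hM hz]
      have e : (cauchyKernel z * circlePow n * star (circlePow m))
          = circlePow (-m + n) * cauchyKernel z := by
        rw [star_circlePow, circlePow_add]
        ring
      rw [Finset.sum_eq_single i, Finset.sum_eq_single j]
      · simp only [contPowPair, Pi.single_eq_same, e]
      · intro j' _ hj'
        simp [contPowPair, Pi.single_eq_of_ne hj']
      · simp
      · intro i' _ hi'
        simp [contPowPair, Pi.single_eq_of_ne hi']
      · simp

/-- A positive matrix measure whose Cauchy transform is the resolvent at the origin represents
the whole resolvent, because `δ₀ ⊗ ℂ²` is cyclic. -/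
theorem isSpectralMatrixMeasure_of_origin (C : Coin)
    (hC : ∀ x, (C x : Mat) 0 0 ≠ 0 ∧ (C x : Mat) 1 1 ≠ 0) {M : MatMeasure} (hpos : M.IsPositive)
    (hM : ∀ z : ℂ, ‖z‖ ≠ 1 → ∀ i j, integralCLM (M.entry i j) (cauchyKernel z)
      = (walkResolvent C z (toL2 (Finsupp.single 0 (originVec j))) 0) i) :
    IsSpectralMatrixMeasure C M := by
  refine ⟨hpos, fun z hz f g => ?_⟩
  obtain ⟨p, hp, hpf⟩ := exists_evalPair_eq_fourierPair C hC f
  obtain ⟨q, hq, hqg⟩ := exists_evalPair_eq_fourierPair C hC g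
  have h := inner_walkResolvent_eq_sum C hM hz hp hq
  have hp1 : p.1 = toL2 f := congrArg Prod.fst hpf
  have hq1 : q.1 = toL2 g := congrArg Prod.fst hqg
  have hp2 (ζ : Circle) (j : Fin 2) : fourier C f (ζ : ℂ) j = p.2 j ζ :=
    congrArg (fun v : Spin => v j) (congrFun (congrArg Prod.snd hpf) ζ).symm
  have hq2 (ζ : Circle) (j : Fin 2) : fourier C g (ζ : ℂ) j = q.2 j ζ :=
    congrArg (fun v : Spin => v j) (congrFun (congrArg Prod.snd hqg) ζ).symm
  rw [← hp1, ← hq1, h]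
  refine Finset.sum_congr rfl fun i _ => Finset.sum_congr rfl fun j _ => ?_
  rw [integralCLM_apply]
  congr 1
  ext ζ
  simp [cauchyKernel_apply hz, hp2, hq2]

/-- The Cauchy transform of a spectral measure is the resolvent at the origin. -/
theorem integralCLM_cauchyKernel_eq (C : Coin) {M : MatMeasure} (h : IsSpectralMatrixMeasure C M)
    {z : ℂ} (hz : ‖z‖ ≠ 1) (i j : Fin 2) : integralCLM (M.entry i j) (cauchyKernel z)
      = (walkResolvent C z (toL2 (Finsupp.single 0 (originVec j))) 0) i := by
  have h1 := h.2 z hz (Finsupp.single 0 (originVec j)) (Finsupp.single 0 (originVec i))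
  have hδ (ψ : L2) : inner ℂ (toL2 (Finsupp.single 0 (originVec i))) ψ = (ψ 0) i := by
    simp [inner_toL2_single, originVec, EuclideanSpace.inner_single_left]
  have hf (j : Fin 2) (ζ : Circle) :
      fourier C (Finsupp.single 0 (originVec j)) (ζ : ℂ) = originVec j := by
    rw [fourier_single]
    simp [fundamental, fundamentalPos]
  rw [hδ] at h1
  rw [h1, MatMeasure.sesqIntegral]
  simp only [hf]
  rw [Finset.sum_eq_single i, Finset.sum_eq_single j]
  · rw [integralCLM_apply]
    congr 1
    ext ζ
    simp [cauchyKernel_apply hz, originVec]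
  · intro j' _ hj'
    simp [originVec, hj']
  · simp
  · intro i' _ hi'
    simp [originVec, hi']
  · simp

/-- A spectral measure is unique. -/
theorem IsSpectralMatrixMeasure.unique {C : Coin} {M M' : MatMeasure}
    (h : IsSpectralMatrixMeasure C M) (h' : IsSpectralMatrixMeasure C M') : M' = M := by
  have he (i j : Fin 2) : M'.entry i j = M.entry i j :=
    complexMeasure_ext_of_cauchy fun z hz => by
      rw [integralCLM_cauchyKernel_eq C h hz, integralCLM_cauchyKernel_eq C h' hz]
  refine VectorMeasure.ext fun A _ => ?_
  ext i j
  exact congrArg (fun c : ComplexMeasure Circle => c A) (he i j)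

/-! ### Integrals over the circle and the semicircle law -/

instance isFiniteMeasure_circleLebesgue : IsFiniteMeasure circleLebesgue := by
  have : IsFiniteMeasure ((volume.restrict (Set.Ioc (-Real.pi) Real.pi)).map Circle.exp) := by
    infer_instance
  refine Measure.smul_finite _ (ENNReal.inv_ne_top.mpr ?_)
  simpa using Real.pi_pos

theorem integral_neg_pi_pi {F : ℝ → ℂ} (hF : IntervalIntegrable F volume (-Real.pi) Real.pi) :
    ∫ θ in -Real.pi..Real.pi, F θ = ∫ θ in 0..Real.pi, (F θ + F (-θ)) := by
  have h0 : (0 : ℝ) ∈ Set.uIcc (-Real.pi) Real.pi := by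
    rw [Set.uIcc_of_le (by linarith [Real.pi_pos])]
    constructor <;> linarith [Real.pi_pos]
  have h1 : IntervalIntegrable F volume (-Real.pi) 0 :=
    hF.mono_set (Set.uIcc_subset_uIcc_left h0)
  have h2 : IntervalIntegrable F volume 0 Real.pi :=
    hF.mono_set (Set.uIcc_subset_uIcc_right h0)
  have h3 : IntervalIntegrable (fun θ => F (-θ)) volume 0 Real.pi := by
    
    have := (IntervalIntegrable.comp_sub_left (f := F) (c := 0) h1.symm)
    simpa using this
  rw [← intervalIntegral.integral_add_adjacent_intervals h1 h2, intervalIntegral.integral_add h2 h3,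
    intervalIntegral.integral_comp_neg]
  simp [add_comm]

theorem integral_circleLebesgue {F : Circle → ℂ} (hF : Integrable F circleLebesgue) :
    ∫ ζ, F ζ ∂circleLebesgue = (2 * Real.pi : ℂ)⁻¹ *
      ∫ θ in 0..Real.pi, (F (Circle.exp θ) + F (Circle.exp (-θ))) := by
  have hc : (ENNReal.ofReal (2 * Real.pi))⁻¹ ≠ 0 := ENNReal.inv_ne_zero.mpr ENNReal.ofReal_ne_top
  have hc' : (ENNReal.ofReal (2 * Real.pi))⁻¹ ≠ ⊤ :=
    ENNReal.inv_ne_top.mpr (by simpa using Real.pi_pos)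
  have h1 : Integrable F ((volume.restrict (Set.Ioc (-Real.pi) Real.pi)).map Circle.exp) :=
    (integrable_smul_measure hc hc').mp hF
  have hm : AEMeasurable Circle.exp (volume.restrict (Set.Ioc (-Real.pi) Real.pi)) :=
    Circle.exp.continuous.measurable.aemeasurable
  have h2 := (integrable_map_measure h1.aestronglyMeasurable hm).mp h1
  have h3 : IntervalIntegrable (fun θ => F (Circle.exp θ)) volume (-Real.pi) Real.pi :=
    (intervalIntegrable_iff_integrableOn_Ioc_of_le (by linarith [Real.pi_pos])).mpr h2
  rw [circleLebesgue, integral_smul_measure, integral_map hm h1.aestronglyMeasurable,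
    ← intervalIntegral.integral_of_le (by linarith [Real.pi_pos]), integral_neg_pi_pi h3]
  rw [ENNReal.toReal_inv, ENNReal.toReal_ofReal (by positivity), Complex.real_smul]
  push_cast
  rfl

/-- The substitution `x = r cos k`. -/
theorem integral_comp_cos {r : ℝ} (hr : 0 < r) (g : ℝ → ℂ) :
    ∫ x in Set.Ioo (-r) r, g x
      = ∫ k in 0..Real.pi, ((r * Real.sin k : ℝ) : ℂ) * g (r * Real.cos k) := by
  have himage : (fun k => r * Real.cos k) '' Set.Ioo 0 Real.pi = Set.Ioo (-r) r := by
    ext x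
    constructor
    · rintro ⟨k, ⟨h0, h1⟩, rfl⟩
      have e1 : Real.cos k < 1 := by
        have := Real.cos_lt_cos_of_nonneg_of_le_pi (le_refl 0) h1.le h0
        simpa using this
      have e2 : -1 < Real.cos k := by
        have := Real.cos_lt_cos_of_nonneg_of_le_pi h0.le le_rfl h1
        simpa using this
      constructor <;> nlinarith
    · rintro ⟨h0, h1⟩
      have e1 : -1 < x / r := by rw [lt_div_iff₀ hr]; linarith
      have e2 : x / r < 1 := by rw [div_lt_iff₀ hr]; linarith
      refine ⟨Real.arccos (x / r), ⟨Real.arccos_pos.mpr e2, ?_⟩, ?_⟩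
      · refine lt_of_le_of_ne (Real.arccos_le_pi _) fun h => ?_
        exact absurd (Real.arccos_eq_pi.mp h) (not_le.mpr e1)
      · change r * Real.cos (Real.arccos (x / r)) = x
        rw [Real.cos_arccos e1.le e2.le]
        field_simp
  rw [← himage, integral_image_eq_integral_abs_deriv_smul (f' := fun k => r * -Real.sin k)
    measurableSet_Ioo (fun k _ => ((Real.hasDerivAt_cos k).const_mul r).hasDerivWithinAt) ?_ g,
    intervalIntegral.integral_of_le Real.pi_pos.le, ← integral_Ioc_eq_integral_Ioo]
  · refine setIntegral_congr_fun measurableSet_Ioc fun k hk => ?_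
    have hs := Real.sin_nonneg_of_nonneg_of_le_pi hk.1.le hk.2
    have : |r * -Real.sin k| = r * Real.sin k := by
      rw [mul_neg, abs_neg, abs_of_nonneg (by positivity)]
    simp only [this, Complex.real_smul]
  · intro a ha b hb h
    have h' : r * Real.cos a = r * Real.cos b := h
    exact Real.injOn_cos ⟨ha.1.le, ha.2.le⟩ ⟨hb.1.le, hb.2.le⟩ (mul_left_cancel₀ hr.ne' h')

theorem one_sub_mul_ne_zero {κ w : ℂ} (hκ : ‖κ‖ < 1) (hw : ‖w‖ ≤ 1) : 1 - κ * w ≠ 0 := by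
  intro h
  have h1 : ‖κ * w‖ = 1 := by rw [← sub_eq_zero.mp h, norm_one]
  rw [norm_mul] at h1
  nlinarith [norm_nonneg κ, norm_nonneg w]

/-- The mean value property of `w ↦ (w² - 1) / (1 - κ w)` on the unit circle, folded onto the
upper half circle. -/
theorem integral_sin_sq_div {κ : ℂ} (hκ : ‖κ‖ < 1) :
    ∫ k in 0..Real.pi, ((Real.sin k : ℝ) : ℂ) ^ 2 / (1 + κ ^ 2 - 2 * κ * (Real.cos k : ℝ))
      = (Real.pi : ℂ) / 2 := by
  let f : ℂ → ℂ := fun w => (w ^ 2 - 1) / (1 - κ * w)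
  have hne {w : ℂ} (hw : w ∈ Metric.closedBall (0 : ℂ) 1) : 1 - κ * w ≠ 0 :=
    one_sub_mul_ne_zero hκ (by simpa using hw)
  have hf : DifferentiableOn ℂ f (Metric.closedBall 0 1) := by
    intro w hw
    refine DifferentiableAt.differentiableWithinAt ?_
    exact DifferentiableAt.div (by fun_prop) (by fun_prop) (hne hw)
  have hd : DiffContOnCl ℂ f (Metric.ball 0 |1|) := by
    rw [abs_one]
    refine DifferentiableOn.diffContOnCl ?_
    rwa [closure_ball _ one_ne_zero]
  have hmean := hd.circleAverage
  rw [Real.circleAverage_def] at hmean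
  have hper : Function.Periodic (fun θ : ℝ => f (circleMap 0 1 θ)) (2 * Real.pi) := fun θ => by
    simp [periodic_circleMap 0 1 θ]
  have hshift := hper.intervalIntegral_add_eq 0 (-Real.pi)
  rw [zero_add, show -Real.pi + 2 * Real.pi = Real.pi by ring] at hshift
  have hcont : Continuous fun θ : ℝ => f (circleMap 0 1 θ) := by
    refine hf.continuousOn.comp_continuous (continuous_circleMap 0 1) fun θ => ?_
    exact Metric.sphere_subset_closedBall (circleMap_mem_sphere 0 zero_le_one θ)
  rw [hshift, integral_neg_pi_pi (hcont.intervalIntegrable _ _)] at hmean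
  have hpt (k : ℝ) : f (circleMap 0 1 k) + f (circleMap 0 1 (-k))
      = -4 * (((Real.sin k : ℝ) : ℂ) ^ 2 / (1 + κ ^ 2 - 2 * κ * (Real.cos k : ℝ))) := by
    have e1 : circleMap 0 1 k = Real.cos k + Real.sin k * Complex.I := by
      rw [circleMap, Complex.exp_mul_I, Complex.ofReal_cos, Complex.ofReal_sin]
      simp
    have e2 : circleMap 0 1 (-k) = Real.cos k - Real.sin k * Complex.I := by
      rw [circleMap, Complex.exp_mul_I, Complex.ofReal_cos, Complex.ofReal_sin]
      simp [sub_eq_add_neg]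
    have n1 : 1 - κ * circleMap 0 1 k ≠ 0 := hne
      (Metric.sphere_subset_closedBall (circleMap_mem_sphere 0 zero_le_one k))
    have n2 : 1 - κ * circleMap 0 1 (-k) ≠ 0 := hne
      (Metric.sphere_subset_closedBall (circleMap_mem_sphere 0 zero_le_one (-k)))
    have hsc : ((Real.sin k : ℝ) : ℂ) ^ 2 + ((Real.cos k : ℝ) : ℂ) ^ 2 = 1 := by
      exact_mod_cast Real.sin_sq_add_cos_sq k
    have hI := Complex.I_sq
    change (circleMap 0 1 k ^ 2 - 1) / (1 - κ * circleMap 0 1 k)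
      + (circleMap 0 1 (-k) ^ 2 - 1) / (1 - κ * circleMap 0 1 (-k)) = _
    rw [e1] at n1 ⊢
    rw [e2] at n2 ⊢
    generalize ((Real.sin k : ℝ) : ℂ) = S at *
    generalize ((Real.cos k : ℝ) : ℂ) = T at *
    have hD : 1 + κ ^ 2 - 2 * κ * T = (1 - κ * (T + S * Complex.I)) * (1 - κ * (T - S * Complex.I)) := by
      linear_combination (-κ ^ 2) * hsc + κ ^ 2 * S ^ 2 * hI
    rw [hD, ← mul_div_assoc, div_add_div _ _ n1 n2]
    congr 1
    linear_combination (2 - 2 * κ * T) * hsc + (2 * S ^ 2 + 2 * κ * T * S ^ 2) * hI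
  simp only [hpt] at hmean
  rw [intervalIntegral.integral_const_mul, Complex.real_smul] at hmean
  have hpi : (Real.pi : ℂ) ≠ 0 := Complex.ofReal_ne_zero.mpr Real.pi_ne_zero
  have hf0 : f 0 = -1 := by simp [f]
  rw [hf0] at hmean
  push_cast at hmean ⊢
  field_simp at hmean
  linear_combination (-1 / 4 : ℂ) * hmean

/-- The Stieltjes transform of the semicircle. -/
theorem integral_semicircle {ρ : ℝ} (hρ : 0 < ρ) {κ : ℂ} (hκ : ‖κ‖ < 1) :
    ∫ x in Set.Ioo (-ρ) ρ, ((√(ρ ^ 2 - x ^ 2) : ℝ) : ℂ) / (ρ * (1 + κ ^ 2) - 2 * κ * x)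
      = (Real.pi : ℂ) * ρ / 2 := by
  rw [integral_comp_cos hρ]
  have h : ∀ k ∈ Set.uIcc 0 Real.pi, ((ρ * Real.sin k : ℝ) : ℂ) *
      (((√(ρ ^ 2 - (ρ * Real.cos k) ^ 2) : ℝ) : ℂ)
        / (ρ * (1 + κ ^ 2) - 2 * κ * (ρ * Real.cos k : ℝ)))
      = ρ * (((Real.sin k : ℝ) : ℂ) ^ 2 / (1 + κ ^ 2 - 2 * κ * (Real.cos k : ℝ))) := by
    intro k hk
    rw [Set.uIcc_of_le Real.pi_pos.le] at hk
    have hs := Real.sin_nonneg_of_nonneg_of_le_pi hk.1 hk.2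
    have hsq : √(ρ ^ 2 - (ρ * Real.cos k) ^ 2) = ρ * Real.sin k := by
      rw [← Real.sqrt_sq (by positivity : 0 ≤ ρ * Real.sin k)]
      congr 1
      linear_combination (-ρ ^ 2) * Real.sin_sq_add_cos_sq k
    have hρ' : (ρ : ℂ) ≠ 0 := Complex.ofReal_ne_zero.mpr hρ.ne'
    have e : (ρ : ℂ) * (1 + κ ^ 2) - 2 * κ * (ρ * Real.cos k : ℝ)
        = ρ * (1 + κ ^ 2 - 2 * κ * (Real.cos k : ℝ)) := by
      push_cast
      ring
    rw [hsq, e]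
    push_cast
    rw [← mul_div_mul_left (ρ * (Complex.sin k) : ℂ) _ hρ']
    field_simp
  rw [intervalIntegral.integral_congr h, intervalIntegral.integral_const_mul,
    integral_sin_sq_div hκ]
  ring

/-! ### The Cauchy transform of the density -/

/-- The density `w(x) (A |y| + sgn(y) B x)`, `ζ = x + i y`, with
`w(x) = √(ρ² - x²) / ((1-s)² - (2-2s-ρ²) x²)`. Since `√` vanishes on negative numbers, it is
supported on `|x| ≤ ρ`. -/
def density (ρ s : ℝ) (A B : ℂ) (ζ : Circle) : ℂ :=
  ((√(ρ ^ 2 - (ζ : ℂ).re ^ 2) / ((1 - s) ^ 2 - (2 - 2 * s - ρ ^ 2) * (ζ : ℂ).re ^ 2) : ℝ) : ℂ) *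
    (A * (|(ζ : ℂ).im| : ℝ) + Real.sign (ζ : ℂ).im * B * (ζ : ℂ).re)

theorem density_eq_zero {ρ s : ℝ} (hρ : 0 < ρ) (A B : ℂ) {ζ : Circle} (h : ρ ≤ |(ζ : ℂ).re|) :
    density ρ s A B ζ = 0 := by
  have h1 : ρ ^ 2 - (ζ : ℂ).re ^ 2 ≤ 0 := by
    rw [sub_nonpos, ← sq_abs (ζ : ℂ).re]
    exact pow_le_pow_left₀ hρ.le h 2
  rw [density, Real.sqrt_eq_zero_of_nonpos h1]
  simp

theorem spectral_denominator_ge {ρ s x : ℝ} (hm : 0 < 2 - 2 * s - ρ ^ 2) (hx : |x| ≤ ρ) :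
    (1 - s - ρ ^ 2) ^ 2 ≤ (1 - s) ^ 2 - (2 - 2 * s - ρ ^ 2) * x ^ 2 := by
  have h1 : x ^ 2 ≤ ρ ^ 2 := by
    rw [← sq_abs x]
    exact pow_le_pow_left₀ (abs_nonneg x) hx 2
  nlinarith [mul_le_mul_of_nonneg_left h1 hm.le]

theorem measurable_sign : Measurable Real.sign := by
  unfold Real.sign
  refine Measurable.ite measurableSet_Iio measurable_const
    (Measurable.ite measurableSet_Ioi measurable_const measurable_const)

theorem measurable_density (ρ s : ℝ) (A B : ℂ) : Measurable (density ρ s A B) := by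
  have hc : Measurable fun ζ : Circle => (ζ : ℂ) :=
    (by fun_prop : Continuous fun ζ : Circle => (ζ : ℂ)).measurable
  have hre : Measurable fun ζ : Circle => (ζ : ℂ).re := Complex.measurable_re.comp hc
  have him : Measurable fun ζ : Circle => (ζ : ℂ).im := Complex.measurable_im.comp hc
  have hsg : Measurable fun ζ : Circle => Real.sign (ζ : ℂ).im := measurable_sign.comp him
  have habs : Measurable fun ζ : Circle => |(ζ : ℂ).im| := continuous_abs.measurable.comp him
  unfold density
  refine Measurable.mul (Complex.measurable_ofReal.comp ?_) (Measurable.add ?_ ?_)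
  · exact ((measurable_const.sub (hre.pow_const 2)).sqrt).div
      (measurable_const.sub ((hre.pow_const 2).const_mul _))
  · exact (Complex.measurable_ofReal.comp habs).const_mul A
  · exact ((Complex.measurable_ofReal.comp hsg).mul_const B).mul
      (Complex.measurable_ofReal.comp hre)

/-- The density is bounded, since its denominator is bounded below on the support. -/
theorem integrable_density {ρ s : ℝ} (hρ : 0 < ρ) (hs : ρ ^ 2 < 1 - s) (A B : ℂ) :
    Integrable (density ρ s A B) circleLebesgue := by
  have hd : 0 < (1 - s - ρ ^ 2) ^ 2 := by
    have : 0 < 1 - s - ρ ^ 2 := by linarith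
    positivity
  refine Integrable.of_bound (measurable_density ρ s A B).aestronglyMeasurable
    (ρ / (1 - s - ρ ^ 2) ^ 2 * (‖A‖ + ‖B‖)) (Filter.Eventually.of_forall fun ζ => ?_)
  rcases le_or_gt ρ |(ζ : ℂ).re| with h | h
  · rw [density_eq_zero hρ A B h, norm_zero]
    positivity
  · rw [density, norm_mul]
    have hre : |(ζ : ℂ).re| ≤ 1 := (Complex.abs_re_le_norm _).trans ζ.norm_coe.le
    have him : |(ζ : ℂ).im| ≤ 1 := (Complex.abs_im_le_norm _).trans ζ.norm_coe.le
    have hden := spectral_denominator_ge (s := s) (by nlinarith) h.le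
    have hsq : √(ρ ^ 2 - (ζ : ℂ).re ^ 2) ≤ ρ := by
      rw [Real.sqrt_le_left hρ.le]
      nlinarith [sq_nonneg (ζ : ℂ).re]
    have hsg : |Real.sign (ζ : ℂ).im| ≤ 1 := by
      rcases Real.sign_apply_eq (ζ : ℂ).im with h | h | h <;> rw [h] <;> norm_num
    refine mul_le_mul ?_ ?_ (norm_nonneg _) (by positivity)
    · rw [Complex.norm_real, Real.norm_of_nonneg (div_nonneg (Real.sqrt_nonneg _)
        (hd.le.trans hden))]
      exact div_le_div₀ hρ.le hsq hd hden
    · refine (norm_add_le _ _).trans (add_le_add ?_ ?_)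
      · rw [norm_mul, Complex.norm_real, Real.norm_eq_abs, abs_abs]
        exact mul_le_of_le_one_right (norm_nonneg _) him
      · rw [norm_mul, norm_mul, Complex.norm_real, Complex.norm_real, Real.norm_eq_abs,
          Real.norm_eq_abs]
        calc _ ≤ 1 * ‖B‖ * 1 := by gcongr
          _ = ‖B‖ := by ring

theorem circle_re_sq_add_im_sq (ζ : Circle) : (ζ : ℂ).re ^ 2 + (ζ : ℂ).im ^ 2 = 1 := by
  have h := ζ.normSq_coe
  rw [Complex.normSq_apply] at h
  linarith

/-- The Cauchy kernel at `ζ = x + i y` and at `ζ⁻¹`, weighted with `A y ± B x`. -/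
theorem cauchy_pair {z : ℂ} (hz : ‖z‖ ≠ 1) (A B : ℂ) (ζ : Circle) :
    ((ζ : ℂ) - z)⁻¹ * (A * (ζ : ℂ).im + B * (ζ : ℂ).re)
      + (((ζ⁻¹ : Circle) : ℂ) - z)⁻¹ * (A * (ζ : ℂ).im - B * (ζ : ℂ).re)
      = 2 * (ζ : ℂ).im * (((A - Complex.I * B) * (ζ : ℂ).re - A * z)
        / (1 + z ^ 2 - 2 * z * (ζ : ℂ).re)) := by
  have n1 := coe_sub_ne_zero hz ζ
  have n2 := coe_sub_ne_zero hz ζ⁻¹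
  have e1 : (ζ : ℂ) = (ζ : ℂ).re + (ζ : ℂ).im * Complex.I := (Complex.re_add_im _).symm
  have e2 : ((ζ⁻¹ : Circle) : ℂ) = (ζ : ℂ).re - (ζ : ℂ).im * Complex.I := by
    rw [Circle.coe_inv_eq_conj]
    apply Complex.ext <;> simp
  have hsc : (((ζ : ℂ).re : ℝ) : ℂ) ^ 2 + (((ζ : ℂ).im : ℝ) : ℂ) ^ 2 = 1 := by
    exact_mod_cast circle_re_sq_add_im_sq ζ
  have hI := Complex.I_sq
  rw [e2] at n2 ⊢
  generalize (((ζ : ℂ).re : ℝ) : ℂ) = T at *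
  generalize (((ζ : ℂ).im : ℝ) : ℂ) = S at *
  rw [e1] at n1 ⊢
  have hD : 1 + z ^ 2 - 2 * z * T = (T + S * Complex.I - z) * (T - S * Complex.I - z) := by
    linear_combination (-1 : ℂ) * hsc + S ^ 2 * hI
  rw [hD, ← mul_div_assoc, inv_mul_eq_div, inv_mul_eq_div, div_add_div _ _ n1 n2]
  congr 1
  ring

theorem integral_cauchy_density {ρ s : ℝ} (hρ : 0 < ρ) (hρ1 : ρ < 1) (hs : ρ ^ 2 < 1 - s)
    (A B : ℂ) {z : ℂ} (hz : ‖z‖ ≠ 1) :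
    ∫ ζ, cauchyKernel z ζ * density ρ s A B ζ ∂circleLebesgue
      = (Real.pi : ℂ)⁻¹ * ∫ x in Set.Ioo (-ρ) ρ,
        ((√(ρ ^ 2 - x ^ 2) / ((1 - s) ^ 2 - (2 - 2 * s - ρ ^ 2) * x ^ 2) : ℝ) : ℂ)
          * (((A - Complex.I * B) * x - A * z) / (1 + z ^ 2 - 2 * z * x)) := by
  set G : ℝ → ℂ := fun x =>
    ((√(ρ ^ 2 - x ^ 2) / ((1 - s) ^ 2 - (2 - 2 * s - ρ ^ 2) * x ^ 2) : ℝ) : ℂ)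
          * (((A - Complex.I * B) * x - A * z) / (1 + z ^ 2 - 2 * z * x)) with hG
  have hint : Integrable (fun ζ => cauchyKernel z ζ * density ρ s A B ζ) circleLebesgue := by
    refine (integrable_density hρ hs A B).bdd_mul (c := ‖cauchyKernel z‖)
      (cauchyKernel z).continuous.aestronglyMeasurable
      (Filter.Eventually.of_forall fun ζ => (cauchyKernel z).norm_coe_le_norm ζ)
  have hfold : ∫ θ in 0..Real.pi, (cauchyKernel z (Circle.exp θ) * density ρ s A B (Circle.exp θ)
      + cauchyKernel z (Circle.exp (-θ)) * density ρ s A B (Circle.exp (-θ)))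
      = ∫ θ in 0..Real.pi, 2 * (((1 * Real.sin θ : ℝ) : ℂ) * G (1 * Real.cos θ)) := by
    rw [intervalIntegral.integral_of_le Real.pi_pos.le, intervalIntegral.integral_of_le
      Real.pi_pos.le, integral_Ioc_eq_integral_Ioo, integral_Ioc_eq_integral_Ioo]
    refine setIntegral_congr_fun measurableSet_Ioo fun θ hθ => ?_
    have hsin : 0 < Real.sin θ := Real.sin_pos_of_pos_of_lt_pi hθ.1 hθ.2
    have r1 : ((Circle.exp θ : Circle) : ℂ).re = Real.cos θ := by
      rw [Circle.coe_exp, Complex.exp_ofReal_mul_I_re]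
    have r2 : ((Circle.exp (-θ) : Circle) : ℂ).re = Real.cos θ := by
      rw [Circle.coe_exp, Complex.exp_ofReal_mul_I_re, Real.cos_neg]
    have i1 : ((Circle.exp θ : Circle) : ℂ).im = Real.sin θ := by
      rw [Circle.coe_exp, Complex.exp_ofReal_mul_I_im]
    have i2 : ((Circle.exp (-θ) : Circle) : ℂ).im = -Real.sin θ := by
      rw [Circle.coe_exp, Complex.exp_ofReal_mul_I_im, Real.sin_neg]
    have hpair := cauchy_pair hz A B (Circle.exp θ)
    rw [← Circle.exp_neg] at hpair
    simp only [cauchyKernel_apply hz, density, r1, r2, i1, i2, Real.sign_of_pos hsin,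
      Real.sign_of_neg (neg_neg_of_pos hsin), abs_neg, abs_of_pos hsin, one_mul, hG] at hpair ⊢
    generalize √(ρ ^ 2 - Real.cos θ ^ 2) /
      ((1 - s) ^ 2 - (2 - 2 * s - ρ ^ 2) * Real.cos θ ^ 2) = w
    generalize Real.cos θ = T at *
    generalize Real.sin θ = S at *
    simp only [Complex.ofReal_neg, Complex.ofReal_one]
    linear_combination (w : ℂ) * hpair
  have hsupp : ∫ x in Set.Ioo (-1) 1, G x = ∫ x in Set.Ioo (-ρ) ρ, G x := by
    refine setIntegral_eq_of_subset_of_forall_sdiff_eq_zero measurableSet_Ioo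
      (Set.Ioo_subset_Ioo (by linarith) hρ1.le) fun x hx => ?_
    have hx' : ρ ≤ |x| := by
      by_contra hlt
      exact hx.2 (abs_lt.mp (not_le.mp hlt))
    have h1 : ρ ^ 2 - x ^ 2 ≤ 0 := by
      rw [sub_nonpos, ← sq_abs x]
      exact pow_le_pow_left₀ hρ.le hx' 2
    simp only [hG]
    rw [Real.sqrt_eq_zero_of_nonpos h1]
    simp
  rw [integral_circleLebesgue hint, hfold, intervalIntegral.integral_const_mul,
    ← integral_comp_cos one_pos, hsupp, ← mul_assoc]
  congr 1
  have hpi : (Real.pi : ℂ) ≠ 0 := Complex.ofReal_ne_zero.mpr Real.pi_ne_zero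
  field_simp

/-- With `x = ρ cos k` the denominator is `ρ (1 - κ e^{ik}) (1 - κ e^{-ik})`. -/
theorem semicircle_denominator_ne_zero {ρ x : ℝ} (hρ : 0 < ρ) (hx : |x| ≤ ρ) {κ : ℂ}
    (hκ : ‖κ‖ < 1) : ρ * (1 + κ ^ 2) - 2 * κ * x ≠ 0 := by
  have hx' := abs_le.mp hx
  have hcos : Real.cos (Real.arccos (x / ρ)) = x / ρ := by
    refine Real.cos_arccos ?_ ?_
    · rw [le_div_iff₀ hρ]; linarith
    · rw [div_le_iff₀ hρ]; linarith
  set k := Real.arccos (x / ρ)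
  have hxk : (x : ℂ) = ρ * Real.cos k := by
    rw [hcos]
    push_cast
    have : (ρ : ℂ) ≠ 0 := Complex.ofReal_ne_zero.mpr hρ.ne'
    field_simp
  have n1 : 1 - κ * Complex.exp (k * Complex.I) ≠ 0 :=
    one_sub_mul_ne_zero hκ (Complex.norm_exp_ofReal_mul_I k).le
  have n2 : 1 - κ * Complex.exp ((-k : ℝ) * Complex.I) ≠ 0 :=
    one_sub_mul_ne_zero hκ (Complex.norm_exp_ofReal_mul_I (-k)).le
  have e : (ρ : ℂ) * (1 + κ ^ 2) - 2 * κ * x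
      = ρ * ((1 - κ * Complex.exp (k * Complex.I)) * (1 - κ * Complex.exp ((-k : ℝ) * Complex.I))) := by
    have h1 : Complex.exp (k * Complex.I) * Complex.exp ((-k : ℝ) * Complex.I) = 1 := by
      rw [← Complex.exp_add]
      simp
    have h2 : Complex.exp (k * Complex.I) + Complex.exp ((-k : ℝ) * Complex.I)
        = 2 * Real.cos k := by
      rw [Complex.ofReal_cos, Complex.two_cos]
      simp
    rw [hxk]
    linear_combination (-ρ * κ ^ 2 : ℂ) * h1 + ρ * κ * h2
  rw [e]
  exact mul_ne_zero (Complex.ofReal_ne_zero.mpr hρ.ne') (mul_ne_zero n1 n2)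

theorem integrableOn_semicircle {ρ : ℝ} (hρ : 0 < ρ) {κ : ℂ} (hκ : ‖κ‖ < 1) :
    IntegrableOn (fun x : ℝ => ((√(ρ ^ 2 - x ^ 2) : ℝ) : ℂ) / (ρ * (1 + κ ^ 2) - 2 * κ * x))
      (Set.Ioo (-ρ) ρ) := by
  refine (ContinuousOn.integrableOn_Icc ?_).mono_set Set.Ioo_subset_Icc_self
  refine ContinuousOn.div (by fun_prop) (by fun_prop) fun x hx => ?_
  exact semicircle_denominator_ne_zero hρ (abs_le.mpr hx) hκ

theorem joukowsky_ne_zero {z : ℂ} (hz : ‖z‖ ≠ 1) {x : ℝ} (hx : |x| < 1) :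
    1 + z ^ 2 - 2 * z * x ≠ 0 := by
  intro h
  exact hz (norm_eq_one_of_joukowsky hx (by linear_combination h))

theorem partial_fractions_identity (q D P : ℂ) (z : ℂ) {E X x : ℂ} (hX : X ≠ 0)
    (h0 : E - 2 * z * x ≠ 0) (h1 : E - 2 * z * X ≠ 0) (h2 : E + 2 * z * X ≠ 0) (h3 : X - x ≠ 0)
    (h4 : X + x ≠ 0) :
    q / ((X - x) * (X + x)) * ((D * x - P) / (E - 2 * z * x))
      = (4 * z ^ 2 * P - 2 * z * D * E) / ((E - 2 * z * X) * (E + 2 * z * X))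
          * (q / (E - 2 * z * x))
        + ((D * X - P) / (2 * X * (E - 2 * z * X)) * (q / (X - x))
          + (-D * X - P) / (2 * X * (E + 2 * z * X)) * (q / (X + x))) := by
  generalize hW : E - 2 * z * x = W at *
  generalize hU : E - 2 * z * X = U at *
  generalize hV : E + 2 * z * X = V at *
  generalize hR : X - x = R at *
  generalize hT : X + x = T at *
  field_simp
  rw [← hU, ← hV, ← hR, ← hT, ← hW]
  ring

/-- The integral of the density against the Cauchy kernel, by partial fractions in `x`. The three
poles `(1 + z²) / (2z)` and `±X` are the images of `η z` and `±ρ / k` under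
`κ ↦ ρ (κ + κ⁻¹) / 2`. -/
theorem integral_partial_fractions {ρ k X : ℝ} (hρ : 0 < ρ) (hk : ρ < k)
    (hX : 2 * k * X = k ^ 2 + ρ ^ 2) (hX1 : X < 1) {z η : ℂ} (hz : ‖z‖ ≠ 1) (hκ : ‖η * z‖ < 1)
    (hη : (1 + z ^ 2) * η = ρ * (1 + η ^ 2 * z ^ 2)) (D P : ℂ) :
    (Real.pi : ℂ)⁻¹ * ∫ x in Set.Ioo (-ρ) ρ, ((√(ρ ^ 2 - x ^ 2) : ℝ) : ℂ) / (X ^ 2 - x ^ 2)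
        * ((D * x - P) / (1 + z ^ 2 - 2 * z * x))
      = (4 * z ^ 2 * P - 2 * z * D * (1 + z ^ 2)) / ((1 + z ^ 2) ^ 2 - 4 * z ^ 2 * X ^ 2)
          * (η * ρ / 2)
        + (2 * z * D * X ^ 2 - P * (1 + z ^ 2)) / (X * ((1 + z ^ 2) ^ 2 - 4 * z ^ 2 * X ^ 2))
          * (ρ ^ 2 / k) := by
  have hk0 : 0 < k := hρ.trans hk
  have hXρ : ρ < X := by nlinarith [sq_nonneg (k - ρ), mul_pos (sub_pos.mpr hk) (sub_pos.mpr hk)]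
  have hX0 : 0 < X := hρ.trans hXρ
  have hXc : (X : ℂ) ≠ 0 := Complex.ofReal_ne_zero.mpr hX0.ne'
  have hkc : (k : ℂ) ≠ 0 := Complex.ofReal_ne_zero.mpr hk0.ne'
  have hη0 : η ≠ 0 := by
    rintro rfl
    rw [mul_zero, zero_pow two_ne_zero, zero_mul, add_zero, mul_one] at hη
    exact hρ.ne' (Complex.ofReal_eq_zero.mp hη.symm)
  have n1 : 1 + z ^ 2 - 2 * z * X ≠ 0 := joukowsky_ne_zero hz (by rwa [abs_of_pos hX0])
  have n2 : 1 + z ^ 2 + 2 * z * X ≠ 0 := by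
    have := joukowsky_ne_zero hz (x := -X) (by rwa [abs_neg, abs_of_pos hX0])
    rw [Complex.ofReal_neg] at this
    convert this using 1
    ring
  have n12 : (1 + z ^ 2) ^ 2 - 4 * z ^ 2 * X ^ 2 ≠ 0 := by
    have := mul_ne_zero n1 n2
    convert this using 1
    ring
  set κs : ℂ := ((ρ / k : ℝ) : ℂ) with hκs
  have hκs1 : ‖κs‖ < 1 := by
    rw [hκs, Complex.norm_real, Real.norm_of_nonneg (by positivity), div_lt_one hk0]
    exact hk
  have hκs2 : ‖-κs‖ < 1 := by rwa [norm_neg]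
  have hκX : ρ * (1 + κs ^ 2) = 2 * κs * X := by
    have : ρ * (1 + (ρ / k) ^ 2) = 2 * (ρ / k) * X := by
      field_simp
      linear_combination -hX
    rw [hκs]
    exact_mod_cast this
  let Q : ℂ → ℝ → ℂ := fun κ x =>
    ((√(ρ ^ 2 - x ^ 2) : ℝ) : ℂ) / (ρ * (1 + κ ^ 2) - 2 * κ * x)
  set a : ℂ := (4 * z ^ 2 * P - 2 * z * D * (1 + z ^ 2)) / ((1 + z ^ 2) ^ 2 - 4 * z ^ 2 * X ^ 2)
    with ha
  set b : ℂ := (D * X - P) / (2 * X * (1 + z ^ 2 - 2 * z * X)) with hb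
  set c : ℂ := (-D * X - P) / (2 * X * (1 + z ^ 2 + 2 * z * X)) with hc
  have hpf {x : ℝ} (hx : x ∈ Set.Ioo (-ρ) ρ) :
      ((√(ρ ^ 2 - x ^ 2) : ℝ) : ℂ) / (X ^ 2 - x ^ 2) * ((D * x - P) / (1 + z ^ 2 - 2 * z * x))
      = a * η * Q (η * z) x + (2 * b * κs * Q κs x + 2 * c * κs * Q (-κs) x) := by
    have hx' : |x| < ρ := abs_lt.mpr hx
    have m0 : 1 + z ^ 2 - 2 * z * x ≠ 0 := joukowsky_ne_zero hz (by linarith)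
    have m1 : (X : ℂ) - x ≠ 0 := by
      rw [← Complex.ofReal_sub, Complex.ofReal_ne_zero]
      linarith [hx.2]
    have m2 : (X : ℂ) + x ≠ 0 := by
      rw [← Complex.ofReal_add, Complex.ofReal_ne_zero]
      linarith [hx.1]
    have hκs0 : κs ≠ 0 := Complex.ofReal_ne_zero.mpr (div_pos hρ hk0).ne'
    have q0 : η * Q (η * z) x = ((√(ρ ^ 2 - x ^ 2) : ℝ) : ℂ) / (1 + z ^ 2 - 2 * z * x) := by
      have : (ρ : ℂ) * (1 + (η * z) ^ 2) - 2 * (η * z) * x = η * (1 + z ^ 2 - 2 * z * x) := by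
        linear_combination -hη
      simp only [Q]
      rw [this]
      field_simp
    have q1 : 2 * κs * Q κs x = ((√(ρ ^ 2 - x ^ 2) : ℝ) : ℂ) / (X - x) := by
      simp only [Q]
      rw [hκX, show 2 * κs * (X : ℂ) - 2 * κs * x = 2 * κs * (X - x) by ring]
      field_simp
    have q2 : 2 * κs * Q (-κs) x = ((√(ρ ^ 2 - x ^ 2) : ℝ) : ℂ) / (X + x) := by
      simp only [Q]
      rw [neg_sq, hκX, show 2 * κs * (X : ℂ) - 2 * -κs * x = 2 * κs * (X + x) by ring]
      field_simp
    have q12 : a * η * Q (η * z) x + (2 * b * κs * Q κs x + 2 * c * κs * Q (-κs) x)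
        = a * (η * Q (η * z) x) + (b * (2 * κs * Q κs x) + c * (2 * κs * Q (-κs) x)) := by ring
    have hX2 : (X : ℂ) ^ 2 - x ^ 2 = (X - x) * (X + x) := by ring
    have hn12 : (1 + z ^ 2) ^ 2 - 4 * z ^ 2 * (X : ℂ) ^ 2
        = (1 + z ^ 2 - 2 * z * X) * (1 + z ^ 2 + 2 * z * X) := by ring
    rw [q12, q0, q1, q2, ha, hb, hc, hX2, hn12]
    exact partial_fractions_identity _ _ _ _ hXc m0 n1 n2 m1 m2
  rw [setIntegral_congr_fun measurableSet_Ioo fun x hx => hpf hx]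
  have hQ {κ : ℂ} (h : ‖κ‖ < 1) : Integrable (Q κ) (volume.restrict (Set.Ioo (-ρ) ρ)) :=
    integrableOn_semicircle hρ h
  have hQi {κ : ℂ} (h : ‖κ‖ < 1) : ∫ x in Set.Ioo (-ρ) ρ, Q κ x = (Real.pi : ℂ) * ρ / 2 :=
    integral_semicircle hρ h
  have hi0 := (hQ hκ).const_mul (a * η)
  have hi1 := (hQ hκs1).const_mul (2 * b * κs)
  have hi2 := (hQ hκs2).const_mul (2 * c * κs)
  have hi12 : Integrable (fun x => 2 * b * κs * Q κs x + 2 * c * κs * Q (-κs) x)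
    (volume.restrict (Set.Ioo (-ρ) ρ)) := hi1.add hi2
  rw [integral_add hi0 hi12, integral_add hi1 hi2,
    integral_const_mul, integral_const_mul, integral_const_mul, hQi hκ, hQi hκs1, hQi hκs2]
  have hpi : (Real.pi : ℂ) ≠ 0 := Complex.ofReal_ne_zero.mpr Real.pi_ne_zero
  have hbc : b + c = (2 * z * D * X ^ 2 - P * (1 + z ^ 2))
      / (X * ((1 + z ^ 2) ^ 2 - 4 * z ^ 2 * X ^ 2)) := by
    have hn12 : (1 + z ^ 2) ^ 2 - 4 * z ^ 2 * (X : ℂ) ^ 2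
        = (1 + z ^ 2 - 2 * z * X) * (1 + z ^ 2 + 2 * z * X) := by ring
    rw [hb, hc, hn12]
    generalize hU : 1 + z ^ 2 - 2 * z * (X : ℂ) = U at *
    generalize hV : 1 + z ^ 2 + 2 * z * (X : ℂ) = V at *
    field_simp
    rw [← hU, ← hV]
    ring
  have hκsk : κs = ρ / k := by rw [hκs]; push_cast; rfl
  rw [← hbc, hκsk]
  field_simp

/-! ### The Cauchy transform of the density together with the point masses -/

/-- The contribution of the four point masses to the Cauchy transform. -/
theorem point_masses_cauchy {z : ℂ} (hz : ‖z‖ ≠ 1) (A B : ℂ) (ζ : Circle) :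
    (A * (ζ : ℂ).im + B * (ζ : ℂ).re) * (cauchyKernel z ζ + cauchyKernel z (-ζ))
      + (A * (ζ : ℂ).im - B * (ζ : ℂ).re) * (cauchyKernel z ζ⁻¹ + cauchyKernel z (-ζ⁻¹))
      = 2 * (ζ : ℂ).im * (((A - Complex.I * B) * (ζ : ℂ).re - A * z)
        / (1 + z ^ 2 - 2 * z * (ζ : ℂ).re)
        + (-(A - Complex.I * B) * (ζ : ℂ).re - A * z) / (1 + z ^ 2 + 2 * z * (ζ : ℂ).re)) := by
  have h1 := cauchy_pair hz A B ζ
  have h2 := cauchy_pair hz A B (-ζ⁻¹)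
  have hre : ((-ζ⁻¹ : Circle) : ℂ).re = -(ζ : ℂ).re := by
    rw [Circle.coe_neg, Circle.coe_inv_eq_conj, Complex.neg_re, Complex.conj_re]
  have him : ((-ζ⁻¹ : Circle) : ℂ).im = (ζ : ℂ).im := by
    rw [Circle.coe_neg, Circle.coe_inv_eq_conj, Complex.neg_im, Complex.conj_im, neg_neg]
  have hinv : (-ζ⁻¹)⁻¹ = -ζ := by rw [inv_neg, inv_inv]
  rw [hre, him, hinv, Complex.ofReal_neg] at h2
  rw [show 1 + z ^ 2 - 2 * z * -((ζ : ℂ).re : ℂ) = 1 + z ^ 2 + 2 * z * (ζ : ℂ).re by ring] at h2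
  rw [cauchyKernel_apply hz, cauchyKernel_apply hz, cauchyKernel_apply hz, cauchyKernel_apply hz]
  linear_combination h1 + h2

/-- The algebra behind the Cauchy transform: the branch `η` of the decay rate enters only through
its quadratic equation. -/
theorem green_identity (D A : ℂ) {k X r ρ z η : ℂ} (hk : k ≠ 0) (hX : X ≠ 0)
    (hr : r ≠ 0) (h1 : 1 + z ^ 2 - 2 * z * X ≠ 0) (h2 : 1 + z ^ 2 + 2 * z * X ≠ 0)
    (hden : ρ * (1 + z ^ 2) - 2 * r * z * (η * z) ≠ 0) (hkr : 2 * r - ρ ^ 2 = k ^ 2)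
    (hkX : k * X = r) (hη : (1 + z ^ 2) * η = ρ * (1 + η ^ 2 * z ^ 2)) :
    (k ^ 2)⁻¹ * ((4 * z ^ 2 * (A * z) - 2 * z * D * (1 + z ^ 2))
          / ((1 + z ^ 2) ^ 2 - 4 * z ^ 2 * X ^ 2) * (η * ρ / 2)
        + (2 * z * D * X ^ 2 - A * z * (1 + z ^ 2))
          / (X * ((1 + z ^ 2) ^ 2 - 4 * z ^ 2 * X ^ 2)) * (ρ ^ 2 / k))
      + (r - ρ ^ 2) / (k ^ 2 * r) * ((D * X - A * z) / (1 + z ^ 2 - 2 * z * X)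
        + (-D * X - A * z) / (1 + z ^ 2 + 2 * z * X))
      = (ρ * (1 + z ^ 2) - 2 * r * z * (η * z))⁻¹ * (D * (η * z) - A / r * ρ * z) := by
  have hW : (1 + z ^ 2) ^ 2 - 4 * z ^ 2 * X ^ 2 ≠ 0 := by
    have := mul_ne_zero h1 h2
    convert this using 1
    ring
  have e1 : (D * X - A * z) / (1 + z ^ 2 - 2 * z * X) + (-D * X - A * z) / (1 + z ^ 2 + 2 * z * X)
      = 2 * (2 * z * D * X ^ 2 - A * z * (1 + z ^ 2)) / ((1 + z ^ 2) ^ 2 - 4 * z ^ 2 * X ^ 2) := by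
    rw [div_add_div _ _ h1 h2, div_eq_div_iff (mul_ne_zero h1 h2) hW]
    ring
  have e2 : (k ^ 2)⁻¹ * ((4 * z ^ 2 * (A * z) - 2 * z * D * (1 + z ^ 2))
          / ((1 + z ^ 2) ^ 2 - 4 * z ^ 2 * X ^ 2) * (η * ρ / 2)
        + (2 * z * D * X ^ 2 - A * z * (1 + z ^ 2))
          / (X * ((1 + z ^ 2) ^ 2 - 4 * z ^ 2 * X ^ 2)) * (ρ ^ 2 / k))
      + (r - ρ ^ 2) / (k ^ 2 * r) * (2 * (2 * z * D * X ^ 2 - A * z * (1 + z ^ 2))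
        / ((1 + z ^ 2) ^ 2 - 4 * z ^ 2 * X ^ 2))
      = ((2 * z ^ 2 * (A * z) - z * D * (1 + z ^ 2)) * η * ρ * r
          + (2 * z * D * X ^ 2 - A * z * (1 + z ^ 2)) * k ^ 2)
        / (r * (k ^ 2 * ((1 + z ^ 2) ^ 2 - 4 * z ^ 2 * X ^ 2))) := by
    generalize (1 + z ^ 2) ^ 2 - 4 * z ^ 2 * X ^ 2 = W at *
    rw [← hkr, ← hkX]
    rw [← hkX] at hkr hr
    rw [hkr]
    field_simp
    linear_combination (2 * (2 * z * D * X ^ 2 - A * z * (1 + z ^ 2))) * hkr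
  have e3 : (ρ * (1 + z ^ 2) - 2 * r * z * (η * z))⁻¹ * (D * (η * z) - A / r * ρ * z)
      = (D * η * z * r - A * z * ρ) / (r * (ρ * (1 + z ^ 2) - 2 * r * z * (η * z))) := by
    generalize ρ * (1 + z ^ 2) - 2 * r * z * (η * z) = G at *
    field_simp
  rw [e1, e2, e3, div_eq_div_iff (mul_ne_zero hr (mul_ne_zero (pow_ne_zero 2 hk) hW))
    (mul_ne_zero hr hden)]
  have hkX2 : k ^ 2 * X ^ 2 = r ^ 2 := by rw [← hkX]; ring
  linear_combination r * ((-2 * z * r ^ 2 * (1 + z ^ 2) * D + 4 * z ^ 2 * r ^ 2 * (A * z)) * hη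
    - (-z * r * (1 + z ^ 2) ^ 2 * η * D + 2 * z ^ 2 * r * η * (1 + z ^ 2) * (A * z)) * hkr
    + (2 * z * D * (ρ * (1 + z ^ 2) - 2 * r * z ^ 2 * η)
      + 4 * z ^ 2 * (D * η * z * r - A * z * ρ)) * hkX2)

section Parameters

variable {ρ s : ℝ}

theorem spectral_radicand_pos (hs : ρ ^ 2 < 1 - s) : 0 < 2 - 2 * s - ρ ^ 2 := by
  nlinarith

/-- The condition `x_* < 1`, squared. -/
theorem one_sub_sq_lt (hs' : s ^ 2 < 1 - ρ ^ 2) : (1 - s) ^ 2 < 2 - 2 * s - ρ ^ 2 := by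
  nlinarith

/-- The abscissa `x_*` of the eigenvalues. -/
def eigenAbscissa (ρ s : ℝ) : ℝ := (1 - s) / √(2 - 2 * s - ρ ^ 2)

theorem sqrt_mul_eigenAbscissa (hs : ρ ^ 2 < 1 - s) :
    √(2 - 2 * s - ρ ^ 2) * eigenAbscissa ρ s = 1 - s := by
  have := Real.sqrt_pos.mpr (spectral_radicand_pos hs)
  rw [eigenAbscissa, mul_div_cancel₀ _ this.ne']

theorem radicand_mul_eigenAbscissa_sq (hs : ρ ^ 2 < 1 - s) :
    (2 - 2 * s - ρ ^ 2) * eigenAbscissa ρ s ^ 2 = (1 - s) ^ 2 := by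
  rw [← sqrt_mul_eigenAbscissa hs, mul_pow, Real.sq_sqrt (spectral_radicand_pos hs).le]

theorem lt_sqrt_radicand (hs : ρ ^ 2 < 1 - s) : ρ < √(2 - 2 * s - ρ ^ 2) :=
  Real.lt_sqrt_of_sq_lt (by nlinarith)

theorem two_mul_sqrt_mul_eigenAbscissa (hs : ρ ^ 2 < 1 - s) :
    2 * √(2 - 2 * s - ρ ^ 2) * eigenAbscissa ρ s = √(2 - 2 * s - ρ ^ 2) ^ 2 + ρ ^ 2 := by
  rw [mul_assoc, sqrt_mul_eigenAbscissa hs, Real.sq_sqrt (spectral_radicand_pos hs).le]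
  ring

theorem lt_eigenAbscissa (hρ0 : 0 < ρ) (hs : ρ ^ 2 < 1 - s) : ρ < eigenAbscissa ρ s := by
  have h1 := two_mul_sqrt_mul_eigenAbscissa hs
  have h2 := lt_sqrt_radicand hs
  nlinarith [mul_pos (sub_pos.mpr h2) (sub_pos.mpr h2)]

theorem eigenAbscissa_lt_one (hs : ρ ^ 2 < 1 - s) (hs' : s ^ 2 < 1 - ρ ^ 2) :
    eigenAbscissa ρ s < 1 := by
  have h := Real.sqrt_pos.mpr (spectral_radicand_pos hs)
  rw [eigenAbscissa, div_lt_one h]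
  exact Real.lt_sqrt_of_sq_lt (one_sub_sq_lt hs')

theorem one_sub_eigenAbscissa_sq (hs : ρ ^ 2 < 1 - s) :
    1 - eigenAbscissa ρ s ^ 2 = (1 - ρ ^ 2 - s ^ 2) / (2 - 2 * s - ρ ^ 2) := by
  have h := spectral_radicand_pos hs
  rw [eq_div_iff h.ne']
  linear_combination (-1 : ℝ) * radicand_mul_eigenAbscissa_sq hs

theorem sqrt_eigenAbscissa_sq_sub (hs : ρ ^ 2 < 1 - s) :
    √(eigenAbscissa ρ s ^ 2 - ρ ^ 2) = (1 - s - ρ ^ 2) / √(2 - 2 * s - ρ ^ 2) := by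
  have h := spectral_radicand_pos hs
  have h1 : 0 ≤ (1 - s - ρ ^ 2) / √(2 - 2 * s - ρ ^ 2) :=
    div_nonneg (by linarith) (Real.sqrt_nonneg _)
  rw [← Real.sqrt_sq h1, div_pow, Real.sq_sqrt h.le]
  congr 1
  rw [eq_div_iff h.ne']
  linear_combination radicand_mul_eigenAbscissa_sq hs

/-- The common factor of the point masses, for eigenvalues with imaginary parts `±y`. -/
def pointWeight (ρ s y : ℝ) : ℝ :=
  eigenAbscissa ρ s * √(eigenAbscissa ρ s ^ 2 - ρ ^ 2) / (2 * y * (1 - s) ^ 2)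

/-- The square roots in the point masses cancel, since `√(x_*² - ρ²)` is rational in
`√(2 - 2s - ρ²)`. -/
theorem pointWeight_mul {y : ℝ} (hs : ρ ^ 2 < 1 - s) (hy : y ≠ 0) :
    pointWeight ρ s y * (2 * y) = (1 - s - ρ ^ 2) / ((2 - 2 * s - ρ ^ 2) * (1 - s)) := by
  have h := spectral_radicand_pos hs
  have hk := Real.sqrt_pos.mpr h
  have hr : 0 < 1 - s := by nlinarith
  rw [pointWeight, sqrt_eigenAbscissa_sq_sub hs, eigenAbscissa]
  nth_rw 3 [← Real.sq_sqrt h.le]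
  field_simp

/-- The Cauchy transform of the density plus the point masses. -/
theorem cauchy_transform_density (hρ0 : 0 < ρ) (hs : ρ ^ 2 < 1 - s) (hs' : s ^ 2 < 1 - ρ ^ 2)
    (A B : ℂ) {ζ : Circle} (hre : (ζ : ℂ).re = eigenAbscissa ρ s) (him : (ζ : ℂ).im ≠ 0)
    {z η : ℂ} (hz : ‖z‖ ≠ 1) (hκ : ‖η * z‖ < 1)
    (hη : (1 + z ^ 2) * η = ρ * (1 + η ^ 2 * z ^ 2)) :
    (∫ ξ, cauchyKernel z ξ * density ρ s A B ξ ∂circleLebesgue)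
      + pointWeight ρ s (ζ : ℂ).im *
        ((A * (ζ : ℂ).im + B * (ζ : ℂ).re) * (cauchyKernel z ζ + cauchyKernel z (-ζ))
        + (A * (ζ : ℂ).im - B * (ζ : ℂ).re) * (cauchyKernel z ζ⁻¹ + cauchyKernel z (-ζ⁻¹)))
      = (ρ * (1 + z ^ 2) - 2 * (1 - s) * z * (η * z))⁻¹
        * ((A - Complex.I * B) * (η * z) - A / (1 - s) * ρ * z) := by
  have hρ1 : ρ < 1 := by nlinarith [sq_nonneg s]
  have hm := spectral_radicand_pos hs
  have hkρ := lt_sqrt_radicand hs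
  have hkk : √(2 - 2 * s - ρ ^ 2) ^ 2 = 2 - 2 * s - ρ ^ 2 := Real.sq_sqrt hm.le
  have hkX := sqrt_mul_eigenAbscissa hs
  have hkX2 := two_mul_sqrt_mul_eigenAbscissa hs
  have hX1 := eigenAbscissa_lt_one hs hs'
  have hXρ := lt_eigenAbscissa hρ0 hs
  have hpw : (pointWeight ρ s (ζ : ℂ).im : ℂ) * (2 * (ζ : ℂ).im)
      = (1 - s - ρ ^ 2) / ((2 - 2 * s - ρ ^ 2) * (1 - s)) := by
    have := pointWeight_mul hs him
    exact_mod_cast congrArg ((↑) : ℝ → ℂ) this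
  have hden := green_denominator_ne_zero hρ0 hm (one_sub_sq_lt hs') hz (κ := η * z)
    (by linear_combination z * hη)
  have hI := integral_partial_fractions hρ0 hkρ hkX2 hX1 hz hκ hη (A - Complex.I * B) (A * z)
  rw [integral_cauchy_density hρ0 hρ1 hs A B hz, point_masses_cauchy hz, hre]
  have n1 := joukowsky_ne_zero hz (x := eigenAbscissa ρ s) (by rwa [abs_of_pos (hρ0.trans hXρ)])
  have n2 := joukowsky_ne_zero hz (x := -eigenAbscissa ρ s)
    (by rwa [abs_neg, abs_of_pos (hρ0.trans hXρ)])
  rw [Complex.ofReal_neg, mul_neg, sub_neg_eq_add] at n2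
  have hfac : ∀ x ∈ Set.Ioo (-ρ) ρ,
      ((√(ρ ^ 2 - x ^ 2) / ((1 - s) ^ 2 - (2 - 2 * s - ρ ^ 2) * x ^ 2) : ℝ) : ℂ)
          * (((A - Complex.I * B) * x - A * z) / (1 + z ^ 2 - 2 * z * x))
      = ((2 - 2 * s - ρ ^ 2 : ℝ) : ℂ)⁻¹ * (((√(ρ ^ 2 - x ^ 2) : ℝ) : ℂ)
          / (eigenAbscissa ρ s ^ 2 - x ^ 2)
          * (((A - Complex.I * B) * x - A * z) / (1 + z ^ 2 - 2 * z * x))) := by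
    intro x _
    rw [← radicand_mul_eigenAbscissa_sq hs, ← mul_sub, ← mul_assoc]
    congr 1
    push_cast
    rw [inv_mul_eq_div, div_div, mul_comm (_ - _ : ℂ)]
  rw [setIntegral_congr_fun measurableSet_Ioo hfac, integral_const_mul, mul_left_comm, hI,
    ← mul_assoc (pointWeight ρ s (ζ : ℂ).im : ℂ), hpw]
  have hr0 : ((1 : ℂ) - s) ≠ 0 := by
    have : (1 - s : ℝ) ≠ 0 := by nlinarith
    exact_mod_cast this
  have hk0 : ((√(2 - 2 * s - ρ ^ 2) : ℝ) : ℂ) ≠ 0 :=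
    Complex.ofReal_ne_zero.mpr (hρ0.trans hkρ).ne'
  have hX0 : ((eigenAbscissa ρ s : ℝ) : ℂ) ≠ 0 := Complex.ofReal_ne_zero.mpr (hρ0.trans hXρ).ne'
  have hkXc : ((√(2 - 2 * s - ρ ^ 2) : ℝ) : ℂ) * (eigenAbscissa ρ s : ℝ) = 1 - s := by
    exact_mod_cast congrArg ((↑) : ℝ → ℂ) hkX
  have hkkc : ((2 : ℂ) - 2 * s - ρ ^ 2) = ((√(2 - 2 * s - ρ ^ 2) : ℝ) : ℂ) ^ 2 := by
    exact_mod_cast congrArg ((↑) : ℝ → ℂ) hkk.symm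
  have key := green_identity (A - Complex.I * B) A hk0 hX0 hr0 n1 n2 hden
    (by linear_combination hkkc) hkXc hη
  rw [← hkkc] at key
  rw [show ((2 - 2 * s - ρ ^ 2 : ℝ) : ℂ) = (2 : ℂ) - 2 * s - ρ ^ 2 by push_cast; rfl]
  exact key

end Parameters

/-! ### The spectral matrix measure -/

/-- The matrix measure with prescribed entries. -/
def MatMeasure.ofEntries (m : Matrix (Fin 2) (Fin 2) (ComplexMeasure Circle)) : MatMeasure where
  measureOf' A := Matrix.of fun i j => m i j A
  empty' := by
    ext i j
    simp
  not_measurable' A hA := by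
    ext i j
    simp [VectorMeasure.not_measurable _ hA]
  m_iUnion' f hf hd := by
    refine Pi.hasSum.mpr fun i => Pi.hasSum.mpr fun j => ?_
    exact (m i j).m_iUnion hf hd

theorem MatMeasure.ofEntries_apply (m : Matrix (Fin 2) (Fin 2) (ComplexMeasure Circle))
    (A : Set Circle) : MatMeasure.ofEntries m A = Matrix.of fun i j => m i j A := rfl

theorem MatMeasure.entry_ofEntries (m : Matrix (Fin 2) (Fin 2) (ComplexMeasure Circle))
    (i j : Fin 2) : (MatMeasure.ofEntries m).entry i j = m i j :=
  VectorMeasure.ext fun _ _ => rfl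

/-- The complex measure with density `density ρ s A B` and point masses at `±ζ` and `±ζ⁻¹`. -/
def entryMeasure (ρ s : ℝ) (ζ : Circle) (A B : ℂ) : ComplexMeasure Circle :=
  circleLebesgue.withDensityᵥ (density ρ s A B)
    + ((VectorMeasure.dirac ζ (pointWeight ρ s (ζ : ℂ).im * (A * (ζ : ℂ).im + B * (ζ : ℂ).re))
    + VectorMeasure.dirac (-ζ) (pointWeight ρ s (ζ : ℂ).im * (A * (ζ : ℂ).im + B * (ζ : ℂ).re)))
    + (VectorMeasure.dirac ζ⁻¹ (pointWeight ρ s (ζ : ℂ).im * (A * (ζ : ℂ).im - B * (ζ : ℂ).re))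
    + VectorMeasure.dirac (-ζ⁻¹) (pointWeight ρ s (ζ : ℂ).im * (A * (ζ : ℂ).im - B * (ζ : ℂ).re))))

theorem dirac_eq_mul_diracMass (ζ : Circle) (c : ℂ) {S : Set Circle} (hS : MeasurableSet S) :
    VectorMeasure.dirac ζ c S = c * diracMass ζ S := by
  by_cases h : ζ ∈ S
  · simp [VectorMeasure.dirac_apply_of_mem hS h, diracMass, h]
  · simp [VectorMeasure.dirac_apply_of_notMem h, diracMass, h]

theorem entryMeasure_apply {ρ s : ℝ} (hρ : 0 < ρ) (hs : ρ ^ 2 < 1 - s) (ζ : Circle) (A B : ℂ)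
    {S : Set Circle} (hS : MeasurableSet S) :
    entryMeasure ρ s ζ A B S = (∫ ξ in S, density ρ s A B ξ ∂circleLebesgue)
      + pointWeight ρ s (ζ : ℂ).im * (diracMass ζ S + diracMass (-ζ) S)
        * (A * (ζ : ℂ).im + B * (ζ : ℂ).re)
      + pointWeight ρ s (ζ : ℂ).im * (diracMass ζ⁻¹ S + diracMass (-ζ⁻¹) S)
        * (A * (ζ : ℂ).im - B * (ζ : ℂ).re) := by
  simp only [entryMeasure, add_apply, dirac_eq_mul_diracMass _ _ hS]
  rw [withDensityᵥ_apply (integrable_density hρ hs A B) hS]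
  ring

theorem integralCLM_add (c d : ComplexMeasure Circle) (φ : C(Circle, ℂ)) :
    integralCLM (c + d) φ = integralCLM c φ + integralCLM d φ :=
  VectorMeasure.integral_add_vectorMeasure (integrable_of_continuous c φ)
    (integrable_of_continuous d φ)

theorem integralCLM_dirac (ζ : Circle) (a : ℂ) (φ : C(Circle, ℂ)) :
    integralCLM (VectorMeasure.dirac ζ a) φ = φ ζ * a := by
  rw [integralCLM_apply, VectorMeasure.integral_dirac]
  rfl

theorem integralCLM_entryMeasure {ρ s : ℝ} (hρ : 0 < ρ) (hs : ρ ^ 2 < 1 - s) (ζ : Circle)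
    (A B : ℂ) (φ : C(Circle, ℂ)) :
    integralCLM (entryMeasure ρ s ζ A B) φ = (∫ ξ, φ ξ * density ρ s A B ξ ∂circleLebesgue)
      + pointWeight ρ s (ζ : ℂ).im *
        ((A * (ζ : ℂ).im + B * (ζ : ℂ).re) * (φ ζ + φ (-ζ))
        + (A * (ζ : ℂ).im - B * (ζ : ℂ).re) * (φ ζ⁻¹ + φ (-ζ⁻¹))) := by
  simp only [entryMeasure, integralCLM_add, integralCLM_dirac,
    integral_withDensityᵥ (integrable_density hρ hs A B)]
  ring

/-- The part of the spectral weight that is even under `ζ ↦ ζ⁻¹`. -/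
def evenPart (s : ℝ) : Mat := !![1 - (s : ℂ), 0; 0, 1 - (s : ℂ)]

/-- The part of the spectral weight that is odd under `ζ ↦ ζ⁻¹`. -/
def oddPart (α₀ β : ℂ) (t : ℝ) : Mat :=
  !![(t : ℂ), -(Complex.I * conj α₀ * β); Complex.I * α₀ * conj β, -(t : ℂ)]

/-- The spectral matrix measure of the walk. -/
def spectralMeasure (α₀ β : ℂ) (ρ s t : ℝ) (ζ : Circle) : MatMeasure :=
  MatMeasure.ofEntries (Matrix.of fun i j =>
    entryMeasure ρ s ζ (evenPart s i j) (oddPart α₀ β t i j))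

theorem spectralMeasure_apply {ρ s : ℝ} (hρ : 0 < ρ) (hs : ρ ^ 2 < 1 - s) (α₀ β : ℂ) (t : ℝ)
    (ζ : Circle) {S : Set Circle} (hS : MeasurableSet S) :
    spectralMeasure α₀ β ρ s t ζ S
      = Matrix.of (fun i j => ∫ ξ in S, density ρ s (evenPart s i j) (oddPart α₀ β t i j) ξ
          ∂circleLebesgue)
        + (pointWeight ρ s (ζ : ℂ).im * (diracMass ζ S + diracMass (-ζ) S)) •
          (((ζ : ℂ).im : ℂ) • evenPart s + ((ζ : ℂ).re : ℂ) • oddPart α₀ β t)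
        + (pointWeight ρ s (ζ : ℂ).im * (diracMass ζ⁻¹ S + diracMass (-ζ⁻¹) S)) •
          (((ζ : ℂ).im : ℂ) • evenPart s - ((ζ : ℂ).re : ℂ) • oddPart α₀ β t) := by
  ext i j
  rw [spectralMeasure, MatMeasure.ofEntries_apply]
  simp only [Matrix.of_apply, Matrix.add_apply, Matrix.smul_apply, Matrix.sub_apply, smul_eq_mul]
  rw [entryMeasure_apply hρ hs ζ _ _ hS]
  ring

theorem posSemidef_of_sq_le {a d : ℝ} {b : ℂ} (had : 0 ≤ a + d) (h : ‖b‖ ^ 2 ≤ a * d) :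
    (!![(a : ℂ), b; conj b, (d : ℂ)] : Mat).PosSemidef := by
  have ha : 0 ≤ a := by nlinarith [sq_nonneg ‖b‖, sq_nonneg (a - d)]
  have hd : 0 ≤ d := by nlinarith [sq_nonneg ‖b‖, sq_nonneg (a - d)]
  refine Matrix.PosSemidef.of_dotProduct_mulVec_nonneg ?_ fun v => ?_
  · ext i j
    fin_cases i <;> fin_cases j <;> simp
  · have e : star v ⬝ᵥ (!![(a : ℂ), b; conj b, (d : ℂ)] : Mat).mulVec v
        = ((a * ‖v 0‖ ^ 2 + d * ‖v 1‖ ^ 2 + 2 * (conj (v 0) * b * v 1).re : ℝ) : ℂ) := by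
      have h2 : ((2 * (conj (v 0) * b * v 1).re : ℝ) : ℂ)
          = conj (v 0) * b * v 1 + v 0 * conj b * conj (v 1) := by
        rw [← Complex.add_conj]
        simp
      have h0 := Complex.mul_conj' (v 0)
      have h1 := Complex.mul_conj' (v 1)
      rw [Complex.ofReal_add, h2]
      simp only [dotProduct, Fin.sum_univ_two, Matrix.mulVec, Pi.star_apply, RCLike.star_def]
      push_cast
      simp only [Matrix.of_apply, Matrix.cons_val', Matrix.cons_val_zero, Matrix.cons_val_one,
        Matrix.cons_val_fin_one]
      linear_combination a * h0 + d * h1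
    rw [e]
    have hre : -(‖v 0‖ * ‖b‖ * ‖v 1‖) ≤ (conj (v 0) * b * v 1).re := by
      have := Complex.abs_re_le_norm (conj (v 0) * b * v 1)
      rw [norm_mul, norm_mul, Complex.norm_conj] at this
      exact (abs_le.mp this).1
    have hb : ‖b‖ ≤ √a * √d := by
      rw [← Real.sqrt_mul ha]
      exact Real.le_sqrt_of_sq_le h
    have hfin : 0 ≤ a * ‖v 0‖ ^ 2 + d * ‖v 1‖ ^ 2 + 2 * (conj (v 0) * b * v 1).re := by
      have h3 : ‖v 0‖ * ‖b‖ * ‖v 1‖ ≤ ‖v 0‖ * (√a * √d) * ‖v 1‖ := by gcongr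
      have h4 := sq_nonneg (√a * ‖v 0‖ - √d * ‖v 1‖)
      have h5 := Real.sq_sqrt ha
      have h6 := Real.sq_sqrt hd
      nlinarith
    exact_mod_cast hfin

/-- The spectral weight `u E + v O` is positive as long as its determinant is nonnegative. -/
theorem posSemidef_weight {α₀ β : ℂ} {s t u v : ℝ} (hs : s < 1) (hu : 0 ≤ u)
    (h : (t ^ 2 + ‖α₀‖ ^ 2 * ‖β‖ ^ 2) * v ^ 2 ≤ (1 - s) ^ 2 * u ^ 2) :
    ((u : ℂ) • evenPart s + (v : ℂ) • oddPart α₀ β t).PosSemidef := by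
  have e : (u : ℂ) • evenPart s + (v : ℂ) • oddPart α₀ β t
      = !![(((1 - s) * u + t * v : ℝ) : ℂ), -(Complex.I * conj α₀ * β * v);
          conj (-(Complex.I * conj α₀ * β * v)), (((1 - s) * u - t * v : ℝ) : ℂ)] := by
    ext i j
    fin_cases i <;> fin_cases j <;> simp [evenPart, oddPart] <;> ring
  rw [e]
  refine posSemidef_of_sq_le ?_ ?_
  · nlinarith
  · rw [norm_neg, norm_mul, norm_mul, norm_mul, Complex.norm_I, Complex.norm_conj,
      Complex.norm_real, Real.norm_eq_abs, mul_pow, mul_pow, sq_abs]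
    nlinarith

theorem posSemidef_setIntegral {K : Circle → Mat} (hK : ∀ ζ, (K ζ).PosSemidef)
    (hint : ∀ i j, Integrable (fun ζ => K ζ i j) circleLebesgue) (S : Set Circle) :
    (Matrix.of fun i j => ∫ ζ in S, K ζ i j ∂circleLebesgue).PosSemidef := by
  have hint' (i j : Fin 2) : Integrable (fun ζ => K ζ i j) (circleLebesgue.restrict S) :=
    (hint i j).restrict
  refine Matrix.PosSemidef.of_dotProduct_mulVec_nonneg ?_ fun v => ?_
  · ext i j
    change star (∫ ζ in S, K ζ j i ∂circleLebesgue) = ∫ ζ in S, K ζ i j ∂circleLebesgue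
    rw [RCLike.star_def, ← integral_conj]
    refine integral_congr_ae (Filter.Eventually.of_forall fun ζ => ?_)
    exact congrFun (congrFun (hK ζ).isHermitian i) j
  · have e : star v ⬝ᵥ (Matrix.of fun i j => ∫ ζ in S, K ζ i j ∂circleLebesgue).mulVec v
        = ∫ ζ in S, star v ⬝ᵥ (K ζ).mulVec v ∂circleLebesgue := by
      simp only [dotProduct, Matrix.mulVec, Matrix.of_apply]
      rw [integral_finsetSum]
      · refine Finset.sum_congr rfl fun i _ => ?_
        rw [integral_const_mul, integral_finsetSum]
        · simp only [integral_mul_const]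
        · exact fun j _ => (hint' i j).mul_const _
      · exact fun i _ => (integrable_finsetSum _ fun j _ => (hint' i j).mul_const _).const_mul _
    rw [e]
    exact integral_nonneg fun ζ => (hK ζ).dotProduct_mulVec_nonneg v

theorem density_eq_weight (ρ s : ℝ) (M N : Mat) (ζ : Circle) (i j : Fin 2) :
    density ρ s (M i j) (N i j) ζ
      = (((√(ρ ^ 2 - (ζ : ℂ).re ^ 2) / ((1 - s) ^ 2 - (2 - 2 * s - ρ ^ 2) * (ζ : ℂ).re ^ 2) : ℝ) : ℂ)
        • (((|(ζ : ℂ).im| : ℝ) : ℂ) • M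
          + ((Real.sign (ζ : ℂ).im * (ζ : ℂ).re : ℝ) : ℂ) • N)) i j := by
  simp only [density, Matrix.add_apply, Matrix.smul_apply, smul_eq_mul]
  push_cast
  ring

theorem diracMass_nonneg (ζ : Circle) (S : Set Circle) : 0 ≤ diracMass ζ S := by
  by_cases h : ζ ∈ S <;> simp [diracMass, h]

theorem pointWeight_nonneg {ρ s y : ℝ} (hρ : 0 < ρ) (hs : ρ ^ 2 < 1 - s) (hy : 0 ≤ y) :
    0 ≤ pointWeight ρ s y := by
  have := hρ.trans (lt_eigenAbscissa hρ hs)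
  rw [pointWeight]
  positivity

/-- Positivity: the determinant of the weight is `(1-s)² - (2-2s-ρ²) x²`, which is positive on the
support of the density and vanishes at the eigenvalues. -/
theorem spectralMeasure_isPositive {α₀ β : ℂ} {ρ s t : ℝ} (hρ : 0 < ρ) (hs : ρ ^ 2 < 1 - s)
    (hdet : t ^ 2 + ‖α₀‖ ^ 2 * ‖β‖ ^ 2 = 1 - ρ ^ 2 - s ^ 2) {ζ : Circle}
    (hre : (ζ : ℂ).re = eigenAbscissa ρ s) (him : 0 ≤ (ζ : ℂ).im) :
    (spectralMeasure α₀ β ρ s t ζ).IsPositive := by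
  intro S hS
  have hs1 : s < 1 := by nlinarith
  have hweight {x y : ℝ} (hxy : x ^ 2 + y ^ 2 = 1)
      (h : 0 ≤ (1 - s) ^ 2 - (2 - 2 * s - ρ ^ 2) * x ^ 2) :
      (t ^ 2 + ‖α₀‖ ^ 2 * ‖β‖ ^ 2) * x ^ 2 ≤ (1 - s) ^ 2 * y ^ 2 := by
    rw [hdet, show y ^ 2 = 1 - x ^ 2 by linarith]
    linarith
  have hζ : 0 ≤ (1 - s) ^ 2 - (2 - 2 * s - ρ ^ 2) * (ζ : ℂ).re ^ 2 := by
    rw [hre, radicand_mul_eigenAbscissa_sq hs, sub_self]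
  have hpt (ξ ξ' : Circle) :
      0 ≤ (pointWeight ρ s (ζ : ℂ).im : ℂ) * (diracMass ξ S + diracMass ξ' S) :=
    mul_nonneg (by exact_mod_cast pointWeight_nonneg hρ hs him)
      (add_nonneg (diracMass_nonneg _ _) (diracMass_nonneg _ _))
  rw [spectralMeasure_apply hρ hs α₀ β t ζ hS]
  refine Matrix.PosSemidef.add (Matrix.PosSemidef.add ?_ ?_) ?_
  · simp only [density_eq_weight]
    refine posSemidef_setIntegral (K := fun ζ => ((√(ρ ^ 2 - (ζ : ℂ).re ^ 2)
        / ((1 - s) ^ 2 - (2 - 2 * s - ρ ^ 2) * (ζ : ℂ).re ^ 2) : ℝ) : ℂ)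
      • (((|(ζ : ℂ).im| : ℝ) : ℂ) • evenPart s
          + ((Real.sign (ζ : ℂ).im * (ζ : ℂ).re : ℝ) : ℂ) • oddPart α₀ β t)) (fun ξ => ?_)
      (fun i j => ?_) S
    · rcases le_or_gt ρ |(ξ : ℂ).re| with h | h
      · have h1 : ρ ^ 2 - (ξ : ℂ).re ^ 2 ≤ 0 := by
          rw [sub_nonpos, ← sq_abs (ξ : ℂ).re]
          exact pow_le_pow_left₀ hρ.le h 2
        rw [Real.sqrt_eq_zero_of_nonpos h1, zero_div, Complex.ofReal_zero, zero_smul]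
        exact Matrix.PosSemidef.zero
      · have hden := (sq_nonneg _).trans
          (spectral_denominator_ge (s := s) (spectral_radicand_pos hs) h.le)
        refine Matrix.PosSemidef.smul (posSemidef_weight hs1 (abs_nonneg _) ?_) ?_
        · rw [sq_abs, mul_pow]
          have hsg : Real.sign (ξ : ℂ).im ^ 2 ≤ 1 := by
            rcases Real.sign_apply_eq (ξ : ℂ).im with h | h | h <;> rw [h] <;> norm_num
          refine le_trans ?_ (hweight (circle_re_sq_add_im_sq ξ) hden)
          refine mul_le_mul_of_nonneg_left ?_ (by positivity)
          exact mul_le_of_le_one_left (sq_nonneg _) hsg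
        · exact_mod_cast div_nonneg (Real.sqrt_nonneg _) hden
    · simp only [← density_eq_weight]
      exact integrable_density hρ hs _ _
  · exact Matrix.PosSemidef.smul
      (posSemidef_weight hs1 him (hweight (circle_re_sq_add_im_sq ζ) hζ)) (hpt _ _)
  · refine Matrix.PosSemidef.smul ?_ (hpt _ _)
    have := posSemidef_weight (α₀ := α₀) (β := β) (s := s) (t := t) (v := -(ζ : ℂ).re) hs1 him
      (by rw [neg_sq]; exact hweight (circle_re_sq_add_im_sq ζ) hζ)
    rwa [Complex.ofReal_neg, neg_smul, ← sub_eq_add_neg] at this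

/-- The Cauchy transform of the spectral measure is the resolvent at the origin. -/
theorem integralCLM_spectralMeasure {α₀ β₀ β : ℂ} {ρ s t : ℝ} (hρ : 0 < ρ) (hs : ρ ^ 2 < 1 - s)
    (hs' : s ^ 2 < 1 - ρ ^ 2) (hst : β₀ * conj β = s + t * Complex.I) {ζ : Circle}
    (hre : (ζ : ℂ).re = eigenAbscissa ρ s) (him : (ζ : ℂ).im ≠ 0) {z η : ℂ} (hz : ‖z‖ ≠ 1)
    (hκ : ‖η * z‖ < 1) (hη : (1 + z ^ 2) * η = ρ * (1 + η ^ 2 * z ^ 2)) (i j : Fin 2) :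
    integralCLM ((spectralMeasure α₀ β ρ s t ζ).entry i j) (cauchyKernel z)
      = greenMatrix α₀ β₀ β ρ s z (η * z) i j := by
  rw [spectralMeasure, MatMeasure.entry_ofEntries, Matrix.of_apply,
    integralCLM_entryMeasure hρ hs, cauchy_transform_density hρ hs hs' _ _ hre him hz hκ hη,
    greenMatrix, Matrix.smul_apply, smul_eq_mul]
  congr 1
  have hst' : conj β₀ * β = s - t * Complex.I := by
    have := congrArg conj hst
    simpa [sub_eq_add_neg] using this
  have hr : (1 : ℂ) - s ≠ 0 := by
    have : (1 - s : ℝ) ≠ 0 := by nlinarith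
    exact_mod_cast this
  have hI := Complex.I_sq
  have hd : (1 - (s : ℂ)) / (1 - s) * ρ * z = ρ * z := by rw [div_self hr, one_mul]
  fin_cases i <;> fin_cases j <;> 
    simp [evenPart, oddPart, hst, hst', hd, -mul_eq_mul_right_iff, -mul_eq_mul_left_iff]
  · ring
  · linear_combination (conj α₀ * β * η * z) * hI
  · linear_combination (-α₀ * conj β * η * z) * hI
  · ring

/-- The four points `±x_* ± i y_*` are eigenvalues of the walk. -/
theorem hasEigenvalue_of_re_eq {α₀ β₀ αp αm β : ℂ} {ρ s : ℝ}
    (h₀ : ‖α₀‖ ^ 2 + ‖β₀‖ ^ 2 = 1) (hp : ‖αp‖ ^ 2 + ‖β‖ ^ 2 = 1) (hm : ‖αm‖ ^ 2 + ‖β‖ ^ 2 = 1)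
    (hα₀ : α₀ ≠ 0) (hρp : ‖αp‖ = ρ) (hρm : ‖αm‖ = ρ) (hρ0 : 0 < ρ) (hρ1 : ρ < 1)
    (hs0 : s = (β₀ * conj β).re) (hs : ρ ^ 2 < 1 - s) {ζ : Circle}
    (hζ : (ζ : ℂ).re = eigenAbscissa ρ s ∨ (ζ : ℂ).re = -eigenAbscissa ρ s) :
    Module.End.HasEigenvalue (walk (twoPhaseCoin (suCoin αp β hp) (suCoin α₀ β₀ h₀)
      (suCoin αm β hm)) : L2 →ₗ[ℂ] L2) (ζ : ℂ) := by
  have hm0 := spectral_radicand_pos hs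
  have hk := Real.sqrt_pos.mpr hm0
  have hkρ := lt_sqrt_radicand hs
  have hsq := Real.sq_sqrt hm0.le
  obtain ⟨σ, hσ, hσρ, hσζ⟩ : ∃ σ : ℝ, σ ^ 2 * (2 - 2 * s - ρ ^ 2) = 1 ∧ |ρ * σ| < 1 ∧
      (ζ : ℂ).re = (1 - s) * σ := by
    have h1 : (√(2 - 2 * s - ρ ^ 2))⁻¹ ^ 2 * (2 - 2 * s - ρ ^ 2) = 1 := by
      rw [inv_pow, hsq, inv_mul_cancel₀ hm0.ne']
    have h2 : |ρ * (√(2 - 2 * s - ρ ^ 2))⁻¹| < 1 := by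
      rw [abs_of_pos (by positivity), ← div_eq_mul_inv, div_lt_one hk]
      exact hkρ
    rcases hζ with h | h
    · exact ⟨(√(2 - 2 * s - ρ ^ 2))⁻¹, h1, h2, h⟩
    · exact ⟨-(√(2 - 2 * s - ρ ^ 2))⁻¹, by rwa [neg_sq], by rwa [mul_neg, abs_neg],
        by rw [h, mul_neg]; rfl⟩
  refine hasEigenvalue_walk h₀ hp hm hα₀ hρp hρm hρ0 hρ1 hs0 hσ hσρ ?_
  have e1 : (ζ : ℂ) + conj (ζ : ℂ) = 2 * ((1 - s) * σ) := by
    rw [Complex.add_conj, hσζ]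
    push_cast
    ring
  have e2 : (ζ : ℂ) * conj (ζ : ℂ) = 1 := by
    rw [Complex.mul_conj, ζ.normSq_coe, Complex.ofReal_one]
  linear_combination (ζ : ℂ) * e1 - e2

end QW

end

theorem theorem5p2
    (α₀ β₀ αp αm β : ℂ) (ρ s t xs ys : ℝ)
    (h₀ : ‖α₀‖ ^ 2 + ‖β₀‖ ^ 2 = 1)
    (hp : ‖αp‖ ^ 2 + ‖β‖ ^ 2 = 1)
    (hm : ‖αm‖ ^ 2 + ‖β‖ ^ 2 = 1)
    (hα₀ : α₀ ≠ 0)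
    (hρp : ‖αp‖ = ρ) (hρm : ‖αm‖ = ρ) (hρ0 : 0 < ρ) (hρ1 : ρ < 1)
    (hs : s = (β₀ * conj β).re) (ht : t = (β₀ * conj β).im)
    (hsβ : |s| < ‖β‖ ^ 2)
    (hxs : xs = (1 - s) / √(2 - 2 * s - ρ ^ 2))
    (hys : ys = √(1 - xs ^ 2))
    (C : QW.Coin)
    (hC : C = QW.twoPhaseCoin (QW.suCoin αp β hp) (QW.suCoin α₀ β₀ h₀) (QW.suCoin αm β hm)) :
    ρ < xs ∧ xs < 1 ∧
    ys = √((1 - ρ ^ 2 - s ^ 2) / (2 - 2 * s - ρ ^ 2)) ∧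
    ∃ ζs : Circle, (ζs : ℂ) = xs + ys * Complex.I ∧
      -- each of the four points `ζs`, `-ζs`, `conj ζs`, `-conj ζs` is an eigenvalue of `U`
      (∀ ζ ∈ ({ζs, -ζs, ζs⁻¹, -ζs⁻¹} : Set Circle),
        Module.End.HasEigenvalue (QW.walk C : QW.L2 →ₗ[ℂ] QW.L2) (ζ : ℂ)) ∧
      ∃ M : QW.MatMeasure,
        QW.IsSpectralMatrixMeasure C M ∧
        (∀ M' : QW.MatMeasure, QW.IsSpectralMatrixMeasure C M' → M' = M) ∧
        ∀ A : Set Circle, MeasurableSet A →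
          M A =
            Matrix.of (fun i j : Fin 2 =>
              ∫ ζ in A ∩ {ζ : Circle | |(ζ : ℂ).re| ≤ ρ},
                (let x : ℝ := (ζ : ℂ).re
                 let y : ℝ := (ζ : ℂ).im
                 ((√(ρ ^ 2 - x ^ 2) / ((1 - s) ^ 2 - (2 - 2 * s - ρ ^ 2) * x ^ 2) : ℝ) : ℂ) *
                  (!![(((1 - s) * |y| + Real.sign y * t * x : ℝ) : ℂ),
                        -(Real.sign y * Complex.I * conj α₀ * β * x);
                      Real.sign y * Complex.I * α₀ * conj β * x,
                        (((1 - s) * |y| - Real.sign y * t * x : ℝ) : ℂ)] : QW.Mat) i j)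
                ∂QW.circleLebesgue)
            + (((xs * √(xs ^ 2 - ρ ^ 2) / (2 * ys * (1 - s) ^ 2) : ℝ) : ℂ) *
                (QW.diracMass ζs A + QW.diracMass (-ζs) A)) •
              (!![(((1 - s) * ys + t * xs : ℝ) : ℂ), -(Complex.I * conj α₀ * β * xs);
                  Complex.I * α₀ * conj β * xs, (((1 - s) * ys - t * xs : ℝ) : ℂ)] : QW.Mat)
            + (((xs * √(xs ^ 2 - ρ ^ 2) / (2 * ys * (1 - s) ^ 2) : ℝ) : ℂ) *
                (QW.diracMass ζs⁻¹ A + QW.diracMass (-ζs⁻¹) A)) •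
              (!![(((1 - s) * ys - t * xs : ℝ) : ℂ), Complex.I * conj α₀ * β * xs;
                  -(Complex.I * α₀ * conj β * xs), (((1 - s) * ys + t * xs : ℝ) : ℂ)] : QW.Mat) := by
  subst hC
  have hβ : ‖β‖ ^ 2 = 1 - ρ ^ 2 := by rw [← hρp]; linarith
  have hsβ' := abs_lt.mp (hβ ▸ hsβ)
  have hs1 : ρ ^ 2 < 1 - s := by linarith [hsβ'.2]
  have hs2 : s ^ 2 < 1 - ρ ^ 2 := by
    have h1 : |s| < 1 := by nlinarith
    rw [← sq_abs s]
    nlinarith [abs_nonneg s]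
  have hst : β₀ * conj β = s + t * Complex.I := by rw [hs, ht, Complex.re_add_im]
  have hdet : t ^ 2 + ‖α₀‖ ^ 2 * ‖β‖ ^ 2 = 1 - ρ ^ 2 - s ^ 2 := by
    have h1 : ‖β₀‖ ^ 2 * ‖β‖ ^ 2 = s ^ 2 + t ^ 2 := by
      rw [← mul_pow, ← Complex.norm_conj β, ← norm_mul, hst, Complex.sq_norm,
        Complex.normSq_add_mul_I]
    have h2 : ‖α₀‖ ^ 2 = 1 - ‖β₀‖ ^ 2 := by linarith
    rw [h2, sub_mul, h1, hβ]
    ring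
  have hX : xs = QW.eigenAbscissa ρ s := hxs
  have hρX : ρ < xs := hX ▸ QW.lt_eigenAbscissa hρ0 hs1
  have hX1 : xs < 1 := hX ▸ QW.eigenAbscissa_lt_one hs1 hs2
  have hyp : 0 < 1 - xs ^ 2 := by nlinarith
  have hys0 : 0 < ys := hys ▸ Real.sqrt_pos.mpr hyp
  have hxy : xs ^ 2 + ys ^ 2 = 1 := by rw [hys, Real.sq_sqrt hyp.le]; ring
  obtain ⟨ζs, hζs⟩ : ∃ ζ : Circle, (ζ : ℂ) = xs + ys * Complex.I := by
    refine ⟨⟨xs + ys * Complex.I, mem_sphere_zero_iff_norm.mpr ?_⟩, rfl⟩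
    rw [Complex.norm_add_mul_I, hxy, Real.sqrt_one]
  have hre : (ζs : ℂ).re = xs := by simp [hζs]
  have him : (ζs : ℂ).im = ys := by simp [hζs]
  have hreX : (ζs : ℂ).re = QW.eigenAbscissa ρ s := hre.trans hX
  refine ⟨hρX, hX1, ?_, ζs, hζs, ?_, QW.spectralMeasure α₀ β ρ s t ζs, ?_⟩
  · rw [hys, hX, QW.one_sub_eigenAbscissa_sq hs1]
  · intro ζ hζ
    refine QW.hasEigenvalue_of_re_eq h₀ hp hm hα₀ hρp hρm hρ0 hρ1 hs hs1 ?_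
    rcases hζ with rfl | rfl | rfl | rfl
    · exact Or.inl hreX
    · exact Or.inr (by rw [Circle.coe_neg, Complex.neg_re, hreX])
    · exact Or.inl (by rw [Circle.coe_inv_eq_conj, Complex.conj_re, hreX])
    · exact Or.inr (by rw [Circle.coe_neg, Circle.coe_inv_eq_conj, Complex.neg_re,
        Complex.conj_re, hreX])
  have hcoin (x : ℤ) : (QW.twoPhaseCoin (QW.suCoin αp β hp) (QW.suCoin α₀ β₀ h₀)
      (QW.suCoin αm β hm) x : QW.Mat) 0 0 ≠ 0 ∧
      (QW.twoPhaseCoin (QW.suCoin αp β hp) (QW.suCoin α₀ β₀ h₀)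
      (QW.suCoin αm β hm) x : QW.Mat) 1 1 ≠ 0 := by
    have hαp : αp ≠ 0 := norm_pos_iff.mp (hρp ▸ hρ0)
    have hαm : αm ≠ 0 := norm_pos_iff.mp (hρm ▸ hρ0)
    unfold QW.twoPhaseCoin
    split_ifs <;> simp [QW.suCoin, hαp, hαm, hα₀]
  have hspec : QW.IsSpectralMatrixMeasure (QW.twoPhaseCoin (QW.suCoin αp β hp)
      (QW.suCoin α₀ β₀ h₀) (QW.suCoin αm β hm)) (QW.spectralMeasure α₀ β ρ s t ζs) := by
    refine QW.isSpectralMatrixMeasure_of_origin _ hcoin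
      (QW.spectralMeasure_isPositive hρ0 hs1 hdet hreX (him ▸ hys0.le)) fun z hz i j => ?_
    obtain ⟨η, hκ, hη⟩ := QW.exists_decay_rate hρ0 hρ1 hz
    rw [QW.integralCLM_spectralMeasure hρ0 hs1 hs2 hst hreX (him ▸ hys0.ne') hz hκ hη,
      QW.walkResolvent_origin h₀ hp hm hρp hρm hρ0 hρ1 hs (QW.spectral_radicand_pos hs1)
        (QW.one_sub_sq_lt hs2) hz hκ (by linear_combination z * hη)]
    simp [QW.originVec]
  refine ⟨hspec, fun M' hM' => hspec.unique hM', fun A hA => ?_⟩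
  rw [QW.spectralMeasure_apply hρ0 hs1 α₀ β t ζs hA]
  have hw : QW.pointWeight ρ s (ζs : ℂ).im
      = xs * √(xs ^ 2 - ρ ^ 2) / (2 * ys * (1 - s) ^ 2) := by
    rw [QW.pointWeight, ← hX, him]
  rw [hw, him, hre]
  refine congrArg₂ (· + ·) (congrArg₂ (· + ·) ?_ (congrArg _ ?_)) (congrArg _ ?_)
  · ext i j
    rw [Matrix.of_apply, Matrix.of_apply]
    -- the density vanishes off `|x| ≤ ρ`
    have hsupp := setIntegral_eq_of_subset_of_forall_sdiff_eq_zero (μ := QW.circleLebesgue)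
      (f := QW.density ρ s (QW.evenPart s i j) (QW.oddPart α₀ β t i j)) hA
      (s := A ∩ {ζ : Circle | |(ζ : ℂ).re| ≤ ρ}) Set.inter_subset_left fun ζ hζ =>
        QW.density_eq_zero hρ0 _ _ (le_of_lt (not_le.mp fun h => hζ.2 ⟨hζ.1, h⟩))
    rw [hsupp]
    refine integral_congr_ae (Filter.Eventually.of_forall fun ζ => ?_)
    simp only [QW.density]
    congr 1
    fin_cases i <;> fin_cases j <;> simp [QW.evenPart, QW.oddPart, -mul_eq_mul_right_iff] <;> ring
  · ext i j
    fin_cases i <;> fin_cases j <;> simp [QW.evenPart, QW.oddPart] <;> ring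
  · ext i j
    fin_cases i <;> fin_cases j <;> simp [QW.evenPart, QW.oddPart] <;> ring
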